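/- Let $d\ge 1$ and let $\Omega\subset\mathbb{R}^d$ be nonempty, closed and bounded with piecewise smooth boundary: $\Omega$ is the closure of its interior, and $\partial\Omega$ is a finite union of compact embedded smooth hypersurface pieces (each the image $\varphi(K)$ of a compact set $K\subset\mathbb{R}^{d-1}$ under a smooth map $\varphi$ that is an injective immersion on $K$, where $\partial K$ is covered by finitely many smooth images of $[0,1]^{d-2}$), such that $\varphi(\operatorname{int}K)$ of one piece never meets another piece. Let $X$ be a random vector in $\mathbb{R}^d$ with a Lebesgue density $f_X:\mathbb{R}^d\to[0,\infty)$. Let $g_\Omega(x)=\operatorname{dist}(x,\partial\Omega)$ for $x\in\Omega$ and $g_\Omega(x)=-\operatorname{dist}(x,\partial\Omega)$ for $x\notin\Omega$, and put $g=g_\Omega(X)$. Suppose that for every $x\in\partial\Omega$ the (finite) limits $$f_X^+(x)=\lim_{x'\to x,\ g_\Omega(x')\ge 0}f_X(x'),\qquad f_X^-(x)=\lim_{x'\to x,\ g_\Omega(x')<0}f_X(x')$$ exist (limits over $x'\neq x$), and let $\tau_f(x)=f_X^+(x)-f_X^-(x)$. For each $x$ let $\gamma(x)\in\partial\Omega$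 be a nearest boundary point (ties broken arbitrarily), let $\Lambda(x)=1$ if $\tau_f(\gamma(x))\ge 0$ and $\Lambda(x)=0$ otherwise, and write $\Lambda=\Lambda(X)$. Let $S$ be the $(d-1)$-dimensional Hausdorff measure (normalized as surface area). Then $\tau_f$ is $S$-integrable on $\partial\Omega$; the conditional laws of $g$ given $\Lambda=1$ and given $\Lambda=0$ have Lebesgue densities $f_{g\mid\Lambda}(\cdot\mid 1)$ and $f_{g\mid\Lambda}(\cdot\mid 0)$, and $(2\Lambda-1)g$ has a Lebesgue density $f_{(2\Lambda-1)g}$; each of these has finite one-sided limits at $0$ (limits up to Lebesgue-null sets, hence independent of the version of the density); and $$\Big[\lim_{\epsilon\to0^+}f_{g\mid\Lambda}(\epsilon\mid 1)-\lim_{\epsilon\to0^-}f_{g\mid\Lambda}(\epsilon\mid 1)\Big]\mathbb{P}(\Lambda=1)-\Big[\lim_{\epsilon\to0^+}f_{g\mid\Lambda}(\epsilon\mid 0)-\lim_{\epsilon\to0^-}f_{g\mid\Lambda}(\epsilon\mid 0)\Big]\mathbb{P}(\Lambda=0)$$ $$=\int_{\partial\Omega}|\tau_f(x)|\,dS=\int_{\partial\Omega}(2\Lambda(x)-1)\,\tau_f(x)\,dS=\lim_{\epsilon\to0^+}f_{(2\Lambda-1)g}(\epsilon)-\lim_{\epsilon\to0^-}f_{(2\Lambda-1)g}(\epsilon).$$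 If $\mathbb{P}(\Lambda=j)=0$, the conditional density given $\Lambda=j$ is read as $0$. -/

import Mathlib

open MeasureTheory ProbabilityTheory Filter Topology
open scoped ContDiff

namespace DensityJump

/-- A compact embedded smooth piece of a hypersurface in `ℝ^d`: a compact set `K ⊆ ℝ^(d-1)`
together with a smooth map `φ` that is an injective immersion on `K`. The edge of the parameter
domain `K` has dimension at most `d - 2`: it is covered by finitely many smooth images of the
cube `[0,1]^(d-2)`. (The maps are smooth on the whole space; a map that is smooth on a
neighbourhood of a compact set agrees near that set with such a map.) -/
structure SmoothPiece (d : ℕ) where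
  K : Set (EuclideanSpace ℝ (Fin (d - 1)))
  φ : EuclideanSpace ℝ (Fin (d - 1)) → EuclideanSpace ℝ (Fin d)
  isCompact_K : IsCompact K
  smooth : ContDiff ℝ ∞ φ
  injOn : Set.InjOn φ K
  immersion : ∀ u ∈ K, Function.Injective (fderiv ℝ φ u)
  edge : ∃ (m : ℕ) (e : Fin m → (Fin (d - 2) → ℝ) → EuclideanSpace ℝ (Fin (d - 1))),
    (∀ k, ContDiff ℝ ∞ (e k)) ∧ frontier K ⊆ ⋃ k, e k '' Set.Icc 0 1

/-- The points of the piece. -/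
def SmoothPiece.carrier {d : ℕ} (p : SmoothPiece d) : Set (EuclideanSpace ℝ (Fin d)) :=
  p.φ '' p.K

/-- The points of the piece that do not lie on its edge. -/
def SmoothPiece.inner {d : ℕ} (p : SmoothPiece d) : Set (EuclideanSpace ℝ (Fin d)) :=
  p.φ '' interior p.K

/-- `Ω` is a closed domain with piecewise smooth boundary: it is the closure of its interior, and
its topological boundary is a finite union of compact embedded smooth hypersurface pieces that
meet each other only along their edges. -/
def HasPiecewiseSmoothBoundary {d : ℕ} (Ω : Set (EuclideanSpace ℝ (Fin d))) : Prop :=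
  closure (interior Ω) = Ω ∧
  ∃ (n : ℕ) (p : Fin n → SmoothPiece d),
    frontier Ω = ⋃ i, (p i).carrier ∧
    ∀ i j, i ≠ j → Disjoint (p i).inner (p j).carrier

open Classical in
/-- The signed Euclidean distance to `∂Ω`: nonnegative on `Ω`, nonpositive off `Ω`. -/
noncomputable def signedDistance {d : ℕ} (Ω : Set (EuclideanSpace ℝ (Fin d)))
    (x : EuclideanSpace ℝ (Fin d)) : ℝ :=
  if x ∈ Ω then Metric.infDist x (frontier Ω) else -Metric.infDist x (frontier Ω)

/-- `γ` sends every point to a nearest point of `∂Ω` (ties are broken arbitrarily). -/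
def IsNearestBoundaryPoint {d : ℕ} (Ω : Set (EuclideanSpace ℝ (Fin d)))
    (γ : EuclideanSpace ℝ (Fin d) → EuclideanSpace ℝ (Fin d)) : Prop :=
  ∀ x, γ x ∈ frontier Ω ∧ dist x (γ x) = Metric.infDist x (frontier Ω)

/-- The sign indicator: `1` if `τ ≥ 0` at the nearest boundary point, and `0` otherwise. -/
noncomputable def signIndicator {d : ℕ} (τ : EuclideanSpace ℝ (Fin d) → ℝ)
    (γ : EuclideanSpace ℝ (Fin d) → EuclideanSpace ℝ (Fin d))
    (x : EuclideanSpace ℝ (Fin d)) : ℝ :=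
  if 0 ≤ τ (γ x) then 1 else 0

/-- The real-valued Lebesgue density of the real random variable `Z` under `μ`. -/
noncomputable def density {S : Type*} [MeasurableSpace S] (Z : S → ℝ) (μ : Measure S)
    (t : ℝ) : ℝ :=
  (pdf Z μ volume t).toReal

/-- `h(ε) → a` as `ε → 0+`, up to a Lebesgue null set of `ε`. A density is only determined almost
everywhere, and this notion does not depend on the version of the density. -/
def HasRightLimit (h : ℝ → ℝ) (a : ℝ) : Prop :=
  Tendsto h (𝓝[>] 0 ⊓ ae volume) (𝓝 a)

/-- `h(ε) → a` as `ε → 0-`, up to a Lebesgue null set of `ε`. -/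
def HasLeftLimit (h : ℝ → ℝ) (a : ℝ) : Prop :=
  Tendsto h (𝓝[<] 0 ⊓ ae volume) (𝓝 a)

end DensityJump

namespace DensityJump

/-! ### Hausdorff measures under Lipschitz comparison, and volumes of prisms. -/

open scoped NNReal ENNReal

/-! Fix a Borel set `A ⊆ ∂Ω` and restrict the law of `g` to the event that the chosen nearest
boundary point lies in `A`. A thin layer of `Ω` over `A` looks like `A` times an interval, and there
`f` is close to its boundary value `f⁺`, so the restricted law has right density limit `∫_A f⁺ dS`
at `0`. The layer outside `Ω` gives the left limit `∫_A f⁻ dS`, and the jump is `∫_A τ dS`. With `A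
= {τ ≥ 0}` and `A = {τ < 0}` the difference of the two jumps is `∫ |τ| dS`. Flipping the sign of `g`
over the second set swaps its one-sided limits, so `(2Λ - 1) g` has the same jump.

Two points need work. The first is the volume of a layer of width `r` over `A`, which is `S(A) r +
o(r)` (`CollarLimit`). Over inner points of a piece, normal coordinates compare volume with area up
to a factor `1 + ε` (`exists_collar_comparison`). This is uniform only on compact sets, and the
crude bound `exists_volume_collar_le`, valid up to the edge, controls the remainder. Layers over the
edges have volume `O(r ^ 2)` (`SmoothPiece.exists_volume_collar_edge_le`).

The second is that this asymptotic concerns the distribution function of the distance, whereas a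
limit of its density is wanted. The extra regularity is Kneser's inequality
(`IsNearestPoint.volume_collar_le`): moving points towards their nearest boundary points by a factor
`t` shrinks mutual distances by at most `t`, so dilating the set of allowed distances by `1 / t`
multiplies the volume by at most `t ^ (-d)`. A measure on the half-line with this property is
absolutely continuous, and its density converges as soon as the average over `(0, r)` does
(`IsKneser.limDensity`). The weight `f` is then inserted layer by layer
(`HasCollarDensity.limDensity_withDensity`). -/

theorem euclideanHausdorffMeasure_image_le_of_dist_le {α X Y : Type*}
    [MetricSpace X] [MeasurableSpace X] [BorelSpace X]
    [MetricSpace Y] [MeasurableSpace Y] [BorelSpace Y]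
    {a : α → Y} {b : α → X} {s : Set α} {K : ℝ≥0} (k : ℕ)
    (h : ∀ x ∈ s, ∀ y ∈ s, dist (a x) (a y) ≤ K * dist (b x) (b y)) :
    μHE[k] (a '' s) ≤ (K : ℝ≥0∞) ^ k * μHE[k] (b '' s) := by
  rcases isEmpty_or_nonempty α with hα | hα
  · simp [Set.eq_empty_of_isEmpty s]
  -- `h` makes `a` constant on the fibres of `b`, so `a` factors as `g ∘ b` with `g` Lipschitz on `b
  -- '' s`.
  set g : X → Y := fun x => a (Function.invFunOn b s x) with hg
  have hinv : ∀ x ∈ s, Function.invFunOn b s (b x) ∈ s ∧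
      b (Function.invFunOn b s (b x)) = b x := fun x hx =>
    ⟨Function.invFunOn_mem ⟨x, hx, rfl⟩, Function.invFunOn_eq ⟨x, hx, rfl⟩⟩
  have hga : ∀ x ∈ s, g (b x) = a x := by
    intro x hx
    have := h _ (hinv x hx).1 x hx
    rw [(hinv x hx).2, dist_self, mul_zero] at this
    exact dist_le_zero.1 this
  have hL : LipschitzOnWith K g (b '' s) := by
    refine LipschitzOnWith.of_dist_le_mul ?_
    rintro _ ⟨x, hx, rfl⟩ _ ⟨y, hy, rfl⟩
    rw [hga x hx, hga y hy]
    exact h x hx y hy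
  have him : a '' s = g '' (b '' s) := by
    rw [Set.image_image]
    exact Set.image_congr fun x hx => (hga x hx).symm
  rw [him, Measure.euclideanHausdorffMeasure_def, Measure.euclideanHausdorffMeasure_def,
    Measure.smul_apply, Measure.smul_apply]
  have := hL.hausdorffMeasure_image_le (d := k) (by positivity)
  rw [ENNReal.rpow_natCast] at this
  calc _ ≤ _ := smul_le_smul_of_nonneg_left this zero_le
    _ = _ := by simp only [ENNReal.smul_def, smul_eq_mul]; ring

/-- The volume of a right prism over a linear image. -/
theorem volume_image_prism {m d : ℕ} (hd : m + 1 = d)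
    (L : EuclideanSpace ℝ (Fin m) →L[ℝ] EuclideanSpace ℝ (Fin d))
    (hL : Function.Injective L) {n : EuclideanSpace ℝ (Fin d)} (hn : ‖n‖ = 1)
    (horth : ∀ v, inner ℝ n (L v) = 0) (A : Set (EuclideanSpace ℝ (Fin m))) (J : Set ℝ) :
    volume ((fun p : EuclideanSpace ℝ (Fin m) × ℝ => L p.1 + p.2 • n) '' (A ×ˢ J)) =
      μHE[m] (L '' A) * volume J := by
  have hrank : Module.finrank ℝ (L.toLinearMap.range) = m := by
    rw [LinearMap.finrank_range_of_inj hL]; simp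
  let bas : OrthonormalBasis (Fin m) ℝ (L.toLinearMap.range) :=
    (stdOrthonormalBasis ℝ _).reindex (finCongr hrank)
  let e : EuclideanSpace ℝ (Fin m) ≃ₗᵢ[ℝ] L.toLinearMap.range := bas.repr.symm
  let ι : EuclideanSpace ℝ (Fin m) →ₗᵢ[ℝ] EuclideanSpace ℝ (Fin d) :=
    (L.toLinearMap.range).subtypeₗᵢ.comp e.toLinearIsometry
  have hι : ∀ v, inner ℝ n (ι v) = 0 := by
    intro v
    obtain ⟨w, hw⟩ := (e v).2
    have : ι v = L w := by simpa [ι] using hw.symm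
    rw [this, horth]
  -- `M` is `L` read in an orthonormal basis of its range. The area of `L '' A` is thus the volume
  -- of `M '' A`, and the prism is an isometric copy of a product set. The product carries the `L²`
  -- norm, since `T` is isometric only for that norm.
  let M : EuclideanSpace ℝ (Fin m) → EuclideanSpace ℝ (Fin m) := fun v =>
    e.symm ⟨L v, ⟨v, rfl⟩⟩
  have hM : ∀ v, ι (M v) = L v := by intro v; simp [ι, M]
  let T : WithLp 2 (EuclideanSpace ℝ (Fin m) × ℝ) → EuclideanSpace ℝ (Fin d) :=
    fun p => ι p.fst + p.snd • n
  have hT : Isometry T := by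
    refine Isometry.of_dist_eq fun p q => ?_
    have h1 : T p - T q = ι (p.fst - q.fst) + (p.snd - q.snd) • n := by
      simp only [T, map_sub, sub_smul]; abel
    have h2 : ‖T p - T q‖ ^ 2 = ‖p - q‖ ^ 2 := by
      rw [h1, WithLp.prod_norm_sq_eq_of_L2, norm_add_sq_real, inner_smul_right,
        real_inner_comm, hι, ι.norm_map, norm_smul, hn]
      simp
    rw [dist_eq_norm, dist_eq_norm]
    exact (sq_eq_sq₀ (norm_nonneg _) (norm_nonneg _)).1 h2
  have hfr : Module.finrank ℝ (WithLp 2 (EuclideanSpace ℝ (Fin m) × ℝ)) = d := by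
    rw [(WithLp.linearEquiv 2 ℝ (EuclideanSpace ℝ (Fin m) × ℝ)).finrank_eq]
    simp [hd]
  have hvol : (μHE[d] : Measure (WithLp 2 (EuclideanSpace ℝ (Fin m) × ℝ))) = volume := by
    rw [← InnerProductSpace.euclideanHausdorffMeasure_eq_volume, hfr]
  have himg : (fun p : EuclideanSpace ℝ (Fin m) × ℝ => L p.1 + p.2 • n) '' (A ×ˢ J) =
      T '' (WithLp.ofLp ⁻¹' ((M '' A) ×ˢ J)) := by
    ext x
    constructor
    · rintro ⟨⟨v, s⟩, ⟨hv, hs⟩, rfl⟩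
      refine ⟨WithLp.toLp 2 (M v, s), ⟨⟨v, hv, rfl⟩, hs⟩, ?_⟩
      simp [T, hM]
    · rintro ⟨p, ⟨⟨v, hv, hvp⟩, hs⟩, rfl⟩
      refine ⟨(v, p.snd), ⟨hv, hs⟩, ?_⟩
      have : p.fst = M v := hvp.symm
      simp [T, this, hM]
  have hLA : L '' A = ι '' (M '' A) := by
    rw [Set.image_image]; exact Set.image_congr fun v _ => (hM v).symm
  rw [himg, ← EuclideanSpace.euclideanHausdorffMeasure_eq_volume, hT.euclideanHausdorffMeasure_image,
    hvol, hLA,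
    ι.isometry.euclideanHausdorffMeasure_image, EuclideanSpace.euclideanHausdorffMeasure_eq_volume]
  rw [← Measure.prod_prod, ← Measure.volume_eq_prod]
  exact (WithLp.volume_preserving_ofLp (EuclideanSpace ℝ (Fin m)) ℝ).measure_preimage_equiv
    (f := (MeasurableEquiv.toLp 2 _).symm) _

/-! ### Normal coordinates around a hypersurface patch. -/

/-- Euclidean space of dimension `k`. -/
abbrev Euc (k : ℕ) := EuclideanSpace ℝ (Fin k)

/-- The linear map `(v, s) ↦ L v + s n`. -/
noncomputable def prismMap {m d : ℕ} (L : Euc m →L[ℝ] Euc d) (n : Euc d) :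
    Euc m × ℝ →L[ℝ] Euc d :=
  L.coprod (ContinuousLinearMap.toSpanSingleton ℝ n)

@[simp]
theorem prismMap_apply {m d : ℕ} (L : Euc m →L[ℝ] Euc d) (n : Euc d) (p : Euc m × ℝ) :
    prismMap L n p = L p.1 + p.2 • n := by
  simp [prismMap]

theorem prismMap_injective {m d : ℕ} {L : Euc m →L[ℝ] Euc d} (hL : Function.Injective L)
    {n : Euc d} (hn : ‖n‖ = 1) (horth : ∀ v, inner ℝ n (L v) = 0) :
    Function.Injective (prismMap L n) := by
  rw [injective_iff_map_eq_zero]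
  rintro ⟨v, s⟩ h
  rw [prismMap_apply] at h
  have h1 : inner ℝ n (L v + s • n) = 0 := by
    simp only at h; rw [h, inner_zero_right]
  rw [inner_add_right, horth, inner_smul_right, real_inner_self_eq_norm_sq, hn] at h1
  have hs : s = 0 := by simpa using h1
  subst hs
  have : L v = 0 := by simpa using h
  rw [(injective_iff_map_eq_zero L).1 hL v this]
  rfl

theorem exists_prismMap_equiv {m d : ℕ} (hd : m + 1 = d) {L : Euc m →L[ℝ] Euc d} {n : Euc d}
    (h : Function.Injective (prismMap L n)) :
    ∃ e : (Euc m × ℝ) ≃L[ℝ] Euc d, (e : Euc m × ℝ →L[ℝ] Euc d) = prismMap L n := by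
  refine ⟨(LinearMap.linearEquivOfInjective (prismMap L n).toLinearMap h
    (by simp [hd])).toContinuousLinearEquiv, ?_⟩
  ext p <;> rfl

theorem exists_unit_normal {m d : ℕ} (hd : m + 1 = d) (L : Euc m →L[ℝ] Euc d) :
    ∃ n : Euc d, ‖n‖ = 1 ∧ ∀ v, inner ℝ n (L v) = 0 := by
  have hne : (L.toLinearMap.range)ᗮ ≠ ⊥ := by
    rw [Ne, Submodule.orthogonal_eq_bot_iff]
    intro htop
    have h1 := LinearMap.finrank_range_le L.toLinearMap
    rw [htop] at h1
    simp at h1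
    omega
  obtain ⟨b, hb, hb0⟩ := Submodule.exists_mem_ne_zero_of_ne_bot hne
  refine ⟨‖b‖⁻¹ • b, ?_, fun v => ?_⟩
  · rw [norm_smul, norm_inv, norm_norm, inv_mul_cancel₀ (norm_ne_zero_iff.2 hb0)]
  · rw [inner_smul_left, real_inner_comm, (Submodule.mem_orthogonal _ _).1 hb (L v) ⟨v, rfl⟩, mul_zero]

/-- The range of `L` and `n` together span the space, so `w - ⟪n, w⟫ n` is orthogonal to everything.
This converts the first-order condition at a nearest point into lying on the normal line. -/
theorem eq_smul_normal {m d : ℕ} (hd : m + 1 = d) {L : Euc m →L[ℝ] Euc d}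
    (hL : Function.Injective L) {n : Euc d} (hn : ‖n‖ = 1) (horth : ∀ v, inner ℝ n (L v) = 0)
    {w : Euc d} (hw : ∀ v, inner ℝ w (L v) = 0) : ∃ c : ℝ, w = c • n := by
  obtain ⟨e, he⟩ := exists_prismMap_equiv hd (prismMap_injective hL hn horth)
  set w' := w - inner ℝ n w • n with hw'
  have h1 : ∀ y, inner ℝ w' y = 0 := by
    intro y
    obtain ⟨p, rfl⟩ := e.surjective y
    have : e p = L p.1 + p.2 • n := by
      rw [← prismMap_apply, ← he]; rfl
    rw [this, hw', inner_sub_left, inner_add_right, inner_add_right, hw, inner_smul_left,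
      inner_smul_left, horth, inner_smul_right, inner_smul_right, real_inner_self_eq_norm_sq, hn,
      real_inner_comm]
    simp [mul_comm]
  have h2 : w' = 0 := by simpa using h1 w'
  exact ⟨inner ℝ n w, by rwa [hw', sub_eq_zero] at h2⟩

/-- A hypersurface patch has a continuously differentiable unit normal field. -/
theorem exists_unit_normal_field {m d : ℕ} (hd : m + 1 = d) {φ : Euc m → Euc d}
    (hφ : ContDiff ℝ ∞ φ) {u₀ : Euc m} (himm : Function.Injective (fderiv ℝ φ u₀)) :
    ∃ n : Euc m → Euc d, ContDiffAt ℝ 1 n u₀ ∧ ∀ᶠ u in 𝓝 u₀, ‖n u‖ = 1 ∧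
      (∀ v, inner ℝ (n u) (fderiv ℝ φ u v) = 0) ∧ Function.Injective (fderiv ℝ φ u) := by
  obtain ⟨n₀, hn₀, horth₀⟩ := exists_unit_normal hd (fderiv ℝ φ u₀)
  obtain ⟨e₀, he₀⟩ := exists_prismMap_equiv hd (prismMap_injective himm hn₀ horth₀)
  have hT : ContDiff ℝ 1 (fun u => prismMap (fderiv ℝ φ u) n₀) := by
    have h1 : ContDiff ℝ 1 (fderiv ℝ φ) := hφ.fderiv_right (by norm_cast)
    have h2 : (fun u => prismMap (fderiv ℝ φ u) n₀) = fun u =>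
        (fderiv ℝ φ u).comp (ContinuousLinearMap.fst ℝ (Euc m) ℝ) +
          (ContinuousLinearMap.toSpanSingleton ℝ n₀).comp (ContinuousLinearMap.snd ℝ (Euc m) ℝ) := by
      funext u
      ext p <;> simp
    rw [h2]
    exact (h1.clm_comp contDiff_const).add contDiff_const
  -- With the normal `n₀` at `u₀` frozen, the prism map stays invertible near `u₀`. The last
  -- coordinate of its inverse is a functional that kills the range of the derivative of `φ` at `u`;
  -- the vector `w u` representing it is therefore normal, and it is `C¹` in `u` because inversion
  -- is smooth. Where the prism map is not invertible, `G` is `0`; such `u` stay away from `u₀`.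
  set G : Euc m → (Euc d →L[ℝ] Euc m × ℝ) :=
    fun u => ContinuousLinearMap.inverse (prismMap (fderiv ℝ φ u) n₀) with hG
  have hGc : ContDiffAt ℝ 1 G u₀ := by
    have : ContDiffAt ℝ 1 ContinuousLinearMap.inverse (prismMap (fderiv ℝ φ u₀) n₀) := by
      rw [← he₀]; exact contDiffAt_map_inverse e₀
    exact this.comp u₀ hT.contDiffAt
  let b := EuclideanSpace.basisFun (Fin d) ℝ
  set w : Euc m → Euc d := fun u => ∑ i, (G u (b i)).2 • b i with hw
  have hwc : ContDiffAt ℝ 1 w u₀ := by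
    refine ContDiffAt.sum fun i _ => ?_
    have h1 : ContDiffAt ℝ 1 (fun u => (G u (b i)).2) u₀ := (hGc.clm_apply contDiffAt_const).snd
    exact h1.smul contDiffAt_const
  have hinner : ∀ u y, inner ℝ (w u) y = (G u y).2 := by
    intro u y
    conv_rhs => rw [← b.sum_repr' y]
    rw [map_sum, Prod.snd_sum, hw, sum_inner]
    refine Finset.sum_congr rfl fun i _ => ?_
    rw [inner_smul_left, map_smul, Prod.smul_snd, smul_eq_mul, mul_comm]
    rfl
  have hev : ∀ᶠ u in 𝓝 u₀, ∃ e : (Euc m × ℝ) ≃L[ℝ] Euc d,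
      (e : Euc m × ℝ →L[ℝ] Euc d) = prismMap (fderiv ℝ φ u) n₀ := by
    have := hT.continuous.continuousAt (x := u₀)
    have h2 := e₀.nhds
    rw [he₀] at h2
    exact this.eventually h2
  have hGapp : ∀ u, (∃ e : (Euc m × ℝ) ≃L[ℝ] Euc d,
      (e : Euc m × ℝ →L[ℝ] Euc d) = prismMap (fderiv ℝ φ u) n₀) →
      ∀ p, G u (prismMap (fderiv ℝ φ u) n₀ p) = p := by
    rintro u ⟨e, he⟩ p
    rw [hG]
    simp only
    rw [← he, ContinuousLinearMap.inverse_equiv]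
    exact e.symm_apply_apply p
  have hw1 : ∀ u, (∃ e : (Euc m × ℝ) ≃L[ℝ] Euc d,
      (e : Euc m × ℝ →L[ℝ] Euc d) = prismMap (fderiv ℝ φ u) n₀) → w u ≠ 0 := by
    intro u hu h0
    have h1 := hinner u (prismMap (fderiv ℝ φ u) n₀ (0, 1))
    rw [hGapp u hu, h0, inner_zero_left] at h1
    simp at h1
  refine ⟨fun u => ‖w u‖⁻¹ • w u, ?_, ?_⟩
  · have hne := hw1 u₀ ⟨e₀, he₀⟩
    exact ((hwc.norm ℝ hne).inv (norm_ne_zero_iff.2 hne)).smul hwc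
  · filter_upwards [hev] with u hu
    refine ⟨?_, fun v => ?_, ?_⟩
    · rw [norm_smul, norm_inv, norm_norm, inv_mul_cancel₀ (norm_ne_zero_iff.2 (hw1 u hu))]
    · have h1 := hinner u (prismMap (fderiv ℝ φ u) n₀ (v, 0))
      rw [hGapp u hu, prismMap_apply] at h1
      simp only [zero_smul, add_zero] at h1
      rw [inner_smul_left, h1, mul_zero]
    · intro v v' hvv
      have h1 := hGapp u hu (v, 0)
      have h2 := hGapp u hu (v', 0)
      rw [prismMap_apply] at h1 h2
      simp only [zero_smul, add_zero] at h1 h2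
      rw [hvv, h2] at h1
      exact (congrArg Prod.fst h1).symm

/-- The normal coordinates `(u, s) ↦ φ(u) + s n(u)`. -/
def normalMap {m d : ℕ} (φ n : Euc m → Euc d) (p : Euc m × ℝ) : Euc d := φ p.1 + p.2 • n p.1

/-- The derivative of `n` enters with the factor `s`, which is `0` at the base point. Strict
differentiability is what later gives two-sided Lipschitz bounds on a neighbourhood. -/
theorem hasStrictFDerivAt_normalMap {m d : ℕ} {φ n : Euc m → Euc d}
    (hφ : ContDiff ℝ ∞ φ) {u₀ : Euc m} (hn : ContDiffAt ℝ 1 n u₀) :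
    HasStrictFDerivAt (normalMap φ n) (prismMap (fderiv ℝ φ u₀) (n u₀)) (u₀, 0) := by
  have h1 : HasStrictFDerivAt φ (fderiv ℝ φ u₀) u₀ :=
    hφ.contDiffAt.hasStrictFDerivAt (by simp)
  have h2 : HasStrictFDerivAt n (fderiv ℝ n u₀) u₀ := hn.hasStrictFDerivAt (by simp)
  have h3 : HasStrictFDerivAt (fun p : Euc m × ℝ => φ p.1)
      ((fderiv ℝ φ u₀).comp (ContinuousLinearMap.fst ℝ (Euc m) ℝ)) (u₀, 0) :=
    HasStrictFDerivAt.comp (u₀, (0 : ℝ)) (g := φ) h1 hasStrictFDerivAt_fst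
  have h4 : HasStrictFDerivAt (fun p : Euc m × ℝ => n p.1)
      ((fderiv ℝ n u₀).comp (ContinuousLinearMap.fst ℝ (Euc m) ℝ)) (u₀, 0) :=
    HasStrictFDerivAt.comp (u₀, (0 : ℝ)) (g := n) h2 hasStrictFDerivAt_fst
  have h5 : HasStrictFDerivAt (fun p : Euc m × ℝ => p.2)
      (ContinuousLinearMap.snd ℝ (Euc m) ℝ) (u₀, (0 : ℝ)) := hasStrictFDerivAt_snd
  have h6 := h3.add (h5.smul h4)
  have h7 : prismMap (fderiv ℝ φ u₀) (n u₀) =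
      (fderiv ℝ φ u₀).comp (ContinuousLinearMap.fst ℝ (Euc m) ℝ) +
      ((u₀, (0 : ℝ)).2 • (fderiv ℝ n u₀).comp (ContinuousLinearMap.fst ℝ (Euc m) ℝ) +
        (ContinuousLinearMap.snd ℝ (Euc m) ℝ).smulRight (n (u₀, (0 : ℝ)).1)) := by
    ext p <;> simp
  rw [h7]
  exact h6

/-- Normal coordinates around a point of a hypersurface patch, on a neighbourhood where they
distort areas and volumes by a factor at most `1 + ε`. -/
theorem exists_normal_chart {m d : ℕ} (hd : m + 1 = d) {φ : Euc m → Euc d}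
    (hφ : ContDiff ℝ ∞ φ) {u₀ : Euc m} (himm : Function.Injective (fderiv ℝ φ u₀))
    {ε : ℝ} (hε : 0 < ε) :
    ∃ (n : Euc m → Euc d) (U : Set (Euc m)) (r : ℝ), 0 < r ∧ IsOpen U ∧ u₀ ∈ U ∧
      (∀ u ∈ U, ‖n u‖ = 1) ∧
      (∀ u ∈ U, ∀ w, (∀ v, inner ℝ w (fderiv ℝ φ u v) = 0) → ∃ c : ℝ, w = c • n u) ∧
      ContinuousOn (normalMap φ n) (U ×ˢ Set.Ioo (-r) r) ∧
      Set.InjOn (normalMap φ n) (U ×ˢ Set.Ioo (-r) r) ∧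
      (∀ V ∈ 𝓝 (u₀, (0 : ℝ)), normalMap φ n '' V ∈ 𝓝 (φ u₀)) ∧
      ∀ A ⊆ U, ∀ J ⊆ Set.Ioo (-r) r,
        volume (normalMap φ n '' (A ×ˢ J)) ≤
          ENNReal.ofReal (1 + ε) * (volume J * μHE[m] (φ '' A)) ∧
        volume J * μHE[m] (φ '' A) ≤
          ENNReal.ofReal (1 + ε) * volume (normalMap φ n '' (A ×ˢ J)) := by
  obtain ⟨n, hnc, hn⟩ := exists_unit_normal_field hd hφ himm
  have hn0 := hn.self_of_nhds
  have hTinj := prismMap_injective himm hn0.1 hn0.2.1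
  obtain ⟨e, he⟩ := exists_prismMap_equiv hd hTinj
  have hstrict := hasStrictFDerivAt_normalMap hφ hnc
  set T := prismMap (fderiv ℝ φ u₀) (n u₀) with hT
  -- A `K`-Lipschitz comparison costs `K ^ d` for volumes and `K ^ m` for areas, hence the exponent.
  obtain ⟨K, hK1, hK⟩ : ∃ K : ℝ, 1 < K ∧ K ^ (d + m) ≤ 1 + ε := by
    have hc : Tendsto (fun x : ℝ => x ^ (d + m)) (𝓝[>] 1) (𝓝 (1 ^ (d + m))) :=
      ((continuous_pow (d + m)).tendsto 1).mono_left nhdsWithin_le_nhds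
    rw [one_pow] at hc
    have h1 := hc.eventually (ge_mem_nhds (by linarith : 1 < 1 + ε))
    obtain ⟨K, h2, h3⟩ := (h1.and self_mem_nhdsWithin).exists
    exact ⟨K, h3, h2⟩
  obtain ⟨M, hM0, hM⟩ : ∃ M : ℝ, 0 < M ∧ ∀ p, ‖p‖ ≤ M * ‖T p‖ := by
    refine ⟨‖(e.symm : Euc d →L[ℝ] Euc m × ℝ)‖ + 1, by positivity, fun p => ?_⟩
    have h1 := (e.symm : Euc d →L[ℝ] Euc m × ℝ).le_opNorm (T p)
    have h2 : (e.symm : Euc d →L[ℝ] Euc m × ℝ) (T p) = p := by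
      rw [← he]; exact e.symm_apply_apply p
    rw [h2] at h1
    nlinarith [norm_nonneg (T p)]
  have hδ : 0 < 1 - 1 / K := by
    rw [sub_pos, div_lt_one (by linarith)]; exact hK1
  -- Since `M` bounds the inverse of `T`, this accuracy makes the error at most `(1 - 1 / K) ‖T p -
  -- T q‖`. Then `normalMap φ n` and `T` dominate each other's distances up to the factor `K`; one
  -- direction uses `2 - 1 / K ≤ K`.
  obtain ⟨s, hs, happ⟩ := hstrict.approximates_deriv_on_nhds
    (c := ((1 - 1 / K) / M).toNNReal) (Or.inr (Real.toNNReal_pos.2 (div_pos hδ hM0)))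
  have hdist : ∀ p ∈ s, ∀ q ∈ s,
      dist (normalMap φ n p) (normalMap φ n q) ≤ K * dist (T p) (T q) ∧
      dist (T p) (T q) ≤ K * dist (normalMap φ n p) (normalMap φ n q) := by
    intro p hp q hq
    have h1 := happ p hp q hq
    have h2 := hM (p - q)
    rw [map_sub] at h1 h2
    rw [dist_eq_norm, dist_eq_norm]
    set a := normalMap φ n p - normalMap φ n q
    set b := T p - T q
    have h3 : ‖a - b‖ ≤ (1 - 1 / K) * ‖b‖ := by
      refine h1.trans ?_
      rw [Real.coe_toNNReal _ (div_pos hδ hM0).le, div_mul_eq_mul_div, div_le_iff₀ hM0]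
      nlinarith
    have h4 : ‖a‖ ≤ ‖b‖ + ‖a - b‖ := by
      have := norm_add_le b (a - b); simpa using this
    have h5 : ‖b‖ ≤ ‖a‖ + ‖a - b‖ := by
      have := norm_sub_le a (a - b); simpa using this
    have hb := norm_nonneg b
    have hKi : 1 / K * K = 1 := by field_simp
    constructor
    · have : 2 - 1 / K ≤ K := by
        rw [sub_le_iff_le_add, ← sub_nonneg]
        have : K + 1 / K - 2 = (K - 1) ^ 2 / K := by field_simp; ring
        rw [this]; positivity
      nlinarith
    · have h6 : 1 / K * ‖b‖ ≤ ‖a‖ := by linarith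
      calc ‖b‖ = K * (1 / K * ‖b‖) := by rw [← mul_assoc, mul_comm K, hKi, one_mul]
        _ ≤ K * ‖a‖ := by gcongr
  obtain ⟨V, hV, W, hW, hVW⟩ := mem_nhds_prod_iff.1 hs
  obtain ⟨r, hr, hrW⟩ := Metric.mem_nhds_iff.1 hW
  have hball : Set.Ioo (-r) r ⊆ W := by
    rw [Real.ball_eq_Ioo, zero_sub, zero_add] at hrW; exact hrW
  obtain ⟨U, hUsub, hUo, hU0⟩ := mem_nhds_iff.1 (inter_mem hV hn)
  have hUs : U ×ˢ Set.Ioo (-r) r ⊆ s := fun p hp => hVW ⟨(hUsub hp.1).1, hball hp.2⟩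
  refine ⟨n, U, r, hr, hUo, hU0, fun u hu => (hUsub hu).2.1, ?_, ?_, ?_, ?_, ?_⟩
  · intro u hu w hw
    exact eq_smul_normal hd (hUsub hu).2.2.2 (hUsub hu).2.1 (hUsub hu).2.2.1 hw
  · exact happ.continuousOn.mono hUs
  · intro p hp q hq hpq
    have := (hdist p (hUs hp) q (hUs hq)).2
    rw [hpq, dist_self, mul_zero] at this
    exact hTinj (dist_le_zero.1 this)
  · intro V hV
    have h1 : map (normalMap φ n) (𝓝 (u₀, 0)) = 𝓝 (φ u₀) := by
      rw [← he] at hstrict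
      rw [hstrict.map_nhds_eq_of_equiv]
      simp [normalMap]
    rw [← h1]
    exact image_mem_map hV
  · intro A hA J hJ
    have hAJ : A ×ˢ J ⊆ s := (Set.prod_mono hA hJ).trans hUs
    have hprism := volume_image_prism hd (fderiv ℝ φ u₀) himm hn0.1 hn0.2.1 A J
    have hTeq : (fun p : Euc m × ℝ => fderiv ℝ φ u₀ p.1 + p.2 • n u₀) = T := by
      funext p; rw [hT, prismMap_apply]
    rw [hTeq] at hprism
    lift K to ℝ≥0 using by linarith
    -- Both the volume and, at `s = 0`, the area are compared with the linear model `T`, for which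
    -- the prism formula is exact.
    have h1 := euclideanHausdorffMeasure_image_le_of_dist_le (s := A ×ˢ J) d
      fun p hp q hq => (hdist p (hAJ hp) q (hAJ hq)).1
    have h2 := euclideanHausdorffMeasure_image_le_of_dist_le (s := A ×ˢ J) d
      fun p hp q hq => (hdist p (hAJ hp) q (hAJ hq)).2
    have hzero : ∀ u ∈ A, (u, (0 : ℝ)) ∈ s := fun u hu => hUs ⟨hA hu, by simp [hr]⟩
    have hφe : ∀ u, φ u = normalMap φ n (u, 0) := fun u => by simp [normalMap]
    have hLe : ∀ u, fderiv ℝ φ u₀ u = T (u, 0) := fun u => by simp [hT]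
    have h3 := euclideanHausdorffMeasure_image_le_of_dist_le (a := φ) (b := fderiv ℝ φ u₀)
      (K := K) (s := A) m
      fun p hp q hq => by
        rw [hφe, hφe, hLe, hLe]; exact (hdist _ (hzero p hp) _ (hzero q hq)).1
    have h4 := euclideanHausdorffMeasure_image_le_of_dist_le (a := fderiv ℝ φ u₀) (b := φ)
      (K := K) (s := A) m
      fun p hp q hq => by
        rw [hφe, hφe, hLe, hLe]; exact (hdist _ (hzero p hp) _ (hzero q hq)).2
    rw [EuclideanSpace.euclideanHausdorffMeasure_eq_volume, hprism] at h1 h2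
    have hKε : (K : ℝ≥0∞) ^ (d + m) ≤ ENNReal.ofReal (1 + ε) := by
      rw [← ENNReal.ofReal_coe_nnreal, ← ENNReal.ofReal_pow (by positivity)]
      exact ENNReal.ofReal_le_ofReal hK
    constructor
    · calc volume (normalMap φ n '' (A ×ˢ J))
          ≤ K ^ d * (μHE[m] (fderiv ℝ φ u₀ '' A) * volume J) := h1
        _ ≤ K ^ d * (K ^ m * μHE[m] (φ '' A) * volume J) := by gcongr
        _ = K ^ (d + m) * (volume J * μHE[m] (φ '' A)) := by ring
        _ ≤ _ := by gcongr
    · calc volume J * μHE[m] (φ '' A)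
          ≤ volume J * (K ^ m * μHE[m] (fderiv ℝ φ u₀ '' A)) := by gcongr
        _ = K ^ m * (μHE[m] (fderiv ℝ φ u₀ '' A) * volume J) := by ring
        _ ≤ K ^ m * (K ^ d * volume (normalMap φ n '' (A ×ˢ J))) := by gcongr
        _ = K ^ (d + m) * volume (normalMap φ n '' (A ×ˢ J)) := by ring
        _ ≤ _ := by gcongr

/-! ### Nearest-point maps: contraction, Kneser's inequality, almost everywhere uniqueness. -/

theorem subset_interior_of_disjoint_frontier {X : Type*} [TopologicalSpace X] {t Z : Set X}
    (ht : IsPreconnected t) (hd : Disjoint t (frontier Z)) (hne : (t ∩ Z).Nonempty) :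
    t ⊆ interior Z := by
  have hdj : Disjoint (interior Z) (closure Z)ᶜ :=
    Set.disjoint_compl_right_iff_subset.2 (interior_subset.trans subset_closure)
  have hcov : t ⊆ interior Z ∪ (closure Z)ᶜ := by
    intro x hx
    by_contra hc
    rw [Set.mem_union, not_or, Set.mem_compl_iff, not_not] at hc
    exact Set.disjoint_left.1 hd hx ⟨hc.2, hc.1⟩
  refine ht.subset_left_of_subset_union isOpen_interior isClosed_closure.isOpen_compl hdj hcov ?_
  obtain ⟨x, hxt, hxZ⟩ := hne
  exact ⟨x, hxt, (hcov hxt).resolve_right fun h => h (subset_closure hxZ)⟩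

/-- `γ` sends every point to a nearest point of `F`. -/
def IsNearestPoint {d : ℕ} (F : Set (Euc d)) (γ : Euc d → Euc d) : Prop :=
  ∀ x, γ x ∈ F ∧ dist x (γ x) = Metric.infDist x F

namespace IsNearestPoint

variable {d : ℕ} {F : Set (Euc d)} {γ : Euc d → Euc d}

theorem dist_le (hγ : IsNearestPoint F γ) (x : Euc d) {q : Euc d} (hq : q ∈ F) :
    dist x (γ x) ≤ dist x q := by
  rw [(hγ x).2]; exact Metric.infDist_le_dist_of_mem hq

theorem apply_of_mem (hγ : IsNearestPoint F γ) {x : Euc d} (hx : x ∈ F) : γ x = x := by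
  have := (hγ x).2
  rw [Metric.infDist_zero_of_mem hx] at this
  exact (dist_eq_zero.1 this).symm

/-- Add the squared inequalities saying that `γ x` is at least as near to `x` as `γ y` is, and
conversely. Conceptually, `γ` selects subgradients of the convex function `(|x|² - dist(x, F)²) /
2`, so it is monotone although `F` need not be convex. -/
theorem inner_nonneg (hγ : IsNearestPoint F γ) (x y : Euc d) :
    0 ≤ inner ℝ (γ x - γ y) (x - y) := by
  have h1 := hγ.dist_le x (hγ y).1
  have h2 := hγ.dist_le y (hγ x).1
  rw [dist_eq_norm, dist_eq_norm] at h1 h2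
  have h1' := mul_self_le_mul_self (norm_nonneg _) h1
  have h2' := mul_self_le_mul_self (norm_nonneg _) h2
  simp only [← real_inner_self_eq_norm_mul_norm, inner_sub_left, inner_sub_right] at h1' h2' ⊢
  linarith [real_inner_comm x (γ x), real_inner_comm x (γ y), real_inner_comm y (γ x),
    real_inner_comm y (γ y), real_inner_comm (γ x) (γ y)]

/-- Contraction towards the nearest point by the factor `t`. -/
def shrink (γ : Euc d → Euc d) (t : ℝ) (x : Euc d) : Euc d := γ x + t • (x - γ x)

/-- In the expansion of `‖(1 - t)(γ x - γ y) + t(x - y)‖²` the cross term is nonnegative by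
monotonicity. -/
theorem mul_dist_le_dist_shrink (hγ : IsNearestPoint F γ) {t : ℝ} (ht0 : 0 ≤ t) (ht1 : t ≤ 1)
    (x y : Euc d) : t * dist x y ≤ dist (shrink γ t x) (shrink γ t y) := by
  have h1 : shrink γ t x - shrink γ t y = (1 - t) • (γ x - γ y) + t • (x - y) := by
    simp only [shrink]; module
  rw [dist_eq_norm, dist_eq_norm, h1]
  have h2 : (t * ‖x - y‖) ^ 2 ≤ ‖(1 - t) • (γ x - γ y) + t • (x - y)‖ ^ 2 := by
    rw [norm_add_sq_real, inner_smul_left, inner_smul_right, norm_smul t, mul_pow, mul_pow,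
      Real.norm_eq_abs, sq_abs]
    have h3 := hγ.inner_nonneg x y
    have h4 : (0 : ℝ) ≤ (starRingEnd ℝ) (1 - t) * (t * inner ℝ (γ x - γ y) (x - y)) :=
      mul_nonneg (by simpa using ht1) (mul_nonneg ht0 h3)
    nlinarith [sq_nonneg ‖(1 - t) • (γ x - γ y)‖]
  exact (sq_le_sq₀ (by positivity) (norm_nonneg _)).1 h2

/-- With `a = x - γ x` and `b = γ x - q`, the hypotheses give `2⟪a, b⟫ + ‖b‖² ≥ 0` and `2t⟪a, b⟫ +
‖b‖² ≤ 0`, whence `(1 - t)‖b‖² ≤ 0`. So ties disappear after any proper contraction, and even an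
arbitrary choice `γ` is preserved by it. -/
theorem eq_of_nearest_shrink (hγ : IsNearestPoint F γ) {t : ℝ} (ht0 : 0 ≤ t) (ht1 : t < 1)
    (x : Euc d) {q : Euc d} (hq : q ∈ F) (hd : dist (shrink γ t x) q ≤ t * dist x (γ x)) :
    q = γ x := by
  have h1 := hγ.dist_le x hq
  rw [dist_eq_norm, dist_eq_norm] at h1 hd
  have e1 : x - q = (x - γ x) + (γ x - q) := by abel
  have e2 : shrink γ t x - q = t • (x - γ x) + (γ x - q) := by simp only [shrink]; abel
  rw [e1] at h1
  rw [e2] at hd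
  set a := x - γ x
  set b := γ x - q with hb
  have h1' := pow_le_pow_left₀ (norm_nonneg _) h1 2
  have hd' := pow_le_pow_left₀ (norm_nonneg _) hd 2
  rw [norm_add_sq_real] at h1' hd'
  rw [inner_smul_left, norm_smul, mul_pow, mul_pow, Real.norm_eq_abs, sq_abs] at hd'
  simp only [conj_trivial] at hd'
  have hb0 : ‖b‖ ^ 2 ≤ 0 := by nlinarith [sq_nonneg ‖b‖]
  have : b = 0 := by
    rw [← norm_eq_zero]
    exact pow_eq_zero_iff (two_ne_zero) |>.1 (le_antisymm hb0 (sq_nonneg _))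
  rw [hb, sub_eq_zero] at this
  exact this.symm

theorem infDist_shrink (hγ : IsNearestPoint F γ) {t : ℝ} (ht0 : 0 ≤ t) (ht1 : t ≤ 1)
    (x : Euc d) : Metric.infDist (shrink γ t x) F = t * Metric.infDist x F := by
  have h1 : dist (shrink γ t x) (γ x) = t * Metric.infDist x F := by
    rw [← (hγ x).2, dist_eq_norm, dist_eq_norm]
    simp [shrink, norm_smul, abs_of_nonneg ht0]
  have h2 : dist x (shrink γ t x) = (1 - t) * Metric.infDist x F := by
    have e : x - shrink γ t x = (1 - t) • (x - γ x) := by simp only [shrink]; module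
    rw [← (hγ x).2, dist_eq_norm, dist_eq_norm, e, norm_smul, Real.norm_eq_abs,
      abs_of_nonneg (by linarith)]
  refine le_antisymm (h1 ▸ Metric.infDist_le_dist_of_mem (hγ x).1) ?_
  have := Metric.infDist_le_infDist_add_dist (s := F) (x := x) (y := shrink γ t x)
  rw [h2] at this
  linarith

theorem apply_shrink (hγ : IsNearestPoint F γ) {t : ℝ} (ht0 : 0 ≤ t) (ht1 : t < 1)
    (x : Euc d) : γ (shrink γ t x) = γ x := by
  refine hγ.eq_of_nearest_shrink ht0 ht1 x (hγ _).1 ?_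
  rw [(hγ _).2, hγ.infDist_shrink ht0 ht1.le, (hγ x).2]

/-- Along the segment the distance to `F` stays positive, so the segment never crosses the frontier
of `Z`. -/
theorem shrink_mem (hγ : IsNearestPoint F γ) {Z : Set (Euc d)} (hZ : frontier Z = F)
    {t : ℝ} (ht0 : 0 < t) (ht1 : t ≤ 1) {x : Euc d} (hx : x ∈ Z) (hpos : 0 < Metric.infDist x F) :
    shrink γ t x ∈ Z := by
  by_contra hc
  have hcont : Continuous (fun s : ℝ => shrink γ s x) := by unfold shrink; fun_prop
  have hpre : IsPreconnected ((fun s : ℝ => shrink γ s x) '' Set.Icc t 1) :=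
    isPreconnected_Icc.image _ hcont.continuousOn
  have h1 : shrink γ 1 x = x := by simp [shrink]
  have hnd : ¬ Disjoint ((fun s : ℝ => shrink γ s x) '' Set.Icc t 1) (frontier Z) := fun hdis =>
    hc (interior_subset (subset_interior_of_disjoint_frontier hpre hdis
      ⟨x, ⟨1, ⟨ht1, le_rfl⟩, h1⟩, hx⟩ ⟨t, ⟨le_rfl, ht1⟩, rfl⟩))
  obtain ⟨y, ⟨s, hs, rfl⟩, hy⟩ := Set.not_disjoint_iff.1 hnd
  rw [hZ] at hy
  have := Metric.infDist_zero_of_mem hy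
  rw [hγ.infDist_shrink (ht0.le.trans hs.1) hs.2] at this
  have : 0 < s * Metric.infDist x F := mul_pos (ht0.trans_le hs.1) hpos
  linarith

end IsNearestPoint

/-- The points of `Z` whose distance to `F` lies in `B` and whose chosen nearest point lies
in `A`. -/
def collar {d : ℕ} (F : Set (Euc d)) (γ : Euc d → Euc d) (Z A : Set (Euc d)) (B : Set ℝ) :
    Set (Euc d) :=
  {x | x ∈ Z ∧ Metric.infDist x F ∈ B ∧ γ x ∈ A}

namespace IsNearestPoint

variable {d : ℕ} {F : Set (Euc d)} {γ : Euc d → Euc d}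

/-- Kneser's inequality for the volumes of collars. -/
theorem volume_collar_le (hγ : IsNearestPoint F γ) {Z : Set (Euc d)} (hZ : frontier Z = F)
    (A : Set (Euc d)) {B : Set ℝ} (hB : B ⊆ Set.Ioi 0) {τ : ℝ≥0} (hτ : 1 ≤ τ) :
    volume (collar F γ Z A B) ≤
      (τ : ℝ≥0∞) ^ d * volume (collar F γ Z A ((fun s => (τ : ℝ) * s) ⁻¹' B)) := by
  rcases hτ.eq_or_lt with rfl | hτ1
  · simp
  have hτ1' : (1 : ℝ) < τ := by exact_mod_cast hτ1
  have hτ0 : (0 : ℝ) < τ := by linarith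
  have ht0 : (0 : ℝ) < (τ : ℝ)⁻¹ := by positivity
  have ht1 : (τ : ℝ)⁻¹ < 1 := inv_lt_one_of_one_lt₀ hτ1'
  -- The inverse of the contraction by `τ⁻¹` is `τ`-Lipschitz. Hausdorff measure is an outer
  -- measure, so no measurability of `γ`, `A` or `B` enters.
  have h1 := euclideanHausdorffMeasure_image_le_of_dist_le (a := id)
    (b := shrink γ (τ : ℝ)⁻¹) (s := collar F γ Z A B) (K := τ) d fun x _ y _ => by
      have := hγ.mul_dist_le_dist_shrink ht0.le ht1.le x y
      rw [inv_mul_le_iff₀ hτ0] at this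
      exact this
  rw [Set.image_id, EuclideanSpace.euclideanHausdorffMeasure_eq_volume] at h1
  refine h1.trans ?_
  gcongr
  rintro _ ⟨x, ⟨hxZ, hxB, hxA⟩, rfl⟩
  refine ⟨hγ.shrink_mem hZ ht0 ht1.le hxZ (hB hxB), ?_, ?_⟩
  · rw [hγ.infDist_shrink ht0.le ht1.le, Set.mem_preimage]
    rwa [mul_inv_cancel_left₀ hτ0.ne']
  · rwa [hγ.apply_shrink ht0.le ht1]

/-- By Rademacher, the 1-Lipschitz distance function is differentiable almost everywhere. At such an
`x` its derivative in the direction `q - x` is `-dist(x, F)` for every nearest point `q`. For two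
nearest points the sum of the directions then has length at least `2 dist(x, F)`, and the
parallelogram law makes them equal. -/
theorem ae_unique (hγ : IsNearestPoint F γ) :
    ∀ᵐ x : Euc d, ∀ q ∈ F, dist x q = Metric.infDist x F → q = γ x := by
  have hLip : LipschitzWith 1 (fun x : Euc d => Metric.infDist x F) := Metric.lipschitz_infDist_pt F
  filter_upwards [hLip.ae_differentiableAt] with x hx
  set D := fderiv ℝ (fun x : Euc d => Metric.infDist x F) x with hD
  have hDn : ‖D‖ ≤ 1 := by simpa using norm_fderiv_le_of_lipschitz ℝ hLip
  have key : ∀ q ∈ F, dist x q = Metric.infDist x F → D (q - x) = -Metric.infDist x F := by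
    intro q hq hqd
    have h1 : HasDerivWithinAt (fun t : ℝ => Metric.infDist (x + t • (q - x)) F) (D (q - x))
        (Set.Icc 0 1) 0 := (hx.hasFDerivAt.hasLineDerivAt (q - x)).hasDerivWithinAt
    have heq : ∀ t ∈ Set.Icc (0 : ℝ) 1,
        Metric.infDist (x + t • (q - x)) F = (1 - t) * Metric.infDist x F := by
      intro t ht
      have e1 : dist (x + t • (q - x)) q = (1 - t) * dist x q := by
        have e : x + t • (q - x) - q = (1 - t) • (x - q) := by module
        rw [dist_eq_norm, dist_eq_norm, e, norm_smul, Real.norm_eq_abs,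
          abs_of_nonneg (by linarith [ht.2])]
      have e2 : dist x (x + t • (q - x)) = t * dist x q := by
        have e : x - (x + t • (q - x)) = t • (x - q) := by module
        rw [dist_eq_norm, dist_eq_norm, e, norm_smul, Real.norm_eq_abs,
          abs_of_nonneg ht.1]
      have e3 := Metric.infDist_le_dist_of_mem (x := x + t • (q - x)) hq
      have e4 := Metric.infDist_le_infDist_add_dist (s := F) (x := x) (y := x + t • (q - x))
      rw [e1, hqd] at e3
      rw [e2, hqd] at e4
      linarith
    have h2 : HasDerivWithinAt (fun t : ℝ => (1 - t) * Metric.infDist x F)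
        (-1 * Metric.infDist x F) (Set.Icc 0 1) 0 :=
      (((hasDerivAt_id (0 : ℝ)).const_sub 1).mul_const _).hasDerivWithinAt
    have h3 : HasDerivWithinAt (fun t : ℝ => (1 - t) * Metric.infDist x F) (D (q - x))
        (Set.Icc 0 1) 0 :=
      h1.congr (fun t ht => (heq t ht).symm) (heq 0 (by simp)).symm
    have := (uniqueDiffOn_Icc (zero_lt_one' ℝ) 0 (by simp)).eq_deriv _ h3 h2
    linarith
  intro q hq hqd
  have h1 := key q hq hqd
  have h2 := key (γ x) (hγ x).1 (hγ x).2
  have h3 : D ((q - x) + (γ x - x)) = -2 * Metric.infDist x F := by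
    rw [map_add, h1, h2]; ring
  have h4 : 2 * Metric.infDist x F ≤ ‖(q - x) + (γ x - x)‖ := by
    have h5 := D.le_opNorm ((q - x) + (γ x - x))
    rw [h3, Real.norm_eq_abs] at h5
    have h6 := neg_abs_le (-2 * Metric.infDist x F)
    have h7 : ‖D‖ * ‖(q - x) + (γ x - x)‖ ≤ 1 * ‖(q - x) + (γ x - x)‖ := by gcongr
    linarith
  have hq' : ‖q - x‖ = Metric.infDist x F := by rw [← dist_eq_norm, dist_comm]; exact hqd
  have hg' : ‖γ x - x‖ = Metric.infDist x F := by
    rw [← dist_eq_norm, dist_comm]; exact (hγ x).2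
  have hpar := parallelogram_law_with_norm ℝ (q - x) (γ x - x)
  rw [hq', hg'] at hpar
  have h0 : (0 : ℝ) ≤ Metric.infDist x F := Metric.infDist_nonneg
  have h8 : ‖(q - x) - (γ x - x)‖ * ‖(q - x) - (γ x - x)‖ ≤ 0 := by nlinarith
  have h9 : ‖(q - x) - (γ x - x)‖ = 0 := mul_self_eq_zero.1 (le_antisymm h8 (mul_self_nonneg _))
  have h10 : (q - x) - (γ x - x) = q - γ x := by abel
  rw [h10, norm_eq_zero, sub_eq_zero] at h9
  exact h9

/-- The choice at ties is arbitrary, so `γ` itself need not be measurable. On the conull set of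
points with a unique nearest point it is continuous, by compactness of `F`. -/
theorem aemeasurable (hγ : IsNearestPoint F γ) (hF : IsCompact F) :
    AEMeasurable γ (volume : Measure (Euc d)) := by
  set D := {x : Euc d | ∀ q ∈ F, dist x q = Metric.infDist x F → q = γ x} with hD
  have hcont : ContinuousOn γ D := by
    intro x hx
    rw [ContinuousWithinAt, Metric.tendsto_nhds]
    intro ε hε
    have hK : IsCompact (F \ Metric.ball (γ x) ε) := hF.diff Metric.isOpen_ball
    rcases (F \ Metric.ball (γ x) ε).eq_empty_or_nonempty with h0 | h0
    · refine Eventually.of_forall fun y => ?_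
      by_contra hy
      have : γ y ∈ F \ Metric.ball (γ x) ε := ⟨(hγ y).1, hy⟩
      rw [h0] at this
      exact this
    · obtain ⟨q, hq, hmin⟩ := hK.exists_isMinOn h0 (f := fun q => dist x q) (by fun_prop)
      have hlt : Metric.infDist x F < dist x q := by
        refine lt_of_le_of_ne (Metric.infDist_le_dist_of_mem hq.1) fun h => ?_
        have h2 := hx q hq.1 h.symm
        exact hq.2 (by rw [h2]; exact Metric.mem_ball_self hε)
      filter_upwards [mem_nhdsWithin_of_mem_nhds (Metric.ball_mem_nhds x
        (ε := (dist x q - Metric.infDist x F) / 2) (by linarith))] with y hy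
      by_contra hc
      have h1 : dist x q ≤ dist x (γ y) := hmin ⟨(hγ y).1, hc⟩
      have h2 := dist_triangle x y (γ y)
      have h3 := Metric.infDist_le_infDist_add_dist (s := F) (x := y) (y := x)
      rw [(hγ y).2] at h2
      rw [Metric.mem_ball] at hy
      rw [dist_comm x y] at h2
      linarith
  have hae : ∀ᵐ x : Euc d, x ∈ D := hγ.ae_unique
  obtain ⟨D', hD', hD'm, hD'ae⟩ := hae.exists_measurable_mem
  have h1 : AEMeasurable γ (volume.restrict D') :=
    (hcont.mono fun x hx => hD'ae x hx).aemeasurable hD'm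
  rwa [Measure.restrict_eq_self_of_ae_mem hD'] at h1

end IsNearestPoint

/-! ### From Kneser's inequality on the half-line to a limit of the density. -/

section Kneser

/-- Tonelli and the substitution `y = t * s`. Averaging over dilations is what brings Lebesgue
measure on `B` into estimates about the otherwise arbitrary measure `m`. -/
theorem lintegral_measure_preimage_mul (m : Measure ℝ) [IsFiniteMeasure m]
    (hm : m (Set.Iic 0) = 0) {α β : ℝ} (hα : 0 < α) (hαβ : α ≤ β) {B : Set ℝ}
    (hB : MeasurableSet B) :
    ∫⁻ t in Set.Icc α β, m ((fun s => t * s) ⁻¹' B) =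
      ∫⁻ y in B, ∫⁻ s in Set.Icc (y / β) (y / α), ENNReal.ofReal s⁻¹ ∂m := by
  have hβ : 0 < β := hα.trans_le hαβ
  have hpos : ∀ᵐ s ∂m, 0 < s := by
    rw [ae_iff]; simpa [Set.Iic] using hm
  have hind : Measurable fun p : ℝ × ℝ => B.indicator (1 : ℝ → ℝ≥0∞) (p.1 * p.2) :=
    (measurable_one.indicator hB).comp (measurable_fst.mul measurable_snd)
  have hinner : ∀ s : ℝ, 0 < s →
      ∫⁻ t in Set.Icc α β, B.indicator (1 : ℝ → ℝ≥0∞) (t * s) =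
        ∫⁻ y in B, (Set.Icc (y / β) (y / α)).indicator (fun s => ENNReal.ofReal s⁻¹) s := by
    intro s hs
    have h1 : ∀ t : ℝ, (Set.Icc α β).indicator (fun t => B.indicator (1 : ℝ → ℝ≥0∞) (t * s)) t =
        (fun y => (Set.Icc α β).indicator (fun _ => B.indicator (1 : ℝ → ℝ≥0∞) y) (y / s))
          (t * s) := by
      intro t
      simp only [mul_div_cancel_right₀ _ hs.ne']
      rfl
    have hmeas : Measurable fun y : ℝ =>
        (Set.Icc α β).indicator (fun _ => B.indicator (1 : ℝ → ℝ≥0∞) y) (y / s) := by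
      have : (fun y : ℝ => (Set.Icc α β).indicator (fun _ => B.indicator (1 : ℝ → ℝ≥0∞) y) (y / s))
          = ((fun y => y / s) ⁻¹' Set.Icc α β).indicator (B.indicator 1) := by
        funext y; rfl
      rw [this]
      exact (measurable_one.indicator hB).indicator
        ((measurable_id.div_const s) measurableSet_Icc)
    rw [← lintegral_indicator measurableSet_Icc]
    simp_rw [h1]
    rw [← lintegral_map hmeas (measurable_mul_const s), Real.map_volume_mul_right hs.ne',
      lintegral_smul_measure, smul_eq_mul, ← lintegral_const_mul _ hmeas,
      ← lintegral_indicator hB]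
    refine lintegral_congr fun y => ?_
    have h2 : y / s ∈ Set.Icc α β ↔ s ∈ Set.Icc (y / β) (y / α) := by
      rw [Set.mem_Icc, Set.mem_Icc, le_div_iff₀ hs, div_le_iff₀ hs, div_le_iff₀ hβ,
        le_div_iff₀ hα, mul_comm s β, mul_comm s α, and_comm]
    by_cases hy : y ∈ B <;> by_cases hys : y / s ∈ Set.Icc α β
    · simp only [Set.indicator_of_mem hy, Set.indicator_of_mem hys, Set.indicator_of_mem (h2.1 hys),
        Pi.one_apply, mul_one, abs_of_pos (inv_pos.2 hs)]
    · simp only [Set.indicator_of_mem hy, Set.indicator_of_notMem hys,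
        Set.indicator_of_notMem (mt h2.2 hys), mul_zero]
    · simp only [Set.indicator_of_notMem hy, Set.indicator_of_mem hys, mul_zero]
    · simp only [Set.indicator_of_notMem hy, Set.indicator_of_notMem hys, mul_zero]
  have hset : MeasurableSet {p : ℝ × ℝ | p.2 ∈ Set.Icc (p.1 / β) (p.1 / α)} := by
    have : {p : ℝ × ℝ | p.2 ∈ Set.Icc (p.1 / β) (p.1 / α)} =
        {p | p.1 / β ≤ p.2} ∩ {p | p.2 ≤ p.1 / α} := rfl
    rw [this]
    exact (measurableSet_le (by fun_prop) (by fun_prop)).inter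
      (measurableSet_le (by fun_prop) (by fun_prop))
  calc ∫⁻ t in Set.Icc α β, m ((fun s => t * s) ⁻¹' B)
      = ∫⁻ t in Set.Icc α β, ∫⁻ s, B.indicator (1 : ℝ → ℝ≥0∞) (t * s) ∂m := by
        refine lintegral_congr fun t => ?_
        rw [← lintegral_indicator_one (measurable_const_mul t hB)]
        rfl
    _ = ∫⁻ s, (∫⁻ t in Set.Icc α β, B.indicator (1 : ℝ → ℝ≥0∞) (t * s)) ∂m :=
        lintegral_lintegral_swap hind.aemeasurable
    _ = ∫⁻ s, (∫⁻ y in B, (Set.Icc (y / β) (y / α)).indicator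
          (fun s => ENNReal.ofReal s⁻¹) s) ∂m :=
        lintegral_congr_ae (hpos.mono fun s hs => hinner s hs)
    _ = ∫⁻ y in B, ∫⁻ s, (Set.Icc (y / β) (y / α)).indicator
          (fun s => ENNReal.ofReal s⁻¹) s ∂m := by
        refine lintegral_lintegral_swap (Measurable.aemeasurable ?_)
        have hs : MeasurableSet {p : ℝ × ℝ | p.1 ∈ Set.Icc (p.2 / β) (p.2 / α)} :=
          measurable_swap hset
        have : (Function.uncurry fun s y => (Set.Icc (y / β) (y / α)).indicator
            (fun s => ENNReal.ofReal s⁻¹) s) =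
            {p : ℝ × ℝ | p.1 ∈ Set.Icc (p.2 / β) (p.2 / α)}.indicator
              (fun p => ENNReal.ofReal p.1⁻¹) := by
          funext p; rfl
        rw [this]
        exact (ENNReal.measurable_ofReal.comp measurable_fst.inv).indicator hs
    _ = _ := by
        refine lintegral_congr fun y => ?_
        rw [lintegral_indicator measurableSet_Icc]

/-- The abstract form of Kneser's inequality, for a measure on the half-line. -/
structure IsKneser (d : ℕ) (m : Measure ℝ) : Prop where
  iic_eq_zero : m (Set.Iic 0) = 0
  le_mul : ∀ τ : ℝ≥0, 1 ≤ τ → ∀ B, MeasurableSet B →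
    m B ≤ (τ : ℝ≥0∞) ^ d * m ((fun s => (τ : ℝ) * s) ⁻¹' B)

variable {d : ℕ} {m : Measure ℝ} [IsFiniteMeasure m]

/-- Kneser's inequality is averaged over dilations `t ∈ [1, lam]`. On the other side only the masses
of the intervals `[y / lam, y]` survive, so a bound on intervals becomes a bound on every measurable
set. -/
theorem IsKneser.measure_mul_le (h : IsKneser d m) {lam : ℝ} (hlam : 1 < lam) {B : Set ℝ}
    (hB : MeasurableSet B) (hB0 : B ⊆ Set.Ioi 0) (hfin : volume B ≠ ⊤)
    {C : ℝ} (hC0 : 0 ≤ C)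
    (hC : ∀ y ∈ B, m.real (Set.Icc (y / lam) y) ≤ C * y) :
    m.real B * (lam - 1) ≤ lam ^ d * (lam * C * volume.real B) := by
  have hl0 : 0 < lam := by linarith
  have h1 := lintegral_measure_preimage_mul m h.iic_eq_zero zero_lt_one hlam.le hB
  have h2 : ∫⁻ y in B, ∫⁻ s in Set.Icc (y / lam) (y / 1), ENNReal.ofReal s⁻¹ ∂m ≤
      ∫⁻ y in B, ENNReal.ofReal (lam * C) := by
    refine setLIntegral_mono measurable_const fun y hy => ?_
    have hy0 : 0 < y := hB0 hy
    calc ∫⁻ s in Set.Icc (y / lam) (y / 1), ENNReal.ofReal s⁻¹ ∂m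
        ≤ ∫⁻ s in Set.Icc (y / lam) (y / 1), ENNReal.ofReal (lam / y) ∂m := by
          refine setLIntegral_mono measurable_const fun s hs => ENNReal.ofReal_le_ofReal ?_
          rw [← inv_div]
          exact inv_anti₀ (by positivity) hs.1
      _ = ENNReal.ofReal (lam / y) * ENNReal.ofReal (m.real (Set.Icc (y / lam) y)) := by
          rw [setLIntegral_const, div_one, ofReal_measureReal]
      _ ≤ ENNReal.ofReal (lam / y) * ENNReal.ofReal (C * y) := by
          gcongr; exact hC y hy
      _ = ENNReal.ofReal (lam * C) := by
          rw [← ENNReal.ofReal_mul (by positivity)]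
          congr 1
          field_simp
  rw [← h1, setLIntegral_const] at h2
  have h3 : ∫⁻ _t in Set.Icc 1 lam, m B ≤
      ∫⁻ t in Set.Icc 1 lam, ENNReal.ofReal (lam ^ d) * m ((fun s => t * s) ⁻¹' B) := by
    refine setLIntegral_mono' measurableSet_Icc fun t ht => ?_
    have h4 := h.le_mul t.toNNReal (by rw [Real.one_le_toNNReal]; exact ht.1) B hB
    rw [Real.coe_toNNReal _ (by linarith [ht.1])] at h4
    refine h4.trans ?_
    gcongr
    rw [ENNReal.ofReal_pow hl0.le]
    gcongr
    exact ENNReal.ofReal_le_ofReal ht.2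
  rw [setLIntegral_const, Real.volume_Icc, lintegral_const_mul' _ _ ENNReal.ofReal_ne_top] at h3
  have h5 := h3.trans (mul_le_mul_right h2 _)
  have h6 := ENNReal.toReal_mono (by finiteness) h5
  rw [ENNReal.toReal_mul, ENNReal.toReal_mul, ENNReal.toReal_mul,
    ENNReal.toReal_ofReal (by linarith), ENNReal.toReal_ofReal (by positivity),
    ENNReal.toReal_ofReal (by positivity)] at h6
  exact h6

/-- The same average over `t ∈ [lam⁻¹, 1]`, with Kneser's inequality applied to the dilation `t⁻¹`,
which bounds `m B` from below. -/
theorem IsKneser.mul_le_measure (h : IsKneser d m) {lam : ℝ} (hlam : 1 < lam) {B : Set ℝ}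
    (hB : MeasurableSet B) (hB0 : B ⊆ Set.Ioi 0) {c : ℝ}
    (hc : ∀ y ∈ B, c * y ≤ m.real (Set.Icc y (lam * y))) :
    c * volume.real B ≤ (lam - 1) * (lam ^ d * m.real B) := by
  have hl0 : 0 < lam := by linarith
  rcases le_or_gt c 0 with hc0 | hc0
  · exact (mul_nonpos_of_nonpos_of_nonneg hc0 measureReal_nonneg).trans
      (mul_nonneg (by linarith) (by positivity))
  have hli : lam⁻¹ < 1 := inv_lt_one_of_one_lt₀ hlam
  have h1 := lintegral_measure_preimage_mul m h.iic_eq_zero (inv_pos.2 hl0) hli.le hB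
  have h2 : ∫⁻ y in B, ENNReal.ofReal (c / lam) ≤
      ∫⁻ y in B, ∫⁻ s in Set.Icc (y / 1) (y / lam⁻¹), ENNReal.ofReal s⁻¹ ∂m := by
    refine setLIntegral_mono' hB fun y hy => ?_
    have hy0 : 0 < y := hB0 hy
    calc ENNReal.ofReal (c / lam) = ENNReal.ofReal (lam * y)⁻¹ * ENNReal.ofReal (c * y) := by
          rw [← ENNReal.ofReal_mul (by positivity)]
          congr 1
          field_simp
      _ ≤ ENNReal.ofReal (lam * y)⁻¹ * ENNReal.ofReal (m.real (Set.Icc y (lam * y))) := by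
          gcongr; exact hc y hy
      _ = ∫⁻ s in Set.Icc (y / 1) (y / lam⁻¹), ENNReal.ofReal (lam * y)⁻¹ ∂m := by
          rw [setLIntegral_const, div_one, ofReal_measureReal, div_inv_eq_mul, mul_comm y]
      _ ≤ _ := by
          refine setLIntegral_mono' measurableSet_Icc fun s hs => ENNReal.ofReal_le_ofReal ?_
          rw [div_one, div_inv_eq_mul, mul_comm y] at hs
          exact inv_anti₀ (hy0.trans_le hs.1) hs.2
  rw [← h1, setLIntegral_const] at h2
  have h3 : ∫⁻ t in Set.Icc lam⁻¹ 1, m ((fun s => t * s) ⁻¹' B) ≤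
      ∫⁻ _t in Set.Icc lam⁻¹ 1, ENNReal.ofReal (lam ^ d) * m B := by
    refine setLIntegral_mono' measurableSet_Icc fun t ht => ?_
    have ht0 : 0 < t := (inv_pos.2 hl0).trans_le ht.1
    have h4 := h.le_mul t⁻¹.toNNReal
      (by rw [Real.one_le_toNNReal]; exact (one_le_inv₀ ht0).2 ht.2) _ (measurable_const_mul t hB)
    rw [Real.coe_toNNReal _ (by positivity), ← Set.preimage_comp] at h4
    have hid : ((fun s => t * s) ∘ fun s => t⁻¹ * s) = (id : ℝ → ℝ) := by
      funext s; simp [mul_inv_cancel_left₀ ht0.ne']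
    rw [hid, Set.preimage_id] at h4
    refine h4.trans ?_
    gcongr
    rw [ENNReal.ofReal_pow hl0.le]
    gcongr
    exact ENNReal.ofReal_le_ofReal ((inv_le_comm₀ ht0 hl0).2 ht.1)
  rw [setLIntegral_const, Real.volume_Icc] at h3
  have h5 := h2.trans h3
  have h6 := ENNReal.toReal_mono (by finiteness) h5
  rw [ENNReal.toReal_mul, ENNReal.toReal_mul, ENNReal.toReal_mul,
    ENNReal.toReal_ofReal (by positivity), ENNReal.toReal_ofReal (by positivity),
    ENNReal.toReal_ofReal (by linarith)] at h6
  change c / lam * volume.real B ≤ lam ^ d * m.real B * (1 - lam⁻¹) at h6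
  have h7 := mul_le_mul_of_nonneg_left h6 hl0.le
  have e1 : lam * (c / lam * volume.real B) = c * volume.real B := by field_simp
  have e2 : lam * (lam ^ d * m.real B * (1 - lam⁻¹)) = (lam - 1) * (lam ^ d * m.real B) := by
    field_simp
  rwa [e1, e2] at h7

/-- For a null set the averaged right-hand side is an integral over that null set. -/
theorem IsKneser.absolutelyContinuous (h : IsKneser d m) : m ≪ volume := by
  refine Measure.AbsolutelyContinuous.mk fun N hN hN0 => ?_
  have h1 : m (N ∩ Set.Ioi 0) = 0 := by
    have hM : MeasurableSet (N ∩ Set.Ioi 0) := hN.inter measurableSet_Ioi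
    have h0 : volume (N ∩ Set.Ioi 0) = 0 := measure_mono_null Set.inter_subset_left hN0
    have h2 := lintegral_measure_preimage_mul m h.iic_eq_zero zero_lt_one one_le_two hM
    rw [Measure.restrict_eq_zero.2 h0, lintegral_zero_measure] at h2
    have h3 : ∫⁻ _t in Set.Icc (1 : ℝ) 2, m (N ∩ Set.Ioi 0) ≤
        ∫⁻ t in Set.Icc (1 : ℝ) 2, ENNReal.ofReal (2 ^ d) *
          m ((fun s => t * s) ⁻¹' (N ∩ Set.Ioi 0)) := by
      refine setLIntegral_mono' measurableSet_Icc fun t ht => ?_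
      have h4 := h.le_mul t.toNNReal (by rw [Real.one_le_toNNReal]; exact ht.1) _ hM
      rw [Real.coe_toNNReal _ (by linarith [ht.1])] at h4
      refine h4.trans ?_
      gcongr
      rw [ENNReal.ofReal_pow zero_le_two]
      gcongr
      exact ENNReal.ofReal_le_ofReal ht.2
    rw [setLIntegral_const, Real.volume_Icc, lintegral_const_mul' _ _ ENNReal.ofReal_ne_top, h2,
      mul_zero, nonpos_iff_eq_zero] at h3
    norm_num at h3
    exact h3
  have h2 : N ⊆ (N ∩ Set.Ioi 0) ∪ Set.Iic 0 := fun x hx => by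
    rcases le_or_gt x 0 with h | h
    · exact Or.inr h
    · exact Or.inl ⟨hx, h⟩
  exact measure_mono_null h2 (measure_union_null h1 h.iic_eq_zero)

end Kneser

/-- The measure `m` has a density with limit `a` along `l`: on small sets of `l`, it is
proportional to Lebesgue measure up to a small relative error. -/
def LimDensity (m : Measure ℝ) (l : Filter ℝ) (a : ℝ) : Prop :=
  ∀ ε > 0, ∀ᶠ B in l.smallSets, MeasurableSet B →
    |m.real B - a * volume.real B| ≤ ε * volume.real B

/-- A Tauberian argument. Fix `lam > 1` so near `1` that the loss `lam ^ d` is negligible; the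
asymptotics of `m (0, r)` give those of `m [y, lam * y]` by subtraction, and the two averaged
inequalities carry them to all small sets. -/
theorem IsKneser.limDensity {d : ℕ} {m : Measure ℝ} [IsFiniteMeasure m] (h : IsKneser d m)
    {a : ℝ} (ha : 0 ≤ a)
    (hlim : ∀ η > 0, ∀ᶠ r in 𝓝[>] 0, |m.real (Set.Ioo 0 r) - a * r| ≤ η * r) :
    LimDensity m (𝓝[>] 0) a := by
  intro ε hε
  obtain ⟨lam, ⟨hup, hlow⟩, hlam⟩ : ∃ lam : ℝ, (lam ^ d * (a + ε / 4) < a + ε ∧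
      (a - ε) * lam ^ d < a - ε / 4) ∧ 1 < lam := by
    have hc : Tendsto (fun x : ℝ => x ^ d) (𝓝[>] 1) (𝓝 1) := by
      have := ((continuous_pow d).tendsto (1 : ℝ)).mono_left (nhdsWithin_le_nhds (s := Set.Ioi 1))
      rwa [one_pow] at this
    have h1 := (hc.mul_const (a + ε / 4)).eventually (gt_mem_nhds (by linarith : 1 * (a + ε / 4) < a + ε))
    have h2 := (hc.const_mul (a - ε)).eventually (gt_mem_nhds (by linarith : (a - ε) * 1 < a - ε / 4))
    exact ((h1.and h2).and self_mem_nhdsWithin).exists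
  have hl0 : 0 < lam := by linarith
  -- The subtraction error `2 η y` has to be small against the interval length, which is of order
  -- `(lam - 1) y`; hence `η` is chosen after `lam`.
  set η := ε / 4 * (lam - 1) / (2 * lam) with hη
  have hη0 : 0 < η := by
    have : 0 < lam - 1 := by linarith
    positivity
  obtain ⟨δ, hδ, hδr⟩ := mem_nhdsGT_iff_exists_Ioo_subset.1 (hlim η hη0)
  have hδ' : (0 : ℝ) < δ := hδ
  have hlim' : ∀ r, 0 < r → r < δ → |m.real (Set.Ioo 0 r) - a * r| ≤ η * r :=
    fun r h0 h1 => hδr ⟨h0, h1⟩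
  have hIcc : ∀ x y, 0 < x → x ≤ y → y < δ →
      |m.real (Set.Icc x y) - a * (y - x)| ≤ 2 * η * y := by
    intro x y hx hxy hy
    have hsing : m {y} = 0 := h.absolutelyContinuous (by simp)
    have e1 : m.real (Set.Icc x y) = m.real (Set.Ioo 0 y) - m.real (Set.Ioo 0 x) := by
      have hun : Set.Ioo 0 y = Set.Ioo 0 x ∪ Set.Ico x y := by
        rw [Set.Ioo_union_Ico_eq_Ioo hx hxy]
      have hdj : Disjoint (Set.Ioo 0 x) (Set.Ico x y) :=
        Set.disjoint_left.2 fun z hz hz' => not_le.2 hz.2 hz'.1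
      rw [hun, measureReal_union hdj measurableSet_Ico, add_sub_cancel_left,
        ← Set.Ico_union_right hxy]
      rw [measureReal_def, measureReal_def]
      congr 1
      exact le_antisymm ((measure_union_le _ _).trans (by rw [hsing, add_zero]))
        (measure_mono Set.subset_union_left)
    have h1 := abs_le.1 (hlim' x hx (hxy.trans_lt hy))
    have h2 := abs_le.1 (hlim' y (hx.trans_le hxy) hy)
    rw [e1, abs_le]
    constructor <;> nlinarith
  have hsm : Set.Ioo 0 (δ / lam) ∈ 𝓝[>] (0 : ℝ) := Ioo_mem_nhdsGT (by positivity)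
  filter_upwards [eventually_smallSets.2 ⟨_, hsm, fun t ht => ht⟩] with B hBs hB
  have hB0 : B ⊆ Set.Ioi 0 := fun y hy => (hBs hy).1
  have hBδ : ∀ y ∈ B, lam * y < δ := fun y hy => by
    have := (lt_div_iff₀ hl0).1 (hBs hy).2
    linarith
  have hyl : ∀ y ∈ B, y ≤ lam * y := fun y hy => by
    have : 0 < y := hB0 hy
    nlinarith
  have hV : volume B ≠ ⊤ := ne_top_of_le_ne_top (by simp) (measure_mono hBs)
  have hV0 : 0 ≤ volume.real B := measureReal_nonneg
  have hη2 : 2 * η * lam = ε / 4 * (lam - 1) := by rw [hη]; field_simp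
  have hu := (h.measure_mul_le hlam hB hB0 hV (C := a * (1 - lam⁻¹) + 2 * η)
    (by
      have : lam⁻¹ ≤ 1 := (inv_lt_one_of_one_lt₀ hlam).le
      have : 0 ≤ a * (1 - lam⁻¹) := mul_nonneg ha (by linarith)
      positivity)
    (fun y hy => by
      have hy0 : 0 < y := hB0 hy
      have h1 := (abs_le.1 (hIcc (y / lam) y (by positivity) (div_le_self hy0.le hlam.le)
        ((hyl y hy).trans_lt (hBδ y hy)))).2
      rw [div_eq_mul_inv] at h1 ⊢
      linarith))
  have hlo := h.mul_le_measure hlam hB hB0 (c := a * (lam - 1) - 2 * η * lam)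
    (fun y hy => by
      have hy0 : 0 < y := hB0 hy
      have h1 := (abs_le.1 (hIcc y (lam * y) hy0 (hyl y hy) (hBδ y hy))).1
      linarith)
  have hl1 : 0 < lam - 1 := by linarith
  have hu' : m.real B ≤ lam ^ d * (a + ε / 4) * volume.real B := by
    have e : lam ^ d * (lam * (a * (1 - lam⁻¹) + 2 * η) * volume.real B) =
        (lam ^ d * (a + ε / 4) * volume.real B) * (lam - 1) := by
      have : lam * (a * (1 - lam⁻¹) + 2 * η) = (a + ε / 4) * (lam - 1) := by
        rw [mul_add, mul_left_comm lam a, mul_sub, mul_inv_cancel₀ hl0.ne']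
        linarith
      rw [this]; ring
    rw [e] at hu
    exact le_of_mul_le_mul_right hu hl1
  have hlo' : (a - ε / 4) * volume.real B ≤ lam ^ d * m.real B := by
    have e : (a * (lam - 1) - 2 * η * lam) * volume.real B =
        (lam - 1) * ((a - ε / 4) * volume.real B) := by rw [hη2]; ring
    rw [e] at hlo
    exact le_of_mul_le_mul_left hlo hl1
  rw [abs_le]
  constructor
  · have h1 : lam ^ d * ((a - ε) * volume.real B) ≤ lam ^ d * m.real B := by
      refine le_trans ?_ hlo'
      rw [← mul_assoc, mul_comm (lam ^ d)]
      exact mul_le_mul_of_nonneg_right hlow.le hV0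
    have := le_of_mul_le_mul_left h1 (by positivity)
    linarith
  · have := mul_le_mul_of_nonneg_right hup.le hV0
    linarith

namespace LimDensity

variable {m m' : Measure ℝ} {l : Filter ℝ} {a a' : ℝ}

theorem add [IsFiniteMeasure m] [IsFiniteMeasure m'] (h : LimDensity m l a)
    (h' : LimDensity m' l a') : LimDensity (m + m') l (a + a') := by
  intro ε hε
  filter_upwards [h (ε / 2) (half_pos hε), h' (ε / 2) (half_pos hε)] with B h1 h2 hB
  have h1 := abs_le.1 (h1 hB)
  have h2 := abs_le.1 (h2 hB)
  rw [measureReal_add_apply, abs_le]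
  constructor <;> linarith

theorem const_smul (h : LimDensity m l a) (c : ℝ≥0) : LimDensity (c • m) l (c * a) := by
  intro ε hε
  filter_upwards [h (ε / (c + 1)) (by positivity)] with B h1 hB
  rw [measureReal_nnreal_smul_apply, mul_assoc, ← mul_sub, abs_mul, abs_of_nonneg c.coe_nonneg]
  have hc : (c : ℝ) / (c + 1) ≤ 1 := (div_le_one (by positivity)).2 (by linarith)
  have hV : 0 ≤ volume.real B := measureReal_nonneg
  calc (c : ℝ) * |m.real B - a * volume.real B|
      ≤ c * (ε / (c + 1) * volume.real B) := by gcongr; exact h1 hB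
    _ = c / (c + 1) * (ε * volume.real B) := by ring
    _ ≤ 1 * (ε * volume.real B) := by gcongr
    _ = _ := one_mul _

theorem map_neg (h : LimDensity m l a) {l' : Filter ℝ} (hl : Tendsto (fun x : ℝ => -x) l' l) :
    LimDensity (m.map fun x => -x) l' a := by
  intro ε hε
  obtain ⟨s, hs, hsB⟩ := eventually_smallSets.1 (h ε hε)
  refine eventually_smallSets.2 ⟨_, hl hs, fun B hBs hB => ?_⟩
  have h1 := hsB ((fun x : ℝ => -x) ⁻¹' B) (fun x hx => by simpa using hBs hx) (hB.preimage measurable_neg)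
  have h2 : volume.real ((fun x : ℝ => -x) ⁻¹' B) = volume.real B := by
    have : (fun x : ℝ => -x) ⁻¹' B = -B := rfl
    rw [this, measureReal_def, Measure.measure_neg, measureReal_def]
  rw [h2] at h1
  rwa [measureReal_def, Measure.map_apply measurable_neg hB]

theorem eq_zero (h : LimDensity (0 : Measure ℝ) (𝓝[>] 0) a) : a = 0 := by
  by_contra ha
  obtain ⟨s, hs, hsB⟩ := eventually_smallSets.1 (h (|a| / 2) (by positivity))
  obtain ⟨δ, hδ, hδs⟩ := mem_nhdsGT_iff_exists_Ioo_subset.1 hs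
  have hδ' : (0 : ℝ) < δ := hδ
  have h1 := hsB _ hδs measurableSet_Ioo
  have h2 : volume.real (Set.Ioo 0 δ) = δ := by simp [measureReal_def, hδ'.le]
  rw [h2] at h1
  simp only [measureReal_zero_apply, zero_sub, abs_neg, abs_mul, abs_of_pos hδ'] at h1
  have : 0 < |a| := abs_pos.2 ha
  nlinarith

/-- Testing the Radon-Nikodym derivative on all measurable subsets of one small set confines it
almost everywhere there to `[a - ε / 2, a + ε / 2]`. For this reason `LimDensity` quantifies over
all small sets and not only over intervals. -/
theorem tendsto_rnDeriv [IsFiniteMeasure m] [l.IsMeasurablyGenerated] (hl : l ≤ 𝓝 0)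
    (hm : m ≪ volume) (h : LimDensity m l a) :
    Tendsto (fun t => (m.rnDeriv volume t).toReal) (l ⊓ ae volume) (𝓝 a) := by
  rw [Metric.tendsto_nhds]
  intro ε hε
  obtain ⟨s', hs', hsB'⟩ := eventually_smallSets.1 (h (ε / 2) (half_pos hε))
  obtain ⟨s, hs, hsm, hss⟩ := IsMeasurablyGenerated.exists_measurable_subset
    (inter_mem hs' (hl (Metric.ball_mem_nhds 0 one_pos)))
  have hfin : IsFiniteMeasure (volume.restrict s) := by
    refine ⟨?_⟩
    rw [Measure.restrict_apply_univ]
    exact (measure_mono (hss.trans Set.inter_subset_right)).trans_lt measure_ball_lt_top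
  have hint : Integrable (fun t => (m.rnDeriv volume t).toReal) (volume.restrict s) :=
    Measure.integrable_toReal_rnDeriv.restrict
  have key : ∀ B, MeasurableSet B →
      ∫ t in B, (m.rnDeriv volume t).toReal ∂(volume.restrict s) = m.real (B ∩ s) ∧
      |m.real (B ∩ s) - a * volume.real (B ∩ s)| ≤ ε / 2 * volume.real (B ∩ s) := by
    intro B hB
    refine ⟨?_, hsB' _ (Set.inter_subset_right.trans (hss.trans Set.inter_subset_left))
      (hB.inter hsm)⟩
    rw [Measure.restrict_restrict hB, Measure.setIntegral_toReal_rnDeriv hm]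
  have hconst : ∀ (c : ℝ) (B : Set ℝ), MeasurableSet B →
      ∫ _t in B, c ∂(volume.restrict s) = c * volume.real (B ∩ s) := by
    intro c B hB
    rw [Measure.restrict_restrict hB, setIntegral_const, smul_eq_mul, mul_comm]
  have hup : (fun t => (m.rnDeriv volume t).toReal) ≤ᵐ[volume.restrict s] fun _ => a + ε / 2 := by
    refine ae_le_of_forall_setIntegral_le hint (integrable_const _) fun B hB _ => ?_
    rw [(key B hB).1, hconst _ B hB]
    have := (abs_le.1 (key B hB).2).2
    linarith
  have hlo : (fun _ => a - ε / 2) ≤ᵐ[volume.restrict s] fun t => (m.rnDeriv volume t).toReal := by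
    refine ae_le_of_forall_setIntegral_le (integrable_const _) hint fun B hB _ => ?_
    rw [(key B hB).1, hconst _ B hB]
    have := (abs_le.1 (key B hB).2).1
    linarith
  have hu := (ae_restrict_iff' hsm).1 hup
  have hd := (ae_restrict_iff' hsm).1 hlo
  have h1 : ∀ᶠ t in l ⊓ ae volume, t ∈ s := (show l ⊓ ae volume ≤ l from inf_le_left) hs
  have h2 : ∀ᶠ t in l ⊓ ae volume, t ∈ s → (m.rnDeriv volume t).toReal ≤ a + ε / 2 :=
    (show l ⊓ ae volume ≤ ae volume from inf_le_right) hu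
  have h3 : ∀ᶠ t in l ⊓ ae volume, t ∈ s → a - ε / 2 ≤ (m.rnDeriv volume t).toReal :=
    (show l ⊓ ae volume ≤ ae volume from inf_le_right) hd
  filter_upwards [h1, h2, h3] with t ht h4 h5
  have h4 := h4 ht
  have h5 := h5 ht
  rw [Real.dist_eq, abs_lt]
  constructor <;> linarith

end LimDensity

/-! ### Collar densities, and the passage from volume to the weight `f`. -/

/-- The volumes of the collars over any Borel set `A ⊆ F` have density `S(A)` at distance `0`. -/
def HasCollarDensity {d : ℕ} (F : Set (Euc d)) (γ : Euc d → Euc d) (Z : Set (Euc d))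
    (S : Measure (Euc d)) : Prop :=
  ∀ A, MeasurableSet A → A ⊆ F → ∀ ε > 0, ∀ᶠ B in (𝓝[>] (0 : ℝ)).smallSets, MeasurableSet B →
    |volume.real (collar F γ Z A B) - S.real A * volume.real B| ≤ ε * volume.real B

theorem nullMeasurableSet_collar {d : ℕ} {F : Set (Euc d)} {γ : Euc d → Euc d}
    (hγ : AEMeasurable γ volume) {Z A : Set (Euc d)} (hZ : MeasurableSet Z) (hA : MeasurableSet A)
    {B : Set ℝ} (hB : MeasurableSet B) : NullMeasurableSet (collar F γ Z A B) volume :=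
  hZ.nullMeasurableSet.inter
    (((Metric.continuous_infDist_pt F).measurable hB).nullMeasurableSet.inter
      (hγ.nullMeasurable hA))

theorem volume_collar_ne_top {d : ℕ} {F : Set (Euc d)} {γ : Euc d → Euc d}
    (hF : IsCompact F) (hγ : IsNearestPoint F γ) {Z A : Set (Euc d)} {B : Set ℝ}
    {R : ℝ} (hB : B ⊆ Set.Iio R) : volume (collar F γ Z A B) ≠ ⊤ := by
  obtain ⟨C, hC⟩ := hF.isBounded.exists_norm_le
  refine ne_top_of_le_ne_top (measure_ball_lt_top (x := (0 : Euc d)) (r := R + C)).ne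
    (measure_mono fun x hx => ?_)
  have h1 : Metric.infDist x F < R := hB hx.2.1
  rw [← (hγ x).2] at h1
  have h2 := hC _ (hγ x).1
  rw [mem_ball_zero_iff]
  calc ‖x‖ ≤ ‖x - γ x‖ + ‖γ x‖ := by simpa using norm_add_le (x - γ x) (γ x)
    _ < R + C := by rw [dist_eq_norm] at h1; linarith

/-- Cut `A` into level sets of `h` of height `η`. Over the `k`-th one, near `F`, the weight `f` lies
between `(k - 1) η` and `(k + 2) η`, so its integral is a volume up to controlled error; then sum
the finitely many layers. -/
theorem HasCollarDensity.limDensity_withDensity {d : ℕ} {F : Set (Euc d)} {γ : Euc d → Euc d}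
    {Z : Set (Euc d)} {S : Measure (Euc d)} (hF : IsCompact F) (hγ : IsNearestPoint F γ)
    (hZ : MeasurableSet Z) (hS : S F ≠ ⊤) (H : HasCollarDensity F γ Z S)
    {f : Euc d → ℝ} (hf : Measurable f)
    {h : Euc d → ℝ} {A : Set (Euc d)} (hA : MeasurableSet A) (hAF : A ⊆ F) (hhm : Measurable h)
    (hh0 : ∀ x ∈ A, 0 ≤ h x) {M : ℝ} (hhM : ∀ x ∈ A, h x ≤ M)
    (hfh : ∀ η > 0, ∃ δ > 0, ∀ x ∈ Z, 0 < Metric.infDist x F → Metric.infDist x F < δ →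
      |f x - h (γ x)| ≤ η)
    {m : Measure ℝ}
    (hm : ∀ᶠ B in (𝓝[>] (0 : ℝ)).smallSets, MeasurableSet B →
      m B = (volume.withDensity fun x => ENNReal.ofReal (f x)) (collar F γ Z A B)) :
    LimDensity m (𝓝[>] 0) (∫ x in A, h x ∂S) := by
  intro ε hε
  have hSA : S A ≠ ⊤ := ne_top_of_le_ne_top hS (measure_mono hAF)
  have hγm := hγ.aemeasurable hF
  set η : ℝ := ε / (4 * (S.real A + 1)) with hη
  have hη0 : 0 < η := by have : 0 ≤ S.real A := measureReal_nonneg; positivity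
  obtain ⟨N, hN⟩ := exists_nat_gt (M / η)
  set level : ℕ → Set (Euc d) := fun k => A ∩ (fun x => ⌊h x / η⌋₊) ⁻¹' {k} with hlevel
  have hlm : ∀ k, MeasurableSet (level k) := fun k =>
    hA.inter ((Nat.measurable_floor.comp (hhm.div_const η)) (measurableSet_singleton k))
  have hlb : ∀ k, ∀ x ∈ level k, k * η ≤ h x ∧ h x ≤ (k + 1) * η := by
    intro k x hx
    have hk : ⌊h x / η⌋₊ = k := hx.2
    have h0 : 0 ≤ h x / η := div_nonneg (hh0 x hx.1) hη0.le
    constructor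
    · rw [← le_div_iff₀ hη0, ← hk]; exact Nat.floor_le h0
    · rw [← div_le_iff₀ hη0, ← hk]; exact (Nat.lt_floor_add_one _).le
  have hcover : A = ⋃ k ∈ Finset.range N, level k := by
    ext x
    simp only [Set.mem_iUnion, Finset.mem_range, exists_prop]
    constructor
    · intro hx
      refine ⟨⌊h x / η⌋₊, ?_, hx, rfl⟩
      have h1 : h x / η ≤ M / η := by gcongr; exact hhM x hx
      exact (Nat.floor_lt (div_nonneg (hh0 x hx) hη0.le)).2 (h1.trans_lt hN)
    · rintro ⟨k, -, hx⟩; exact hx.1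
  have hdisj : Set.PairwiseDisjoint (↑(Finset.range N)) level := by
    intro i _ j _ hij
    refine Set.disjoint_left.2 fun x hx hx' => hij ?_
    have h1 : ⌊h x / η⌋₊ = i := hx.2
    have h2 : ⌊h x / η⌋₊ = j := hx'.2
    rw [← h1, h2]
  set W : ℝ := ∑ k ∈ Finset.range N, ((k : ℝ) + 2) * η with hW
  have hW0 : 0 ≤ W := Finset.sum_nonneg fun k _ => by positivity
  -- The volume errors of the layers are multiplied by the upper bounds of `f`, whose sum is `W`.
  set ε' : ℝ := ε / (2 * (W + 1)) with hε'
  have hW1 : 0 < 2 * (W + 1) := by linarith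
  have hε'0 : 0 < ε' := div_pos hε hW1
  obtain ⟨δ, hδ0, hδ⟩ := hfh η hη0
  have hIoo : Set.Ioo 0 δ ∈ 𝓝[>] (0 : ℝ) := Ioo_mem_nhdsGT hδ0
  have hall : ∀ᶠ B in (𝓝[>] (0 : ℝ)).smallSets, ∀ k ∈ Finset.range N, MeasurableSet B →
      |volume.real (collar F γ Z (level k) B) - S.real (level k) * volume.real B| ≤
        ε' * volume.real B :=
    (Finset.eventually_all _).2 fun k _ =>
      H (level k) (hlm k) (Set.inter_subset_left.trans hAF) ε' hε'0
  filter_upwards [hm, hall, eventually_smallSets.2 ⟨_, hIoo, fun t ht => ht⟩] with B hmB hBk hBδ hB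
  set ν := volume.withDensity fun x => ENNReal.ofReal (f x) with hν
  set V := volume.real B with hV
  have hV0 : 0 ≤ V := measureReal_nonneg
  have hcollar : collar F γ Z A B = ⋃ k ∈ Finset.range N, collar F γ Z (level k) B := by
    ext x
    have : γ x ∈ A ↔ ∃ k ∈ Finset.range N, γ x ∈ level k := by
      conv_lhs => rw [hcover]
      simp
    simp only [collar, Set.mem_ofPred_eq, Set.mem_iUnion, this, exists_prop]
    tauto
  have hnull : ∀ k, NullMeasurableSet (collar F γ Z (level k) B) volume := fun k =>
    nullMeasurableSet_collar hγm hZ (hlm k) hB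
  have hνm : ν (collar F γ Z A B) = ∑ k ∈ Finset.range N, ν (collar F γ Z (level k) B) := by
    rw [hcollar]
    refine measure_biUnion_finset₀ ?_ fun k _ =>
      (hnull k).mono_ac (withDensity_absolutelyContinuous _ _)
    intro i hi j hj hij
    refine Disjoint.aedisjoint (Set.disjoint_left.2 fun x hx hx' => ?_)
    exact Set.disjoint_left.1 (hdisj hi hj hij) hx.2.2 hx'.2.2
  have hfin : ∀ k, volume (collar F γ Z (level k) B) ≠ ⊤ := fun k =>
    volume_collar_ne_top hF hγ (R := δ) fun x hx => (hBδ hx).2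
  have hfx : ∀ k, ∀ x ∈ collar F γ Z (level k) B,
      (k - 1) * η ≤ f x ∧ f x ≤ (k + 2) * η := by
    intro k x hx
    have h1 := abs_le.1 (hδ x hx.1 (hBδ hx.2.1).1 (hBδ hx.2.1).2)
    have h2 := hlb k _ hx.2.2
    constructor <;> linarith
  have hup : ∀ k, ν (collar F γ Z (level k) B) ≤
      ENNReal.ofReal ((k + 2) * η) * volume (collar F γ Z (level k) B) := by
    intro k
    rw [hν, withDensity_apply₀ _ (hnull k), ← setLIntegral_const]
    exact setLIntegral_mono measurable_const fun x hx =>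
      ENNReal.ofReal_le_ofReal (hfx k x hx).2
  have hlo : ∀ k : ℕ, ENNReal.ofReal (((k : ℝ) - 1) * η) * volume (collar F γ Z (level k) B) ≤
      ν (collar F γ Z (level k) B) := by
    intro k
    rw [hν, withDensity_apply₀ _ (hnull k), ← setLIntegral_const]
    exact setLIntegral_mono hf.ennreal_ofReal fun x hx =>
      ENNReal.ofReal_le_ofReal (hfx k x hx).1
  have hνfin : ∀ k, ν (collar F γ Z (level k) B) ≠ ⊤ := fun k =>
    ne_top_of_le_ne_top (ENNReal.mul_ne_top ENNReal.ofReal_ne_top (hfin k)) (hup k)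
  have hupr : ∀ k, ν.real (collar F γ Z (level k) B) ≤
      (k + 2) * η * volume.real (collar F γ Z (level k) B) := by
    intro k
    have := ENNReal.toReal_mono (ENNReal.mul_ne_top ENNReal.ofReal_ne_top (hfin k)) (hup k)
    rwa [ENNReal.toReal_mul, ENNReal.toReal_ofReal (by positivity)] at this
  have hlor : ∀ k, (k - 1) * η * volume.real (collar F γ Z (level k) B) ≤
      ν.real (collar F γ Z (level k) B) := by
    intro k
    have := ENNReal.toReal_mono (hνfin k) (hlo k)
    rw [ENNReal.toReal_mul] at this
    refine le_trans ?_ this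
    -- For `k = 0` the factor is negative and `ENNReal.ofReal` truncates it to `0`, which only
    -- strengthens the bound.
    exact mul_le_mul_of_nonneg_right ((le_max_left _ _).trans_eq ENNReal.toReal_ofReal'.symm) measureReal_nonneg
  have hint : ∀ k, IntegrableOn h (level k) S := by
    intro k
    refine Measure.integrableOn_of_bounded (M := (k + 1) * η)
      (ne_top_of_le_ne_top hSA (measure_mono Set.inter_subset_left))
      hhm.aestronglyMeasurable ?_
    refine (ae_restrict_iff' (hlm k)).2 (Eventually.of_forall fun x hx => ?_)
    rw [Real.norm_eq_abs, abs_of_nonneg (hh0 x hx.1)]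
    exact (hlb k x hx).2
  have hJ : ∀ k, k * η * S.real (level k) ≤ ∫ x in level k, h x ∂S ∧
      ∫ x in level k, h x ∂S ≤ (k + 1) * η * S.real (level k) := by
    intro k
    have hlf : S (level k) ≠ ⊤ := ne_top_of_le_ne_top hSA (measure_mono Set.inter_subset_left)
    constructor
    · have := setIntegral_mono_on (f := fun _ => k * η) (integrableOn_const hlf) (hint k) (hlm k)
        fun x hx => (hlb k x hx).1
      rwa [setIntegral_const, smul_eq_mul, mul_comm] at this
    · have := setIntegral_mono_on (g := fun _ => (k + 1) * η) (hint k) (integrableOn_const hlf)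
        (hlm k) fun x hx => (hlb k x hx).2
      rwa [setIntegral_const, smul_eq_mul, mul_comm] at this
  have hintA : ∫ x in A, h x ∂S = ∑ k ∈ Finset.range N, ∫ x in level k, h x ∂S := by
    conv_lhs => rw [hcover]
    exact integral_biUnion_finset _ (fun k _ => hlm k) hdisj fun k _ => hint k
  have hSsum : S.real A = ∑ k ∈ Finset.range N, S.real (level k) := by
    conv_lhs => rw [hcover]
    exact measureReal_biUnion_finset hdisj (fun k _ => hlm k)
      fun k _ => ne_top_of_le_ne_top hSA (measure_mono Set.inter_subset_left)
  have hmr : m.real B = ∑ k ∈ Finset.range N, ν.real (collar F γ Z (level k) B) := by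
    rw [measureReal_def, hmB hB, hνm, ENNReal.toReal_sum fun k _ => hνfin k]
    rfl
  have hterm : ∀ k ∈ Finset.range N,
      |ν.real (collar F γ Z (level k) B) - (∫ x in level k, h x ∂S) * V| ≤
        2 * η * S.real (level k) * V + (k + 2) * η * (ε' * V) := by
    intro k hk
    have h1 := abs_le.1 (hBk k hk hB)
    have h2 := hupr k
    have h3 := hlor k
    obtain ⟨h4, h5⟩ := hJ k
    have h4' := mul_le_mul_of_nonneg_right h4 hV0
    have h5' := mul_le_mul_of_nonneg_right h5 hV0
    set c := volume.real (collar F γ Z (level k) B)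
    set s := S.real (level k)
    have hk0 : (0 : ℝ) ≤ k := Nat.cast_nonneg k
    have hεV : 0 ≤ ε' * V := mul_nonneg hε'0.le hV0
    have h6 : (k + 2) * η * c ≤ (k + 2) * η * (s * V + ε' * V) := by
      gcongr; linarith
    have h7 : (k - 1) * η * (s * V) - (k + 2) * η * (ε' * V) ≤ (k - 1) * η * c := by
      have e : (k - 1) * η * c - ((k - 1) * η * (s * V) - (k + 2) * η * (ε' * V)) =
          (k * (c - s * V + ε' * V) + (ε' * V - (c - s * V)) + ε' * V) * η := by ring
      have : 0 ≤ (k * (c - s * V + ε' * V) + (ε' * V - (c - s * V)) + ε' * V) * η := by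
        refine mul_nonneg (add_nonneg (add_nonneg (mul_nonneg hk0 ?_) ?_) hεV) hη0.le <;> linarith
      linarith
    rw [abs_le]
    constructor <;> nlinarith
  have hfinal : |m.real B - (∫ x in A, h x ∂S) * V| ≤
      2 * η * S.real A * V + W * (ε' * V) := by
    rw [hmr, hintA, Finset.sum_mul, ← Finset.sum_sub_distrib]
    refine (Finset.abs_sum_le_sum_abs _ _).trans ((Finset.sum_le_sum hterm).trans_eq ?_)
    rw [Finset.sum_add_distrib, hSsum, hW, Finset.sum_mul, Finset.mul_sum, Finset.sum_mul]
  refine hfinal.trans ?_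
  have h1 : 2 * η * S.real A ≤ ε / 2 := by
    have h0 : 0 ≤ S.real A := measureReal_nonneg
    rw [hη, mul_div_assoc', div_mul_eq_mul_div, div_le_iff₀ (by positivity)]
    nlinarith
  have h2 : W * ε' ≤ ε / 2 := by
    rw [hε', mul_div_assoc', div_le_iff₀ hW1]
    nlinarith
  calc 2 * η * S.real A * V + W * (ε' * V) = (2 * η * S.real A + W * ε') * V := by ring
    _ ≤ (ε / 2 + ε / 2) * V := by gcongr
    _ = ε * V := by ring

/-- The distribution of the distance to `F` on the collar of width `R` over `A`. -/
noncomputable def collarMeasure {d : ℕ} (F : Set (Euc d)) (γ : Euc d → Euc d)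
    (Z A : Set (Euc d)) (R : ℝ) : Measure ℝ :=
  (volume.restrict (collar F γ Z A (Set.Ioo 0 R))).map fun x => Metric.infDist x F

section

variable {d : ℕ} {F : Set (Euc d)} {γ : Euc d → Euc d} {Z : Set (Euc d)}

theorem collarMeasure_apply (A : Set (Euc d)) (R : ℝ) {B : Set ℝ} (hB : MeasurableSet B) :
    collarMeasure F γ Z A R B = volume (collar F γ Z A (B ∩ Set.Ioo 0 R)) := by
  have hmeas := (Metric.continuous_infDist_pt F).measurable
  rw [collarMeasure, Measure.map_apply hmeas hB, Measure.restrict_apply (hmeas hB)]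
  congr 1
  ext x
  simp only [collar, Set.mem_inter_iff, Set.mem_preimage, Set.mem_ofPred_eq]
  tauto

theorem isFiniteMeasure_collarMeasure (hF : IsCompact F) (hγ : IsNearestPoint F γ)
    (A : Set (Euc d)) (R : ℝ) : IsFiniteMeasure (collarMeasure F γ Z A R) := by
  refine ⟨?_⟩
  rw [collarMeasure_apply A R MeasurableSet.univ]
  exact (volume_collar_ne_top hF hγ (R := R) fun x hx => hx.2.2).lt_top

/-- The cut-off at `R` makes the measure finite and respects Kneser's inequality: since `τ ≥ 1`, `τ
* s < R` with `s > 0` forces `s < R`. -/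
theorem isKneser_collarMeasure (hγ : IsNearestPoint F γ) (hZ : frontier Z = F)
    (A : Set (Euc d)) (R : ℝ) : IsKneser d (collarMeasure F γ Z A R) := by
  constructor
  · rw [collarMeasure_apply A R measurableSet_Iic]
    have : collar F γ Z A (Set.Iic 0 ∩ Set.Ioo 0 R) = ∅ := by
      refine Set.eq_empty_of_forall_notMem fun x hx => ?_
      exact absurd hx.2.1.1 (not_le.2 hx.2.1.2.1)
    rw [this, measure_empty]
  · intro τ hτ B hB
    rw [collarMeasure_apply A R hB, collarMeasure_apply A R (measurable_const_mul _ hB)]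
    refine (hγ.volume_collar_le hZ A (fun x hx => hx.2.1) hτ).trans ?_
    gcongr
    have hτ' : (1 : ℝ) ≤ τ := by exact_mod_cast hτ
    rintro x ⟨hxZ, ⟨hxB, hx0, hxR⟩, hxA⟩
    have h0 : 0 < Metric.infDist x F := by
      simp only at hx0
      by_contra hc
      nlinarith
    refine ⟨hxZ, ⟨hxB, h0, ?_⟩, hxA⟩
    simp only at hxR
    nlinarith

theorem hasCollarDensity_of_tendsto (hF : IsCompact F) (hγ : IsNearestPoint F γ)
    (hZ : frontier Z = F) {S : Measure (Euc d)}
    (H : ∀ A, MeasurableSet A → A ⊆ F → ∀ η > 0, ∀ᶠ r in 𝓝[>] (0 : ℝ),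
      |volume.real (collar F γ Z A (Set.Ioo 0 r)) - S.real A * r| ≤ η * r) :
    HasCollarDensity F γ Z S := by
  intro A hA hAF
  have := isFiniteMeasure_collarMeasure (Z := Z) hF hγ A 1
  have hlim := (isKneser_collarMeasure hγ hZ A 1).limDensity (a := S.real A) measureReal_nonneg
    fun η hη => by
      have h1 : Set.Ioo (0 : ℝ) 1 ∈ 𝓝[>] (0 : ℝ) := Ioo_mem_nhdsGT one_pos
      filter_upwards [H A hA hAF η hη, h1] with r hr hr1
      rw [measureReal_def, collarMeasure_apply A 1 measurableSet_Ioo,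
        Set.inter_eq_left.2 (Set.Ioo_subset_Ioo_right hr1.2.le)]
      exact hr
  intro ε hε
  have h1 : Set.Ioo (0 : ℝ) 1 ∈ 𝓝[>] (0 : ℝ) := Ioo_mem_nhdsGT one_pos
  filter_upwards [hlim ε hε, eventually_smallSets.2 ⟨_, h1, fun t ht => ht⟩] with B hB hB1 hBm
  have := hB hBm
  rwa [measureReal_def, collarMeasure_apply A 1 hBm, Set.inter_eq_left.2 hB1] at this

theorem volume_collar_univ_eq_zero (hF : IsCompact F) (hγ : IsNearestPoint F γ)
    (hZ : frontier Z = F) {N : Set ℝ} (hN : MeasurableSet N) (hN0 : volume N = 0)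
    (hNpos : N ⊆ Set.Ioi 0) : volume (collar F γ Z Set.univ N) = 0 := by
  have hsub : collar F γ Z Set.univ N ⊆
      ⋃ k : ℕ, collar F γ Z Set.univ (N ∩ Set.Ioo 0 (k : ℝ)) := by
    intro x hx
    obtain ⟨k, hk⟩ := exists_nat_gt (Metric.infDist x F)
    exact Set.mem_iUnion.2 ⟨k, hx.1, ⟨hx.2.1, hNpos hx.2.1, hk⟩, trivial⟩
  refine measure_mono_null hsub (measure_iUnion_null fun k => ?_)
  have := isFiniteMeasure_collarMeasure (Z := Z) hF hγ Set.univ k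
  rw [← collarMeasure_apply Set.univ (k : ℝ) hN]
  exact (isKneser_collarMeasure hγ hZ Set.univ k).absolutelyContinuous hN0

end

/-! ### Collars over the inner part of a patch. -/

section

variable {m d : ℕ} {F : Set (Euc d)} {γ : Euc d → Euc d}

/-- First-order condition for the minimum of `‖x - φ w‖²`. It needs `u` interior to `K`, which is
why edges are treated separately. -/
theorem IsNearestPoint.inner_sub_fderiv_eq_zero (hγ : IsNearestPoint F γ) {φ : Euc m → Euc d}
    {K : Set (Euc m)} (hKF : φ '' K ⊆ F) {u : Euc m} (hu : u ∈ interior K)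
    (hφ : DifferentiableAt ℝ φ u) {x : Euc d} (hx : γ x = φ u) (v : Euc m) :
    inner ℝ (x - φ u) (fderiv ℝ φ u v) = 0 := by
  have hmin : IsLocalMin (fun w => ‖x - φ w‖ ^ 2) u := by
    filter_upwards [mem_interior_iff_mem_nhds.1 hu] with w hw
    have := hγ.dist_le x (hKF ⟨w, hw, rfl⟩)
    rw [hx, dist_eq_norm, dist_eq_norm] at this
    gcongr
  have hder := (hφ.hasFDerivAt.const_sub x).norm_sq
  have h0 := hmin.hasFDerivAt_eq_zero hder
  have h1 := congrArg (fun T : Euc m →L[ℝ] ℝ => T v) h0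
  have h2 : inner ℝ (φ u) (fderiv ℝ φ u v) - inner ℝ x (fderiv ℝ φ u v) = 0 := by simpa using h1
  rw [inner_sub_left]
  linarith

/-- A point whose nearest boundary point lies on a patch is reached in normal coordinates. -/
theorem IsNearestPoint.exists_eq_normalMap (hγ : IsNearestPoint F γ) {φ n : Euc m → Euc d}
    {K : Set (Euc m)} (hKF : φ '' K ⊆ F) {u : Euc m} (hu : u ∈ interior K)
    (hφ : DifferentiableAt ℝ φ u) (hn : ‖n u‖ = 1)
    (hspan : ∀ w, (∀ v, inner ℝ w (fderiv ℝ φ u v) = 0) → ∃ c : ℝ, w = c • n u)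
    {x : Euc d} (hx : γ x = φ u) :
    ∃ c : ℝ, x = normalMap φ n (u, c) ∧ |c| = Metric.infDist x F := by
  obtain ⟨c, hc⟩ := hspan _ (hγ.inner_sub_fderiv_eq_zero hKF hu hφ hx)
  refine ⟨c, ?_, ?_⟩
  · simp only [normalMap]; rw [← hc]; abel
  · rw [← (hγ x).2, hx, dist_eq_norm, hc, norm_smul, hn, mul_one, Real.norm_eq_abs]

/-- Near an inner point of a patch, the normal coordinates give the nearest boundary point. -/
theorem exists_reach {φ n : Euc m → Euc d} (hγ : IsNearestPoint F γ) {K : Set (Euc m)}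
    (hK : IsCompact K) (hφ : ContDiff ℝ ∞ φ) (hinj : Set.InjOn φ K) (hKF : φ '' K ⊆ F)
    {C : Set (Euc d)} (hC : IsClosed C) (hFC : F ⊆ φ '' K ∪ C) {u₀ : Euc m}
    (hu₀ : u₀ ∈ interior K) (hu₀C : φ u₀ ∉ C) {U : Set (Euc m)} (hU : IsOpen U) (huU : u₀ ∈ U)
    {r : ℝ} (hr : 0 < r) (hn : ∀ u ∈ U, ‖n u‖ = 1)
    (hspan : ∀ u ∈ U, ∀ w, (∀ v, inner ℝ w (fderiv ℝ φ u v) = 0) → ∃ c : ℝ, w = c • n u)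
    (hcont : ContinuousOn (normalMap φ n) (U ×ˢ Set.Ioo (-r) r))
    (hinjn : Set.InjOn (normalMap φ n) (U ×ˢ Set.Ioo (-r) r)) :
    ∃ (κ ρ : ℝ), 0 < κ ∧ 0 < ρ ∧ ρ ≤ r ∧ Metric.ball u₀ κ ⊆ U ∩ interior K ∧
      ∀ u ∈ Metric.ball u₀ κ, ∀ s ∈ Set.Ioo (-ρ) ρ,
        Metric.infDist (normalMap φ n (u, s)) F = |s| ∧ γ (normalMap φ n (u, s)) = φ u := by
  set U' := U ∩ interior K with hU'
  have hO : IsOpen (φ '' (K \ U') ∪ C)ᶜ :=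
    (((hK.diff (hU.inter isOpen_interior)).image hφ.continuous).isClosed.union hC).isOpen_compl
  have hx₀ : φ u₀ ∈ (φ '' (K \ U') ∪ C)ᶜ := by
    rintro (⟨w, hw, hwe⟩ | h)
    · have := hinj hw.1 (interior_subset hu₀) hwe
      exact hw.2 (this ▸ ⟨huU, hu₀⟩)
    · exact hu₀C h
  obtain ⟨δ, hδ, hball⟩ := Metric.isOpen_iff.1 hO _ hx₀
  have hloc : ∀ y ∈ F, dist y (φ u₀) < δ → ∃ u ∈ U', φ u = y := by
    intro y hy hyd
    have h1 := hball hyd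
    rcases hFC hy with ⟨u, hu, rfl⟩ | hyC
    · by_contra hc
      push Not at hc
      exact h1 (Or.inl ⟨u, ⟨hu, fun h => hc u h rfl⟩, rfl⟩)
    · exact absurd (Or.inr hyC) h1
  have hnh : U' ×ˢ Set.Ioo (-r) r ∈ 𝓝 (u₀, (0 : ℝ)) :=
    prod_mem_nhds ((hU.inter isOpen_interior).mem_nhds ⟨huU, hu₀⟩) (Ioo_mem_nhds (by linarith) hr)
  have hca : ContinuousAt (normalMap φ n) (u₀, 0) :=
    hcont.continuousAt (mem_of_superset hnh (Set.prod_mono Set.inter_subset_left le_rfl))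
  have h0 : normalMap φ n (u₀, 0) = φ u₀ := by simp [normalMap]
  have hpre : normalMap φ n ⁻¹' Metric.ball (φ u₀) (δ / 2) ∈ 𝓝 (u₀, (0 : ℝ)) :=
    hca (by rw [h0]; exact Metric.ball_mem_nhds _ (half_pos hδ))
  obtain ⟨κ, hκ, hκs⟩ := Metric.mem_nhds_iff.1 (inter_mem hnh hpre)
  have hmem : ∀ u ∈ Metric.ball u₀ κ, ∀ s : ℝ, |s| < κ → (u, s) ∈ Metric.ball (u₀, (0 : ℝ)) κ := by
    intro u hu s hs
    rw [Metric.mem_ball, Prod.dist_eq, max_lt_iff]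
    exact ⟨hu, by simpa using hs⟩
  refine ⟨κ, min (min κ (δ / 2)) r, hκ, by positivity, min_le_right _ _, ?_, ?_⟩
  · intro u hu
    exact (hκs (hmem u hu 0 (by simpa using hκ))).1.1
  · intro u hu s hs
    have hs' : |s| < min (min κ (δ / 2)) r := abs_lt.2 hs
    rw [lt_min_iff, lt_min_iff] at hs'
    obtain ⟨⟨hsκ, hsδ⟩, hsr⟩ := hs'
    have h1 := hκs (hmem u hu s hsκ)
    set x := normalMap φ n (u, s) with hx
    have hxd : dist x (φ u₀) < δ / 2 := h1.2
    have huU' : u ∈ U' := h1.1.1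
    have hd1 : dist x (φ u) = |s| := by
      rw [dist_eq_norm, hx]
      simp [normalMap, norm_smul, hn u huU'.1]
    have hd2 := hγ.dist_le x (hKF ⟨u, interior_subset huU'.2, rfl⟩)
    rw [hd1] at hd2
    -- The nearest point of `x` is within `δ` of `φ u₀`, so it lies on this patch and `x` acquires
    -- normal coordinates `(u', c)` with `|c| ≤ |s| < r`. Injectivity of the chart then identifies
    -- them with `(u, s)`.
    obtain ⟨u', hu', hu'e⟩ := hloc (γ x) (hγ x).1 (by
      calc dist (γ x) (φ u₀) ≤ dist (γ x) x + dist x (φ u₀) := dist_triangle _ _ _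
        _ < δ := by rw [dist_comm]; linarith)
    obtain ⟨c, hc, hcd⟩ := hγ.exists_eq_normalMap hKF hu'.2
      (hφ.contDiffAt.differentiableAt (by simp)) (hn u' hu'.1) (hspan u' hu'.1) hu'e.symm
    have hcs : |c| ≤ |s| := by rw [hcd, ← (hγ x).2]; exact hd2
    have heq := hinjn (x₁ := (u', c)) (x₂ := (u, s))
      ⟨hu'.1, abs_lt.1 (hcs.trans_lt hsr)⟩ ⟨huU'.1, abs_lt.1 hsr⟩ (hc ▸ hx)
    rw [Prod.mk.injEq] at heq
    exact ⟨by rw [← hcd, heq.2], by rw [← hu'e, heq.1]⟩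

/-- Near an inner point of a patch, the volume of a collar is comparable, up to a factor
`1 + ε`, with its width times the area of its base. -/
theorem exists_collar_comparison (hd : m + 1 = d) {φ : Euc m → Euc d} (hγ : IsNearestPoint F γ)
    {Z : Set (Euc d)} (hZ : frontier Z = F) {K : Set (Euc m)}
    (hK : IsCompact K) (hφ : ContDiff ℝ ∞ φ) (hinj : Set.InjOn φ K) (hKF : φ '' K ⊆ F)
    {C : Set (Euc d)} (hC : IsClosed C) (hFC : F ⊆ φ '' K ∪ C) {u₀ : Euc m}
    (hu₀ : u₀ ∈ interior K) (himm : Function.Injective (fderiv ℝ φ u₀)) (hu₀C : φ u₀ ∉ C)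
    (hin : φ u₀ ∈ closure (interior Z)) (hout : φ u₀ ∈ closure (interior Zᶜ))
    {ε : ℝ} (hε : 0 < ε) :
    ∃ O : Set (Euc d), IsOpen O ∧ φ u₀ ∈ O ∧ ∃ ρ > 0, ∀ A ⊆ F ∩ O, ∀ r ∈ Set.Ioo 0 ρ,
      volume (collar F γ Z A (Set.Ioo 0 r)) ≤
        ENNReal.ofReal (1 + ε) * (ENNReal.ofReal r * μHE[m] A) ∧
      ENNReal.ofReal r * μHE[m] A ≤
        ENNReal.ofReal (1 + ε) * volume (collar F γ Z A (Set.Ioo 0 r)) := by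
  obtain ⟨n, U, r₁, hr₁, hU, huU, hn, hspan, hcont, hinjn, hnhds, hvol⟩ :=
    exists_normal_chart hd hφ himm hε
  obtain ⟨κ, ρ, hκ, hρ, hρr, hballU, hreach⟩ := exists_reach hγ hK hφ hinj hKF hC hFC hu₀ hu₀C
    hU huU hr₁ hn hspan hcont hinjn
  set V := Metric.ball u₀ κ with hV
  have hFo : frontier Zᶜ = F := by rw [frontier_compl, hZ]
  have hdis : ∀ J ⊆ Set.Ioo (-ρ) ρ, 0 ∉ J → Disjoint (normalMap φ n '' (V ×ˢ J)) F := by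
    intro J hJ hJ0
    refine Set.disjoint_left.2 ?_
    rintro _ ⟨⟨u, s⟩, ⟨hu, hs⟩, rfl⟩ hF
    have h1 := (hreach u hu s (hJ hs)).1
    rw [Metric.infDist_zero_of_mem hF] at h1
    exact hJ0 (abs_eq_zero.1 h1.symm ▸ hs)
  have hJp : Set.Ioo 0 ρ ⊆ Set.Ioo (-ρ) ρ := Set.Ioo_subset_Ioo_left (by linarith)
  have hJm : Set.Ioo (-ρ) 0 ⊆ Set.Ioo (-ρ) ρ := Set.Ioo_subset_Ioo_right hρ.le
  have hJr : Set.Ioo (-ρ) ρ ⊆ Set.Ioo (-r₁) r₁ := Set.Ioo_subset_Ioo (by linarith) hρr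
  have hconn : ∀ J ⊆ Set.Ioo (-ρ) ρ, IsPreconnected J →
      IsPreconnected (normalMap φ n '' (V ×ˢ J)) := by
    intro J hJ hJc
    refine ((convex_ball u₀ κ).isPreconnected.prod hJc).image _ (hcont.mono ?_)
    exact Set.prod_mono (fun u hu => (hballU hu).1) (hJ.trans hJr)
  have hside : ∀ J ⊆ Set.Ioo (-ρ) ρ, 0 ∉ J → IsPreconnected J →
      normalMap φ n '' (V ×ˢ J) ⊆ interior Z ∨ normalMap φ n '' (V ×ˢ J) ⊆ interior Zᶜ := by
    intro J hJ hJ0 hJc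
    by_cases hne : (normalMap φ n '' (V ×ˢ J) ∩ Z).Nonempty
    · exact Or.inl (subset_interior_of_disjoint_frontier (hconn J hJ hJc)
        (hZ ▸ hdis J hJ hJ0) hne)
    · rcases (normalMap φ n '' (V ×ˢ J)).eq_empty_or_nonempty with h0 | ⟨y, hy⟩
      · exact Or.inl (by rw [h0]; exact Set.empty_subset _)
      · refine Or.inr (subset_interior_of_disjoint_frontier (hconn J hJ hJc)
          (hFo ▸ hdis J hJ hJ0) ⟨y, hy, fun h => hne ⟨y, hy, h⟩⟩)
  have hW : normalMap φ n '' (V ×ˢ Set.Ioo (-ρ) ρ) ∈ 𝓝 (φ u₀) :=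
    hnhds _ (prod_mem_nhds (Metric.ball_mem_nhds _ hκ) (Ioo_mem_nhds (by linarith) hρ))
  have hcov : normalMap φ n '' (V ×ˢ Set.Ioo (-ρ) ρ) ⊆
      normalMap φ n '' (V ×ˢ Set.Ioo 0 ρ) ∪ normalMap φ n '' (V ×ˢ Set.Ioo (-ρ) 0) ∪ F := by
    rintro _ ⟨⟨u, s⟩, ⟨hu, hs⟩, rfl⟩
    rcases lt_trichotomy s 0 with h | h | h
    · exact Or.inl (Or.inr ⟨(u, s), ⟨hu, hs.1, h⟩, rfl⟩)
    · refine Or.inr (hKF ⟨u, interior_subset (hballU hu).2, ?_⟩)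
      simp [normalMap, show s = 0 from h]
    · exact Or.inl (Or.inl ⟨(u, s), ⟨hu, h, hs.2⟩, rfl⟩)
  -- The two half-neighbourhoods cannot lie on the same side, because `φ u₀` is adherent to the
  -- interiors of both `Z` and its complement. Which sign of `s` belongs to `Z` depends on the
  -- orientation of `n`, so both mixed cases occur below.
  have hnot : ∀ Y : Set (Euc d), frontier Y = F → φ u₀ ∈ closure (interior Yᶜ) →
      normalMap φ n '' (V ×ˢ Set.Ioo 0 ρ) ⊆ interior Y →
      normalMap φ n '' (V ×ˢ Set.Ioo (-ρ) 0) ⊆ interior Y → False := by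
    intro Y hY hYc h1 h2
    obtain ⟨y, hyW, hyI⟩ := mem_closure_iff_nhds.1 hYc _ hW
    rcases hcov hyW with (h | h) | h
    · exact interior_subset hyI (interior_subset (h1 h))
    · exact interior_subset hyI (interior_subset (h2 h))
    · rw [← hY, ← frontier_compl] at h
      exact h.2 hyI
  -- the open set on which `F` is the image of `V`
  obtain ⟨O, hO, hu₀O, hFO⟩ : ∃ O : Set (Euc d), IsOpen O ∧ φ u₀ ∈ O ∧ F ∩ O ⊆ φ '' V := by
    refine ⟨(φ '' (K \ V) ∪ C)ᶜ, (((hK.diff Metric.isOpen_ball).image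
      hφ.continuous).isClosed.union hC).isOpen_compl, ?_, ?_⟩
    · rintro (⟨w, hw, hwe⟩ | h)
      · exact hw.2 (hinj hw.1 (interior_subset hu₀) hwe ▸ Metric.mem_ball_self hκ)
      · exact hu₀C h
    · rintro y ⟨hyF, hyO⟩
      rcases hFC hyF with ⟨u, hu, rfl⟩ | hyC
      · by_contra hc
        exact hyO (Or.inl ⟨u, ⟨hu, fun h => hc ⟨u, h, rfl⟩⟩, rfl⟩)
      · exact absurd (Or.inr hyC) hyO
  refine ⟨O, hO, hu₀O, ρ, hρ, fun A hA r hr => ?_⟩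
  set A' := V ∩ φ ⁻¹' A with hA'
  have hAA' : A = φ '' A' := by
    ext y
    constructor
    · intro hy
      obtain ⟨u, hu, rfl⟩ := hFO (hA hy)
      exact ⟨u, ⟨hu, hy⟩, rfl⟩
    · rintro ⟨u, hu, rfl⟩; exact hu.2
  have hA'U : A' ⊆ U := fun u hu => (hballU hu.1).1
  have hrep : ∀ x, γ x ∈ A → ∃ u ∈ A', ∃ c : ℝ, x = normalMap φ n (u, c) ∧
      |c| = Metric.infDist x F := by
    intro x hx
    rw [hAA'] at hx
    obtain ⟨u, hu, hux⟩ := hx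
    obtain ⟨c, hc⟩ := hγ.exists_eq_normalMap hKF (hballU hu.1).2
      (hφ.contDiffAt.differentiableAt (by simp)) (hn u (hA'U hu)) (hspan u (hA'U hu)) hux.symm
    exact ⟨u, hu, c, hc⟩
  have hvolJ : ∀ J ⊆ Set.Ioo (-ρ) ρ, volume J = ENNReal.ofReal r →
      collar F γ Z A (Set.Ioo 0 r) = normalMap φ n '' (A' ×ˢ J) →
      volume (collar F γ Z A (Set.Ioo 0 r)) ≤
        ENNReal.ofReal (1 + ε) * (ENNReal.ofReal r * μHE[m] A) ∧
      ENNReal.ofReal r * μHE[m] A ≤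
        ENNReal.ofReal (1 + ε) * volume (collar F γ Z A (Set.Ioo 0 r)) := by
    intro J hJ hJv hJc
    have := hvol A' hA'U J (hJ.trans hJr)
    rwa [hJv, ← hAA', ← hJc] at this
  have hsub : ∀ J ⊆ Set.Ioo (-ρ) ρ, (∀ s ∈ J, |s| ∈ Set.Ioo 0 r) →
      normalMap φ n '' (V ×ˢ J) ⊆ interior Z →
      normalMap φ n '' (A' ×ˢ J) ⊆ collar F γ Z A (Set.Ioo 0 r) := by
    rintro J hJ hJr' hJZ _ ⟨⟨u, s⟩, ⟨hu, hs⟩, rfl⟩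
    have h1 := hreach u hu.1 s (hJ hs)
    refine ⟨interior_subset (hJZ ⟨(u, s), ⟨hu.1, hs⟩, rfl⟩), ?_, ?_⟩
    · rw [h1.1]; exact hJr' s hs
    · rw [h1.2]; exact hu.2
  rcases hside (Set.Ioo 0 ρ) hJp (by simp) isPreconnected_Ioo with hp | hp <;>
    rcases hside (Set.Ioo (-ρ) 0) hJm (by simp) isPreconnected_Ioo with hm | hm
  · exact (hnot Z hZ hout hp hm).elim
  · have hJ : Set.Ioo 0 r ⊆ Set.Ioo (-ρ) ρ := Set.Ioo_subset_Ioo (by linarith) hr.2.le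
    refine hvolJ (Set.Ioo 0 r) hJ (by simp) (Set.Subset.antisymm ?_
      (hsub _ hJ (fun s hs => by rwa [abs_of_pos hs.1]) ?_))
    · rintro x ⟨hxZ, hxr, hxA⟩
      obtain ⟨u, hu, c, rfl, hc⟩ := hrep x hxA
      rw [← hc] at hxr
      have hc0 : 0 < c := by
        by_contra hc0
        have hc1 : c < 0 := lt_of_le_of_ne (not_lt.1 hc0) (abs_pos.1 hxr.1)
        rw [abs_of_neg hc1] at hxr
        exact interior_subset (hm ⟨(u, c), ⟨hu.1, by linarith [hr.2, hxr.2], hc1⟩, rfl⟩) hxZ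
      rw [abs_of_pos hc0] at hxr
      exact ⟨(u, c), ⟨hu, hxr⟩, rfl⟩
    · exact (Set.image_mono (Set.prod_mono le_rfl (Set.Ioo_subset_Ioo_right hr.2.le))).trans hp
  · have hJ : Set.Ioo (-r) 0 ⊆ Set.Ioo (-ρ) ρ := Set.Ioo_subset_Ioo (by linarith [hr.2]) hρ.le
    refine hvolJ (Set.Ioo (-r) 0) hJ (by simp) (Set.Subset.antisymm ?_
      (hsub _ hJ (fun s hs => by
        rw [abs_of_neg hs.2]; exact ⟨by linarith [hs.2], by linarith [hs.1]⟩) ?_))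
    · rintro x ⟨hxZ, hxr, hxA⟩
      obtain ⟨u, hu, c, rfl, hc⟩ := hrep x hxA
      rw [← hc] at hxr
      have hc0 : c < 0 := by
        by_contra hc0
        have hc1 : 0 < c := lt_of_le_of_ne (not_lt.1 hc0) (abs_pos.1 hxr.1).symm
        rw [abs_of_pos hc1] at hxr
        exact interior_subset (hp ⟨(u, c), ⟨hu.1, hc1, by linarith [hr.2, hxr.2]⟩, rfl⟩) hxZ
      rw [abs_of_neg hc0] at hxr
      exact ⟨(u, c), ⟨hu, by linarith [hxr.2], hc0⟩, rfl⟩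
    · exact (Set.image_mono (Set.prod_mono le_rfl (Set.Ioo_subset_Ioo_left (by linarith [hr.2])))).trans hm
  · exact (hnot Zᶜ hFo (by rwa [compl_compl]) hp hm).elim

/-- Near any point of a patch, the volume of a collar is at most a constant multiple of its width
times the area of its base. -/
theorem exists_volume_collar_le_of_mem (hd : m + 1 = d) {φ : Euc m → Euc d}
    (hγ : IsNearestPoint F γ) (Z : Set (Euc d)) {K : Set (Euc m)} (hφ : ContDiff ℝ ∞ φ)
    (hKF : φ '' K ⊆ F) {u₀ : Euc m} (himm : Function.Injective (fderiv ℝ φ u₀)) :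
    ∃ U : Set (Euc m), IsOpen U ∧ u₀ ∈ U ∧ ∃ ρ > 0, ∀ A ⊆ U ∩ interior K, ∀ r ∈ Set.Ioo 0 ρ,
      volume (collar F γ Z (φ '' A) (Set.Ioo 0 r)) ≤
        4 * (ENNReal.ofReal r * μHE[m] (φ '' A)) := by
  -- The constant `4` is the distortion `1 + 1` times the factor `2` from the two-sided interval
  -- `(-r, r)`. Only an inclusion is needed, so `u₀` may lie on the edge.
  obtain ⟨n, U, r₁, hr₁, hU, huU, hn, hspan, -, -, -, hvol⟩ :=
    exists_normal_chart hd hφ himm one_pos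
  refine ⟨U, hU, huU, r₁, hr₁, fun A hA r hr => ?_⟩
  have hJ : Set.Ioo (-r) r ⊆ Set.Ioo (-r₁) r₁ := Set.Ioo_subset_Ioo (by linarith [hr.2]) hr.2.le
  have hsub : collar F γ Z (φ '' A) (Set.Ioo 0 r) ⊆ normalMap φ n '' (A ×ˢ Set.Ioo (-r) r) := by
    rintro x ⟨-, hxr, u, hu, hux⟩
    obtain ⟨c, hc, hcd⟩ := hγ.exists_eq_normalMap hKF (hA hu).2
      (hφ.contDiffAt.differentiableAt (by simp)) (hn u (hA hu).1) (hspan u (hA hu).1) hux.symm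
    refine ⟨(u, c), ⟨hu, abs_lt.1 ?_⟩, hc.symm⟩
    rw [hcd]; exact hxr.2
  refine (measure_mono hsub).trans ((hvol A (fun u hu => (hA hu).1) _ hJ).1.trans_eq ?_)
  have e1 : r - -r = 2 * r := by ring
  have e2 : (1 : ℝ) + 1 = 2 := by norm_num
  rw [Real.volume_Ioo, e1, e2, ENNReal.ofReal_mul zero_le_two, ENNReal.ofReal_ofNat]
  ring

/-- The volume of a collar over the inner part of a patch is at most a constant multiple of its
width times the area of its base. -/
theorem exists_volume_collar_le (hd : m + 1 = d) {φ : Euc m → Euc d}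
    (hγ : IsNearestPoint F γ) (Z : Set (Euc d)) {K : Set (Euc m)} (hK : IsCompact K)
    (hφ : ContDiff ℝ ∞ φ) (hKF : φ '' K ⊆ F)
    (himm : ∀ u ∈ K, Function.Injective (fderiv ℝ φ u)) :
    ∃ C : ℝ≥0, ∃ ρ > 0, ∀ A ⊆ φ '' interior K, ∀ r ∈ Set.Ioo 0 ρ,
      volume (collar F γ Z A (Set.Ioo 0 r)) ≤ C * (ENNReal.ofReal r * μHE[m] A) := by
  have key : ∃ C : ℝ≥0, ∃ ρ > 0, ∀ A ⊆ K ∩ interior K, ∀ r ∈ Set.Ioo 0 ρ,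
      volume (collar F γ Z (φ '' A) (Set.Ioo 0 r)) ≤ C * (ENNReal.ofReal r * μHE[m] (φ '' A)) := by
    -- Compactness is used for all of `K`, edge points included; this keeps the constant uniform as
    -- the base approaches the edge.
    refine hK.induction_on (p := fun s => ∃ C : ℝ≥0, ∃ ρ > 0, ∀ A ⊆ s ∩ interior K,
      ∀ r ∈ Set.Ioo 0 ρ, volume (collar F γ Z (φ '' A) (Set.Ioo 0 r)) ≤
        C * (ENNReal.ofReal r * μHE[m] (φ '' A))) ?_ ?_ ?_ ?_
    · refine ⟨0, 1, one_pos, fun A hA r _ => ?_⟩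
      have : A = ∅ := Set.subset_empty_iff.1 (hA.trans Set.inter_subset_left)
      simp [this, collar]
    · rintro s t hst ⟨C, ρ, hρ, h⟩
      exact ⟨C, ρ, hρ, fun A hA => h A (hA.trans (Set.inter_subset_inter_left _ hst))⟩
    · rintro s t ⟨C, ρ, hρ, h⟩ ⟨C', ρ', hρ', h'⟩
      refine ⟨C + C', min ρ ρ', lt_min hρ hρ', fun A hA r hr => ?_⟩
      have hsub : collar F γ Z (φ '' A) (Set.Ioo 0 r) ⊆
          collar F γ Z (φ '' (A ∩ s)) (Set.Ioo 0 r) ∪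
            collar F γ Z (φ '' (A ∩ t)) (Set.Ioo 0 r) := by
        rintro x ⟨hxZ, hxr, u, hu, hux⟩
        rcases (hA hu).1 with hs | ht
        · exact Or.inl ⟨hxZ, hxr, u, ⟨hu, hs⟩, hux⟩
        · exact Or.inr ⟨hxZ, hxr, u, ⟨hu, ht⟩, hux⟩
      have h1 := h (A ∩ s) (fun u hu => ⟨hu.2, (hA hu.1).2⟩) r ⟨hr.1, hr.2.trans_le (min_le_left _ _)⟩
      have h2 := h' (A ∩ t) (fun u hu => ⟨hu.2, (hA hu.1).2⟩) r
        ⟨hr.1, hr.2.trans_le (min_le_right _ _)⟩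
      calc volume (collar F γ Z (φ '' A) (Set.Ioo 0 r))
          ≤ _ := (measure_mono hsub).trans (measure_union_le _ _)
        _ ≤ C * (ENNReal.ofReal r * μHE[m] (φ '' (A ∩ s))) +
            C' * (ENNReal.ofReal r * μHE[m] (φ '' (A ∩ t))) := add_le_add h1 h2
        _ ≤ C * (ENNReal.ofReal r * μHE[m] (φ '' A)) +
            C' * (ENNReal.ofReal r * μHE[m] (φ '' A)) := by
            gcongr <;> exact Set.inter_subset_left
        _ = _ := by rw [ENNReal.coe_add, add_mul]
    · intro u hu
      obtain ⟨U, hU, huU, ρ, hρ, h⟩ :=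
        exists_volume_collar_le_of_mem hd hγ Z hφ hKF (himm u hu)
      refine ⟨U, mem_nhdsWithin_of_mem_nhds (hU.mem_nhds huU), 4, ρ, hρ, fun A hA r hr => ?_⟩
      simpa using h A hA r hr
  obtain ⟨C, ρ, hρ, h⟩ := key
  refine ⟨C, ρ, hρ, fun A hA r hr => ?_⟩
  have hAe : A = φ '' (interior K ∩ φ ⁻¹' A) := by
    ext y
    constructor
    · intro hy
      obtain ⟨u, hu, rfl⟩ := hA hy
      exact ⟨u, ⟨hu, hy⟩, rfl⟩
    · rintro ⟨u, hu, rfl⟩; exact hu.2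
  have := h (interior K ∩ φ ⁻¹' A) (fun u hu => ⟨interior_subset hu.1, hu.1⟩) r hr
  rwa [← hAe] at this

end

/-! ### Edges: tubes of codimension two and null sets. -/

/-- The tube of radius `r` around a smooth image of a cube of codimension `2` has volume
`O(r ^ 2)`. -/
theorem exists_volume_tube_le {k d : ℕ} (hk : k + 2 = d) {ψ : (Fin k → ℝ) → Euc d}
    (hψ : ContDiff ℝ ∞ ψ) :
    ∃ C : ℝ, 0 ≤ C ∧ ∀ r ∈ Set.Ioc (0 : ℝ) 1,
      volume {x | ∃ q ∈ Set.Icc 0 1, dist x (ψ q) < r} ≤ ENNReal.ofReal (C * r ^ 2) := by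
  obtain ⟨L, hL⟩ := hψ.contDiffOn.exists_lipschitzOnWith (by simp)
    (convex_Icc (0 : Fin k → ℝ) 1) isCompact_Icc
  have hdpos : 0 < d := by omega
  have : Nonempty (Fin d) := ⟨⟨0, hdpos⟩⟩
  set c : ℝ := volume.real (Metric.ball (0 : Euc d) 1) with hc
  have hc0 : 0 ≤ c := measureReal_nonneg
  refine ⟨3 ^ k * (L + 1) ^ d * c, by positivity, fun r hr => ?_⟩
  have hr0 : 0 < r := hr.1
  -- A grid of mesh `1 / N ≤ r` gives `(N + 1) ^ k ≤ (3 / r) ^ k` balls of radius `(L + 1) r`. Their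
  -- total volume is of order `r ^ (d - k) = r ^ 2`.
  set N := ⌈1 / r⌉₊ with hN
  have hNr : 1 / r ≤ N := Nat.le_ceil _
  have hN0 : (0 : ℝ) < N := lt_of_lt_of_le (by positivity) hNr
  have hN1 : 1 / (N : ℝ) ≤ r := by rw [div_le_iff₀ hN0]; rw [div_le_iff₀ hr0] at hNr; linarith
  have hNle : (N : ℝ) + 1 ≤ 3 / r := by
    have h1 : (N : ℝ) < 1 / r + 1 := Nat.ceil_lt_add_one (by positivity)
    have h2 : 1 ≤ 1 / r := by rw [le_div_iff₀ hr0]; linarith [hr.2]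
    have h3 : 3 / r = 3 * (1 / r) := by ring
    linarith
  let q : (Fin k → Fin (N + 1)) → Fin k → ℝ := fun j i => (j i : ℝ) / N
  have hsub : {x | ∃ q ∈ Set.Icc 0 1, dist x (ψ q) < r} ⊆
      ⋃ j : Fin k → Fin (N + 1), Metric.ball (ψ (q j)) ((L + 1) * r) := by
    rintro x ⟨y, hy, hxy⟩
    have hfl : ∀ i, ⌊N * y i⌋₊ < N + 1 := by
      intro i
      rw [Nat.lt_succ_iff]
      refine Nat.floor_le_of_le ?_
      have := hy.2 i
      simp only [Pi.one_apply] at this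
      nlinarith
    let j : Fin k → Fin (N + 1) := fun i => ⟨⌊N * y i⌋₊, hfl i⟩
    have hji : ∀ i, q j i ≤ y i ∧ y i ≤ q j i + 1 / N := by
      intro i
      have hyi : 0 ≤ y i := hy.1 i
      have h1 : ((⌊N * y i⌋₊ : ℕ) : ℝ) ≤ N * y i := Nat.floor_le (by positivity)
      have h2 : N * y i < ⌊N * y i⌋₊ + 1 := Nat.lt_floor_add_one _
      simp only [q, j]
      constructor
      · rw [div_le_iff₀ hN0]; linarith
      · rw [← add_div, le_div_iff₀ hN0]; linarith
    have hqmem : q j ∈ Set.Icc (0 : Fin k → ℝ) 1 := by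
      constructor
      · intro i; simp only [q, Pi.zero_apply]; positivity
      · intro i; exact (hji i).1.trans (hy.2 i)
    have hdist : dist y (q j) ≤ r := by
      refine (dist_pi_le_iff hr0.le).2 fun i => ?_
      rw [Real.dist_eq, abs_le]
      have := hji i
      constructor <;> linarith
    refine Set.mem_iUnion.2 ⟨j, ?_⟩
    rw [Metric.mem_ball]
    have h1 := hL.dist_le_mul y hy _ hqmem
    have h2 : (L : ℝ) * dist y (q j) ≤ L * r := by gcongr
    calc dist x (ψ (q j)) ≤ dist x (ψ y) + dist (ψ y) (ψ (q j)) := dist_triangle _ _ _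
      _ < (L + 1) * r := by linarith
  have hball : ∀ z : Euc d, volume (Metric.ball z ((L + 1) * r)) =
      ENNReal.ofReal (((L + 1) * r) ^ d * c) := by
    intro z
    rw [Measure.addHaar_ball _ _ (by positivity), finrank_euclideanSpace, Fintype.card_fin,
      ENNReal.ofReal_mul (by positivity), hc, ofReal_measureReal measure_ball_lt_top.ne]
  calc volume {x | ∃ q ∈ Set.Icc 0 1, dist x (ψ q) < r}
      ≤ ∑ j : Fin k → Fin (N + 1), volume (Metric.ball (ψ (q j)) ((L + 1) * r)) :=
        (measure_mono hsub).trans (measure_iUnion_fintype_le _ _)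
    _ = ENNReal.ofReal (((N : ℝ) + 1) ^ k * (((L + 1) * r) ^ d * c)) := by
        simp only [hball, Finset.sum_const, Finset.card_univ, Fintype.card_fun, Fintype.card_fin,
          nsmul_eq_mul]
        rw [ENNReal.ofReal_mul (p := ((N : ℝ) + 1) ^ k) (by positivity)]
        congr 1
        rw [← Nat.cast_succ, ← Nat.cast_pow, ENNReal.ofReal_natCast]
    _ ≤ ENNReal.ofReal ((3 / r) ^ k * (((L + 1) * r) ^ d * c)) := by gcongr
    _ = _ := by
        congr 1
        rw [mul_pow, ← hk, div_pow, pow_add r]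
        field_simp

section Piece

variable {d : ℕ}

theorem SmoothPiece.volume_frontier_eq_zero (hd : 1 ≤ d) (p : SmoothPiece d) :
    volume (frontier p.K) = 0 := by
  obtain ⟨n, e, he, hcov⟩ := p.edge
  rcases hd.eq_or_lt with rfl | hd2
  -- For `d = 1` the exponent `d - 2` truncates to `0` and the dimension count below fails, but
  -- frontiers in a one-point space are empty.
  · simp
  · refine measure_mono_null (hcov.trans (Set.iUnion_mono fun k => Set.image_subset_range _ _))
      (measure_iUnion_null fun k => ?_)
    have h1 : dimH (Set.range (e k)) ≤ ((d - 2 : ℕ) : ℝ≥0∞) := by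
      have := ((he k).of_le (by norm_cast)).dimH_range_le (f := e k)
      simpa using this
    have h2 : dimH (Set.range (e k)) < ((d - 1 : ℕ) : ℝ≥0) := by
      refine h1.trans_lt ?_
      norm_cast
      omega
    have h3 : μH[((d - 1 : ℕ) : ℝ)] (Set.range (e k)) = 0 := by
      have := hausdorffMeasure_of_dimH_lt h2
      rwa [NNReal.coe_natCast] at this
    rw [← EuclideanSpace.euclideanHausdorffMeasure_eq_volume,
      Measure.euclideanHausdorffMeasure_def, Measure.smul_apply, h3, smul_zero]

theorem SmoothPiece.exists_area_image_le (p : SmoothPiece d) :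
    ∃ C : ℝ≥0, ∀ s ⊆ p.K, μHE[d - 1] (p.φ '' s) ≤ C * volume s := by
  obtain ⟨C, hC⟩ := (((p.smooth.of_le (by norm_cast)).locallyLipschitz).locallyLipschitzOn
    (s := p.K)).exists_lipschitzOnWith_of_compact p.isCompact_K
  refine ⟨C ^ (d - 1), fun s hs => ?_⟩
  have := euclideanHausdorffMeasure_image_le_of_dist_le (a := p.φ) (b := id) (s := s) (K := C)
    (d - 1) fun x hx y hy => hC.dist_le_mul x (hs hx) y (hs hy)
  rw [Set.image_id, EuclideanSpace.euclideanHausdorffMeasure_eq_volume] at this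
  rwa [ENNReal.coe_pow]

theorem SmoothPiece.area_carrier_ne_top (p : SmoothPiece d) : μHE[d - 1] p.carrier ≠ ⊤ := by
  obtain ⟨C, hC⟩ := p.exists_area_image_le
  exact ne_top_of_le_ne_top (ENNReal.mul_ne_top ENNReal.coe_ne_top
    p.isCompact_K.measure_lt_top.ne) (hC p.K le_rfl)

theorem SmoothPiece.area_edge_eq_zero (hd : 1 ≤ d) (p : SmoothPiece d) :
    μHE[d - 1] (p.φ '' frontier p.K) = 0 := by
  obtain ⟨C, hC⟩ := p.exists_area_image_le
  have := hC _ p.isCompact_K.isClosed.frontier_subset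
  rwa [p.volume_frontier_eq_zero hd, mul_zero, nonpos_iff_eq_zero] at this

/-- Collars over the edge of a piece have volume `O(r ^ 2)`. -/
theorem SmoothPiece.exists_volume_collar_edge_le (hd : 1 ≤ d) (p : SmoothPiece d)
    {F : Set (Euc d)} {γ : Euc d → Euc d} (hγ : IsNearestPoint F γ) (Z : Set (Euc d)) :
    ∃ C : ℝ, 0 ≤ C ∧ ∀ r ∈ Set.Ioc (0 : ℝ) 1,
      volume (collar F γ Z (p.φ '' frontier p.K) (Set.Ioo 0 r)) ≤ ENNReal.ofReal (C * r ^ 2) := by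
  rcases hd.eq_or_lt with rfl | hd2
  · refine ⟨0, le_rfl, fun r _ => ?_⟩
    simp [collar]
  · obtain ⟨n, e, he, hcov⟩ := p.edge
    have hk : (d - 2) + 2 = d := by omega
    choose C hC0 hC using fun k : Fin n => exists_volume_tube_le hk (p.smooth.comp (he k))
    refine ⟨∑ k, C k, Finset.sum_nonneg fun k _ => hC0 k, fun r hr => ?_⟩
    have hsub : collar F γ Z (p.φ '' frontier p.K) (Set.Ioo 0 r) ⊆
        ⋃ k, {x | ∃ q ∈ Set.Icc 0 1, dist x ((p.φ ∘ e k) q) < r} := by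
      rintro x ⟨-, hxr, u, hu, hux⟩
      obtain ⟨k, q, hq, hqu⟩ := Set.mem_iUnion.1 (hcov hu)
      refine Set.mem_iUnion.2 ⟨k, q, hq, ?_⟩
      rw [Function.comp_apply, hqu, hux, (hγ x).2]
      exact hxr.2
    calc _ ≤ _ := (measure_mono hsub).trans (measure_iUnion_fintype_le _ _)
      _ ≤ ∑ k, ENNReal.ofReal (C k * r ^ 2) := Finset.sum_le_sum fun k _ => hC k r hr
      _ = _ := by
        rw [Finset.sum_mul, ENNReal.ofReal_sum_of_nonneg]
        exact fun k _ => mul_nonneg (hC0 k) (sq_nonneg r)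

end Piece

/-! ### Asymptotic volume of thin collars over arbitrary Borel bases. -/

section Limit

variable {d : ℕ} {F : Set (Euc d)} {γ : Euc d → Euc d} {Z : Set (Euc d)}

theorem volume_collar_union (hF : IsCompact F) (hγ : IsNearestPoint F γ) (hZ : MeasurableSet Z)
    {A₁ A₂ : Set (Euc d)} (hA₂ : MeasurableSet A₂) (hdisj : Disjoint A₁ A₂) {B : Set ℝ}
    (hB : MeasurableSet B) :
    volume (collar F γ Z (A₁ ∪ A₂) B) =
      volume (collar F γ Z A₁ B) + volume (collar F γ Z A₂ B) := by
  rw [← measure_union₀ (nullMeasurableSet_collar (hγ.aemeasurable hF) hZ hA₂ hB)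
    (Disjoint.aedisjoint (Set.disjoint_left.2 fun x hx hx' =>
      Set.disjoint_left.1 hdisj hx.2.2 hx'.2.2))]
  congr 1
  ext x
  simp only [collar, Set.mem_union, Set.mem_ofPred_eq]
  tauto

/-- On a compact set, local comparison of collar volumes with areas is uniform. -/
theorem exists_uniform_collar_comparison (hF : IsCompact F) (hγ : IsNearestPoint F γ)
    (hZ : MeasurableSet Z) {S : Measure (Euc d)} {c : ℝ≥0∞} {Q : Set (Euc d)} (hQ : IsCompact Q)
    (hloc : ∀ x ∈ Q, ∃ O : Set (Euc d), IsOpen O ∧ x ∈ O ∧ ∃ ρ > 0, ∀ A ⊆ F ∩ O,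
      ∀ r ∈ Set.Ioo 0 ρ,
      volume (collar F γ Z A (Set.Ioo 0 r)) ≤ c * (ENNReal.ofReal r * S A) ∧
      ENNReal.ofReal r * S A ≤ c * volume (collar F γ Z A (Set.Ioo 0 r))) :
    ∃ ρ > 0, ∀ A ⊆ F ∩ Q, MeasurableSet A → ∀ r ∈ Set.Ioo 0 ρ,
      volume (collar F γ Z A (Set.Ioo 0 r)) ≤ c * (ENNReal.ofReal r * S A) ∧
      ENNReal.ofReal r * S A ≤ c * volume (collar F γ Z A (Set.Ioo 0 r)) := by
  have key : ∃ O : Set (Euc d), IsOpen O ∧ Q ⊆ O ∧ ∃ ρ > 0, ∀ A ⊆ F ∩ O, MeasurableSet A →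
      ∀ r ∈ Set.Ioo 0 ρ,
      volume (collar F γ Z A (Set.Ioo 0 r)) ≤ c * (ENNReal.ofReal r * S A) ∧
      ENNReal.ofReal r * S A ≤ c * volume (collar F γ Z A (Set.Ioo 0 r)) := by
    refine hQ.induction_on (p := fun s => ∃ O : Set (Euc d), IsOpen O ∧ s ⊆ O ∧ ∃ ρ > 0,
      ∀ A ⊆ F ∩ O, MeasurableSet A → ∀ r ∈ Set.Ioo 0 ρ,
      volume (collar F γ Z A (Set.Ioo 0 r)) ≤ c * (ENNReal.ofReal r * S A) ∧
      ENNReal.ofReal r * S A ≤ c * volume (collar F γ Z A (Set.Ioo 0 r))) ?_ ?_ ?_ ?_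
    · refine ⟨∅, isOpen_empty, le_rfl, 1, one_pos, fun A hA _ r _ => ?_⟩
      have : A = ∅ := Set.subset_empty_iff.1 (hA.trans Set.inter_subset_right)
      simp [this, collar]
    · rintro s t hst ⟨O, hO, htO, h⟩
      exact ⟨O, hO, hst.trans htO, h⟩
    · rintro s t ⟨O, hO, hsO, ρ, hρ, h⟩ ⟨O', hO', htO', ρ', hρ', h'⟩
      refine ⟨O ∪ O', hO.union hO', Set.union_subset_union hsO htO', min ρ ρ', lt_min hρ hρ',
        fun A hA hAm r hr => ?_⟩
      have h1 := h (A ∩ O) (fun x hx => ⟨(hA hx.1).1, hx.2⟩) (hAm.inter hO.measurableSet) r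
        ⟨hr.1, hr.2.trans_le (min_le_left _ _)⟩
      have h2 := h' (A \ O) (fun x hx => ⟨(hA hx.1).1, (hA hx.1).2.resolve_left hx.2⟩)
        (hAm.diff hO.measurableSet) r ⟨hr.1, hr.2.trans_le (min_le_right _ _)⟩
      have e1 := volume_collar_union hF hγ hZ (A₁ := A ∩ O) (hAm.diff hO.measurableSet)
        Set.disjoint_sdiff_inter.symm (measurableSet_Ioo (a := (0 : ℝ)) (b := r))
      have e2 := measure_inter_add_sdiff (μ := S) A hO.measurableSet
      rw [Set.inter_union_sdiff] at e1
      rw [e1, ← e2, mul_add, mul_add, mul_add]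
      exact ⟨add_le_add h1.1 h2.1, add_le_add h1.2 h2.2⟩
    · intro x hx
      obtain ⟨O, hO, hxO, ρ, hρ, h⟩ := hloc x hx
      exact ⟨O, mem_nhdsWithin_of_mem_nhds (hO.mem_nhds hxO), O, hO, le_rfl, ρ, hρ,
        fun A hA _ => h A hA⟩
  obtain ⟨O, -, hQO, ρ, hρ, h⟩ := key
  exact ⟨ρ, hρ, fun A hA => h A (hA.trans (Set.inter_subset_inter_right _ hQO))⟩

/-- The volume of the collar of width `r` over `A` is asymptotic to `S(A) r`. -/
def CollarLimit (F : Set (Euc d)) (γ : Euc d → Euc d) (Z : Set (Euc d)) (S : Measure (Euc d))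
    (A : Set (Euc d)) : Prop :=
  ∀ η > 0, ∀ᶠ r in 𝓝[>] (0 : ℝ),
    |volume.real (collar F γ Z A (Set.Ioo 0 r)) - S.real A * r| ≤ η * r

theorem CollarLimit.union (hF : IsCompact F) (hγ : IsNearestPoint F γ) (hZ : MeasurableSet Z)
    {S : Measure (Euc d)} {A₁ A₂ : Set (Euc d)} (hA₂ : MeasurableSet A₂) (hdisj : Disjoint A₁ A₂)
    (hS₁ : S A₁ ≠ ⊤) (hS₂ : S A₂ ≠ ⊤)
    (h₁ : CollarLimit F γ Z S A₁) (h₂ : CollarLimit F γ Z S A₂) :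
    CollarLimit F γ Z S (A₁ ∪ A₂) := by
  intro η hη
  filter_upwards [h₁ (η / 2) (half_pos hη), h₂ (η / 2) (half_pos hη)] with r h1 h2
  have hfin : ∀ A, volume (collar F γ Z A (Set.Ioo 0 r)) ≠ ⊤ := fun A =>
    volume_collar_ne_top hF hγ (R := r) fun x hx => hx.2
  have e1 : volume.real (collar F γ Z (A₁ ∪ A₂) (Set.Ioo 0 r)) =
      volume.real (collar F γ Z A₁ (Set.Ioo 0 r)) +
        volume.real (collar F γ Z A₂ (Set.Ioo 0 r)) := by
    rw [measureReal_def, volume_collar_union hF hγ hZ hA₂ hdisj measurableSet_Ioo,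
      ENNReal.toReal_add (hfin _) (hfin _)]
    rfl
  rw [e1, measureReal_union hdisj hA₂ hS₁ hS₂]
  rw [abs_le] at h1 h2 ⊢
  constructor <;> linarith

theorem collarLimit_of_volume_le_sq {S : Measure (Euc d)} {A : Set (Euc d)} (hSA : S A = 0)
    {C : ℝ} (hC : 0 ≤ C) (h : ∀ r ∈ Set.Ioc (0 : ℝ) 1,
      volume (collar F γ Z A (Set.Ioo 0 r)) ≤ ENNReal.ofReal (C * r ^ 2)) :
    CollarLimit F γ Z S A := by
  intro η hη
  have h1 : Set.Ioo (0 : ℝ) (min 1 (η / (C + 1))) ∈ 𝓝[>] (0 : ℝ) :=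
    Ioo_mem_nhdsGT (by positivity)
  filter_upwards [h1] with r hr
  have hr1 := lt_min_iff.1 hr.2
  have h2 := h r ⟨hr.1, hr1.1.le⟩
  have h3 := ENNReal.toReal_mono ENNReal.ofReal_ne_top h2
  rw [ENNReal.toReal_ofReal (by positivity)] at h3
  have h4 : r * (C + 1) < η := (lt_div_iff₀ (by positivity)).1 hr1.2
  rw [measureReal_def S, hSA, ENNReal.toReal_zero, zero_mul, sub_zero,
    abs_of_nonneg measureReal_nonneg]
  refine h3.trans ?_
  nlinarith [hr.1, mul_pos hr.1 hr.1]

/-- Local comparison of collar volumes with areas, together with a crude global bound, determines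
the limit. -/
theorem collarLimit_of_comparison (hF : IsCompact F) (hγ : IsNearestPoint F γ)
    (hZ : MeasurableSet Z) {S : Measure (Euc d)} {A : Set (Euc d)} (hA : MeasurableSet A)
    (hAF : A ⊆ F) (hS : S F ≠ ⊤)
    (hloc : ∀ ε > 0, ∀ x ∈ A, ∃ O : Set (Euc d), IsOpen O ∧ x ∈ O ∧ ∃ ρ > 0, ∀ A ⊆ F ∩ O,
      ∀ r ∈ Set.Ioo 0 ρ,
      volume (collar F γ Z A (Set.Ioo 0 r)) ≤ ENNReal.ofReal (1 + ε) * (ENNReal.ofReal r * S A) ∧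
      ENNReal.ofReal r * S A ≤ ENNReal.ofReal (1 + ε) * volume (collar F γ Z A (Set.Ioo 0 r)))
    {C : ℝ≥0} {ρ' : ℝ} (hρ' : 0 < ρ') (hbound : ∀ A' ⊆ A, ∀ r ∈ Set.Ioo 0 ρ',
      volume (collar F γ Z A' (Set.Ioo 0 r)) ≤ C * (ENNReal.ofReal r * S A')) :
    CollarLimit F γ Z S A := by
  intro η hη
  have hSA : S A ≠ ⊤ := ne_top_of_le_ne_top hS (measure_mono hAF)
  set a := S.real A with ha
  have ha0 : 0 ≤ a := measureReal_nonneg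
  set ε : ℝ := min 1 (η / (4 * (a + 1))) with hε
  have hε0 : 0 < ε := by positivity
  have hε1 : ε ≤ 1 := min_le_left _ _
  have hεa : 2 * ε * a ≤ η / 2 := by
    have h1 : ε ≤ η / (4 * (a + 1)) := min_le_right _ _
    rw [le_div_iff₀ (by positivity)] at h1
    nlinarith
  set η' : ℝ := η / (2 * (C + 1)) with hη'
  have hη'0 : 0 < η' := by positivity
  have hfinS : IsFiniteMeasure (S.restrict F) :=
    ⟨by rw [Measure.restrict_apply_univ]; exact hS.lt_top⟩
  -- On the compact set `Q` the comparison is uniform. The rest of `A` has area below `η'`, so the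
  -- crude bound makes its collar at most `C η' r`.
  obtain ⟨Q, hQA, hQ, hQS⟩ := hA.exists_isCompact_sdiff_lt (μ := S.restrict F)
    (measure_ne_top _ _) (ε := ENNReal.ofReal η') (by simpa using hη'0)
  have hAQ : MeasurableSet (A \ Q) := hA.diff hQ.measurableSet
  rw [Measure.restrict_apply hAQ,
    Set.inter_eq_left.2 (Set.sdiff_subset.trans hAF)] at hQS
  obtain ⟨ρ, hρ, hcomp⟩ := exists_uniform_collar_comparison hF hγ hZ (S := S) hQ
    fun x hx => hloc ε hε0 x (hQA hx)
  have h1 : Set.Ioo (0 : ℝ) (min ρ ρ') ∈ 𝓝[>] (0 : ℝ) := Ioo_mem_nhdsGT (lt_min hρ hρ')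
  filter_upwards [h1] with r hr
  have hr0 : 0 < r := hr.1
  have hr1 := lt_min_iff.1 hr.2
  obtain ⟨h2, h3⟩ := hcomp Q (fun x hx => ⟨hAF (hQA hx), hx⟩) hQ.measurableSet r ⟨hr0, hr1.1⟩
  have h4 := hbound (A \ Q) Set.sdiff_subset r ⟨hr0, hr1.2⟩
  have hfin : ∀ A, volume (collar F γ Z A (Set.Ioo 0 r)) ≠ ⊤ := fun A =>
    volume_collar_ne_top hF hγ (R := r) fun x hx => hx.2
  have hSQ : S Q ≠ ⊤ := ne_top_of_le_ne_top hSA (measure_mono hQA)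
  have hSAQ : S (A \ Q) ≠ ⊤ := ne_top_of_le_ne_top hSA (measure_mono Set.sdiff_subset)
  have e1 : volume.real (collar F γ Z A (Set.Ioo 0 r)) =
      volume.real (collar F γ Z Q (Set.Ioo 0 r)) +
        volume.real (collar F γ Z (A \ Q) (Set.Ioo 0 r)) := by
    have := volume_collar_union hF hγ hZ (A₁ := Q) hAQ Set.disjoint_sdiff_right
      (measurableSet_Ioo (a := (0 : ℝ)) (b := r))
    rw [Set.union_sdiff_cancel hQA] at this
    rw [measureReal_def, this, ENNReal.toReal_add (hfin _) (hfin _)]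
    rfl
  have e2 : a = S.real Q + S.real (A \ Q) := by
    rw [ha, ← measureReal_union Set.disjoint_sdiff_right hAQ hSQ hSAQ, Set.union_sdiff_cancel hQA]
  have h2r := ENNReal.toReal_mono (by finiteness) h2
  have h3r := ENNReal.toReal_mono (ENNReal.mul_ne_top ENNReal.ofReal_ne_top (hfin _)) h3
  have h4r := ENNReal.toReal_mono (by finiteness) h4
  have h5r := ENNReal.toReal_mono ENNReal.ofReal_ne_top hQS.le
  simp only [ENNReal.toReal_mul, ENNReal.toReal_ofReal hr0.le, ENNReal.coe_toReal,
    ENNReal.toReal_ofReal hη'0.le, ENNReal.toReal_ofReal (by linarith : 0 ≤ 1 + ε),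
    ← measureReal_def] at h2r h3r h4r h5r
  rw [e1]
  set v := volume.real (collar F γ Z Q (Set.Ioo 0 r))
  set w := volume.real (collar F γ Z (A \ Q) (Set.Ioo 0 r))
  set s := S.real Q
  set σ := S.real (A \ Q)
  have hs0 : 0 ≤ s := measureReal_nonneg
  have hσ0 : 0 ≤ σ := measureReal_nonneg
  have hv0 : 0 ≤ v := measureReal_nonneg
  have hw0 : 0 ≤ w := measureReal_nonneg
  have hsa : s ≤ a := by linarith
  have hrs : 0 ≤ r * s := by positivity
  have h6 : v - s * r ≤ 2 * ε * a * r := by nlinarith [mul_nonneg hε0.le hrs, mul_le_mul_of_nonneg_left hsa (mul_pos hε0 hr0).le]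
  have h7 : s * r - v ≤ 2 * ε * a * r := by
    have h8 : s * r - v ≤ ε * v := by linarith
    have h9 : ε * v ≤ ε * ((1 + ε) * (r * s)) := by gcongr
    have h10 : ε * ((1 + ε) * (r * s)) ≤ ε * (2 * (r * a)) := by gcongr; linarith
    linarith
  have h11 : (C + 1) * η' = η / 2 := by rw [hη']; field_simp
  have h12 : w ≤ C * (r * η') := h4r.trans (by gcongr)
  have h13 : σ * r ≤ η' * r := by gcongr
  have h14 : C * (r * η') + η' * r = η / 2 * r := by rw [← h11]; ring
  have h15 : 2 * ε * a * r ≤ η / 2 * r := by gcongr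
  have hσr : 0 ≤ σ * r := by positivity
  rw [e2, abs_le]
  constructor <;> nlinarith

end Limit

section

variable {d n : ℕ} {F : Set (Euc d)} {γ : Euc d → Euc d} {Z : Set (Euc d)}

theorem SmoothPiece.isCompact_carrier (p : SmoothPiece d) : IsCompact p.carrier :=
  p.isCompact_K.image p.smooth.continuous

theorem SmoothPiece.inner_subset_carrier (p : SmoothPiece d) : p.inner ⊆ p.carrier :=
  Set.image_mono interior_subset

theorem SmoothPiece.measurableSet_inner (p : SmoothPiece d) : MeasurableSet p.inner :=
  isOpen_interior.measurableSet.image_of_continuousOn_injOn p.smooth.continuous.continuousOn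
    (p.injOn.mono interior_subset)

theorem SmoothPiece.carrier_subset (p : SmoothPiece d) :
    p.carrier ⊆ p.inner ∪ p.φ '' frontier p.K := by
  rintro _ ⟨u, hu, rfl⟩
  by_cases hi : u ∈ interior p.K
  · exact Or.inl ⟨u, hi, rfl⟩
  · exact Or.inr ⟨u, ⟨subset_closure hu, hi⟩, rfl⟩

/-- The union of the other carriers is the closed set to be avoided; inner points of the `i`-th
piece stay off it because pieces meet only along edges. -/
theorem collarLimit_inner (hd : 1 ≤ d) (hF : IsCompact F) (hγ : IsNearestPoint F γ)
    (hZ : frontier Z = F) (hZm : MeasurableSet Z) (hin : F ⊆ closure (interior Z))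
    (hout : F ⊆ closure (interior Zᶜ)) (p : Fin n → SmoothPiece d)
    (hp : F = ⋃ i, (p i).carrier) (hdisj : ∀ i j, i ≠ j → Disjoint (p i).inner (p j).carrier)
    (hS : μHE[d - 1] F ≠ ⊤) {A : Set (Euc d)} (hA : MeasurableSet A) (i : Fin n) :
    CollarLimit F γ Z μHE[d - 1] (A ∩ (p i).inner) := by
  have hd' : d - 1 + 1 = d := Nat.sub_add_cancel hd
  have hKF : (p i).φ '' (p i).K ⊆ F := hp ▸ Set.subset_iUnion (fun i => (p i).carrier) i
  obtain ⟨C, ρ, hρ, hC⟩ := exists_volume_collar_le hd' hγ Z (p i).isCompact_K (p i).smooth hKF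
    (p i).immersion
  refine collarLimit_of_comparison hF hγ hZm (hA.inter (p i).measurableSet_inner)
    (Set.inter_subset_right.trans ((p i).inner_subset_carrier.trans hKF)) hS ?_ hρ
    (fun A' hA' => hC A' (hA'.trans Set.inter_subset_right))
  rintro ε hε _ ⟨-, u, hu, rfl⟩
  have hclosed : IsClosed (⋃ j ∈ {j | j ≠ i}, (p j).carrier) :=
    (Set.toFinite _).isClosed_biUnion fun j _ => (p j).isCompact_carrier.isClosed
  have hmem : (p i).φ u ∈ F := hKF ⟨u, interior_subset hu, rfl⟩
  refine exists_collar_comparison hd' hγ hZ (p i).isCompact_K (p i).smooth (p i).injOn hKF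
    hclosed ?_ hu ((p i).immersion u (interior_subset hu)) ?_ (hin hmem) (hout hmem) hε
  · intro x hx
    rw [hp] at hx
    obtain ⟨j, hj⟩ := Set.mem_iUnion.1 hx
    by_cases hji : j = i
    · subst hji; exact Or.inl hj
    · exact Or.inr (Set.mem_biUnion (show j ∈ {j | j ≠ i} from hji) hj)
  · intro h
    obtain ⟨j, hj, hjx⟩ := Set.mem_iUnion₂.1 h
    exact Set.disjoint_left.1 (hdisj i j (Ne.symm hj)) ⟨u, hu, rfl⟩ hjx

theorem area_ne_top (p : Fin n → SmoothPiece d) (hp : F = ⋃ i, (p i).carrier) :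
    μHE[d - 1] F ≠ ⊤ := by
  rw [hp]
  exact ne_top_of_le_ne_top (ENNReal.sum_ne_top.2 fun i _ => (p i).area_carrier_ne_top)
    (measure_iUnion_fintype_le _ _)

/-- One-sided collars of a piecewise smooth hypersurface have density its surface area. -/
theorem hasCollarDensity_of_smoothPieces (hd : 1 ≤ d) (hF : IsCompact F)
    (hγ : IsNearestPoint F γ) (hZ : frontier Z = F) (hZm : MeasurableSet Z)
    (hin : F ⊆ closure (interior Z)) (hout : F ⊆ closure (interior Zᶜ)) (p : Fin n → SmoothPiece d)
    (hp : F = ⋃ i, (p i).carrier) (hdisj : ∀ i j, i ≠ j → Disjoint (p i).inner (p j).carrier) :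
    HasCollarDensity F γ Z μHE[d - 1] := by
  have hS := area_ne_top p hp
  refine hasCollarDensity_of_tendsto hF hγ hZ fun A hA hAF => ?_
  -- `F` is the disjoint union of the edges `E` and the finitely many inner parts. `E` has area `0`
  -- and its collars are `O(r ^ 2)`, so the limits add up.
  set E : Set (Euc d) := ⋃ i, (p i).φ '' frontier (p i).K with hE
  have hSfin : ∀ A' ⊆ A, μHE[d - 1] A' ≠ ⊤ := fun A' hA' =>
    ne_top_of_le_ne_top hS (measure_mono (hA'.trans hAF))
  have hEi : ∀ i, Disjoint E (p i).inner := by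
    refine fun i => Set.disjoint_left.2 fun x hxE hxi => ?_
    obtain ⟨j, w, hw, rfl⟩ := Set.mem_iUnion.1 hxE
    have hwK : w ∈ (p j).K := (p j).isCompact_K.isClosed.frontier_subset hw
    by_cases hij : i = j
    · subst hij
      obtain ⟨u, hu, hue⟩ := hxi
      have := (p i).injOn (interior_subset hu) hwK hue
      exact hw.2 (this ▸ hu)
    · exact Set.disjoint_left.1 (hdisj i j hij) hxi ⟨w, hwK, rfl⟩
  have hedge : CollarLimit F γ Z μHE[d - 1] (A ∩ E) := by
    choose C hC0 hC using fun i => (p i).exists_volume_collar_edge_le hd hγ Z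
    have hE0 : μHE[d - 1] (A ∩ E) = 0 := measure_mono_null Set.inter_subset_right
      (measure_iUnion_null fun i => (p i).area_edge_eq_zero hd)
    refine collarLimit_of_volume_le_sq hE0 (C := ∑ i, C i)
      (Finset.sum_nonneg fun i _ => hC0 i) fun r hr => ?_
    have hsub : collar F γ Z (A ∩ E) (Set.Ioo 0 r) ⊆
        ⋃ i, collar F γ Z ((p i).φ '' frontier (p i).K) (Set.Ioo 0 r) := by
      rintro x ⟨hxZ, hxr, -, hxE⟩
      obtain ⟨i, hi⟩ := Set.mem_iUnion.1 hxE
      exact Set.mem_iUnion.2 ⟨i, hxZ, hxr, hi⟩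
    calc _ ≤ _ := (measure_mono hsub).trans (measure_iUnion_fintype_le _ _)
      _ ≤ ∑ i, ENNReal.ofReal (C i * r ^ 2) := Finset.sum_le_sum fun i _ => hC i r hr
      _ = _ := by
        rw [Finset.sum_mul, ENNReal.ofReal_sum_of_nonneg]
        exact fun i _ => mul_nonneg (hC0 i) (sq_nonneg r)
  have hunion : ∀ s : Finset (Fin n),
      CollarLimit F γ Z μHE[d - 1] ((A ∩ E) ∪ ⋃ i ∈ s, A ∩ (p i).inner) := by
    intro s
    induction s using Finset.induction_on with
    | empty => simpa using hedge
    | insert i s hi ih =>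
      have hrw : (A ∩ E) ∪ ⋃ j ∈ insert i s, A ∩ (p j).inner =
          ((A ∩ E) ∪ ⋃ j ∈ s, A ∩ (p j).inner) ∪ (A ∩ (p i).inner) := by
        rw [Finset.set_biUnion_insert, Set.union_comm (A ∩ (p i).inner), Set.union_assoc]
      rw [hrw]
      refine CollarLimit.union hF hγ hZm (hA.inter (p i).measurableSet_inner) ?_
        (hSfin _ ?_) (hSfin _ Set.inter_subset_left) ih
        (collarLimit_inner hd hF hγ hZ hZm hin hout p hp hdisj hS hA i)
      · rw [Set.disjoint_union_left, Set.disjoint_iUnion₂_left]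
        refine ⟨((hEi i).mono Set.inter_subset_right Set.inter_subset_right), fun j hj => ?_⟩
        have hji : j ≠ i := fun h => hi (h ▸ hj)
        exact (hdisj j i hji).mono Set.inter_subset_right
          (Set.inter_subset_right.trans (p i).inner_subset_carrier)
      · exact Set.union_subset Set.inter_subset_left
          (Set.iUnion₂_subset fun j _ => Set.inter_subset_left)
  have hAe : A = (A ∩ E) ∪ ⋃ i ∈ (Finset.univ : Finset (Fin n)), A ∩ (p i).inner := by
    refine Set.Subset.antisymm (fun x hx => ?_) (Set.union_subset Set.inter_subset_left
      (Set.iUnion₂_subset fun j _ => Set.inter_subset_left))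
    have hxF := hAF hx
    rw [hp] at hxF
    obtain ⟨i, hi⟩ := Set.mem_iUnion.1 hxF
    rcases (p i).carrier_subset hi with h | h
    · exact Or.inr (Set.mem_biUnion (Finset.mem_coe.2 (Finset.mem_univ i)) ⟨hx, h⟩)
    · exact Or.inl ⟨hx, Set.mem_iUnion.2 ⟨i, h⟩⟩
  have := hunion Finset.univ
  rw [← hAe] at this
  exact this

end

/-! ### Boundary values: continuity and uniform approach. -/

section BoundaryLimits

variable {d : ℕ} {F Z : Set (Euc d)} {f h : Euc d → ℝ}

/-- For `y ∈ F` near `x`, the value `h y` is a limit of values of `f` at points near `x`. For `y ≠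
x` these can be kept away from `x` itself, where `f` is unconstrained. -/
theorem continuousOn_of_tendsto (hne : ∀ x ∈ F, (𝓝[Z \ {x}] x).NeBot)
    (hlim : ∀ x ∈ F, Tendsto f (𝓝[Z \ {x}] x) (𝓝 (h x))) : ContinuousOn h F := by
  intro x hx
  rw [ContinuousWithinAt, Metric.tendsto_nhds]
  intro ε hε
  have h1 := (Metric.tendsto_nhds.1 (hlim x hx)) (ε / 2) (half_pos hε)
  obtain ⟨r, hr, hball⟩ := Metric.mem_nhdsWithin_iff.1 h1
  filter_upwards [self_mem_nhdsWithin, mem_nhdsWithin_of_mem_nhds (Metric.ball_mem_nhds x hr)]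
    with y hyF hyr
  by_cases hyx : y = x
  · rw [hyx, dist_self]; exact hε
  have := hne y hyF
  have h2 : ∀ᶠ z in 𝓝[Z \ {y}] y, dist (f z) (h x) ≤ ε / 2 := by
    have ho : Metric.ball x r ∩ {x}ᶜ ∈ 𝓝 y :=
      (Metric.isOpen_ball.inter isOpen_compl_singleton).mem_nhds ⟨hyr, hyx⟩
    filter_upwards [self_mem_nhdsWithin, mem_nhdsWithin_of_mem_nhds ho] with z hz hz'
    exact (show dist (f z) (h x) < ε / 2 from hball ⟨hz'.1, hz.1, hz'.2⟩).le
  exact (le_of_tendsto ((hlim y hyF).dist tendsto_const_nhds) h2).trans_lt (half_lt_self hε)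

/-- Cover `F` by balls on which both `f` (off the centre) and `h` are close to the central value. A
Lebesgue number `δ` of this cover puts `x` and `γ x` in a common ball whenever `dist(x, F) < δ`. -/
theorem exists_forall_abs_sub_le (hF : IsCompact F) {γ : Euc d → Euc d} (hγ : IsNearestPoint F γ)
    (hh : ContinuousOn h F) (hlim : ∀ x ∈ F, Tendsto f (𝓝[Z \ {x}] x) (𝓝 (h x)))
    {η : ℝ} (hη : 0 < η) :
    ∃ δ > 0, ∀ x ∈ Z, 0 < Metric.infDist x F → Metric.infDist x F < δ →
      |f x - h (γ x)| ≤ η := by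
  have hr : ∀ x : F, ∃ r > 0, (∀ z ∈ Z, z ≠ x → dist z x < r → |f z - h x| < η / 2) ∧
      ∀ y ∈ F, dist y x < r → |h y - h x| < η / 2 := by
    rintro ⟨x, hx⟩
    obtain ⟨r, hr, h1⟩ := Metric.mem_nhdsWithin_iff.1
      ((Metric.tendsto_nhds.1 (hlim x hx)) (η / 2) (half_pos hη))
    obtain ⟨r', hr', h2⟩ := Metric.mem_nhdsWithin_iff.1
      ((Metric.tendsto_nhds.1 (hh x hx)) (η / 2) (half_pos hη))
    refine ⟨min r r', lt_min hr hr', fun z hz hzx hzr => ?_, fun y hy hyr => ?_⟩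
    · exact h1 ⟨hzr.trans_le (min_le_left _ _), hz, hzx⟩
    · exact h2 ⟨hyr.trans_le (min_le_right _ _), hy⟩
  choose r hr0 hr1 hr2 using hr
  obtain ⟨δ, hδ, hleb⟩ := lebesgue_number_lemma_of_metric hF
    (c := fun x : F => Metric.ball (x : Euc d) (r x)) (fun x => Metric.isOpen_ball)
    (fun x hx => Set.mem_iUnion.2 ⟨⟨x, hx⟩, Metric.mem_ball_self (hr0 _)⟩)
  refine ⟨δ, hδ, fun x hx hx0 hxδ => ?_⟩
  obtain ⟨y, hy⟩ := hleb (γ x) (hγ x).1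
  have hxb : dist x y < r y := hy (by rw [Metric.mem_ball, (hγ x).2]; exact hxδ)
  have hgb : dist (γ x) y < r y := hy (Metric.mem_ball_self hδ)
  have hxy : x ≠ y := fun h => by
    rw [Metric.infDist_zero_of_mem (h ▸ y.2)] at hx0
    exact lt_irrefl _ hx0
  have h1 := abs_lt.1 (hr1 y x hx hxy hxb)
  have h2 := abs_lt.1 (hr2 y (γ x) (hγ x).1 hgb)
  rw [abs_le]
  constructor <;> linarith

theorem nhdsWithin_diff_singleton_neBot (hd : 1 ≤ d) {x : Euc d}
    (hx : x ∈ closure (interior Z)) : (𝓝[Z \ {x}] x).NeBot := by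
  have : Nonempty (Fin d) := ⟨⟨0, hd⟩⟩
  rw [← mem_closure_iff_nhdsWithin_neBot]
  have h1 := (dense_compl_singleton x).open_subset_closure_inter (isOpen_interior (s := Z))
  have h2 := closure_minimal h1 isClosed_closure hx
  exact closure_mono (fun y hy => (⟨interior_subset hy.1, hy.2⟩ : y ∈ Z \ {x})) h2

end BoundaryLimits

theorem measurable_indicator_of_continuousOn {d : ℕ} {F : Set (Euc d)} (hF : IsClosed F)
    {h : Euc d → ℝ} (hh : ContinuousOn h F) : Measurable (F.indicator h) := by
  classical
  rw [← Set.piecewise_eq_indicator]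
  exact hh.measurable_piecewise continuousOn_const hF.measurableSet

theorem integrableOn_of_continuousOn {d : ℕ} {F : Set (Euc d)} (hF : IsCompact F)
    {h : Euc d → ℝ} (hh : ContinuousOn h F) {S : Measure (Euc d)} (hS : S F ≠ ⊤) :
    IntegrableOn h F S := by
  obtain ⟨C, hC⟩ := hF.exists_bound_of_continuousOn hh
  refine ⟨hh.aestronglyMeasurable hF.measurableSet, ?_⟩
  exact HasFiniteIntegral.restrict_of_bounded C hS.lt_top
    ((ae_restrict_iff' hF.measurableSet).2 (Eventually.of_forall hC))

/-- The one-sided density of the weighted distance to `F`, for a weight with boundary values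
`h`. -/
theorem HasCollarDensity.limDensity_of_tendsto {d : ℕ} {F : Set (Euc d)} {γ : Euc d → Euc d}
    {Z : Set (Euc d)} {S : Measure (Euc d)} (hF : IsCompact F) (hγ : IsNearestPoint F γ)
    (hZ : MeasurableSet Z) (hS : S F ≠ ⊤) (H : HasCollarDensity F γ Z S)
    {f : Euc d → ℝ} (hf : Measurable f) (hf0 : ∀ x, 0 ≤ f x)
    {h : Euc d → ℝ} (hne : ∀ x ∈ F, (𝓝[Z \ {x}] x).NeBot)
    (hlim : ∀ x ∈ F, Tendsto f (𝓝[Z \ {x}] x) (𝓝 (h x)))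
    {A : Set (Euc d)} (hA : MeasurableSet A) (hAF : A ⊆ F) {m : Measure ℝ}
    (hm : ∀ᶠ B in (𝓝[>] (0 : ℝ)).smallSets, MeasurableSet B →
      m B = (volume.withDensity fun x => ENNReal.ofReal (f x)) (collar F γ Z A B)) :
    LimDensity m (𝓝[>] 0) (∫ x in A, h x ∂S) := by
  have hh := continuousOn_of_tendsto hne hlim
  obtain ⟨M, hM⟩ := hF.exists_bound_of_continuousOn hh
  have h0 : ∀ x ∈ F, 0 ≤ h x := fun x hx => by
    have := hne x hx
    exact ge_of_tendsto' (hlim x hx) hf0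
  have heq : ∫ x in A, h x ∂S = ∫ x in A, F.indicator h x ∂S :=
    setIntegral_congr_fun hA fun x hx => (Set.indicator_of_mem (hAF hx) h).symm
  rw [heq]
  refine H.limDensity_withDensity hF hγ hZ hS hf hA hAF
    (measurable_indicator_of_continuousOn hF.isClosed hh) (M := M) ?_ ?_ ?_ hm
  · intro x hx; rw [Set.indicator_of_mem (hAF hx)]; exact h0 x (hAF hx)
  · intro x hx; rw [Set.indicator_of_mem (hAF hx)]; exact (le_abs_self _).trans (hM x (hAF hx))
  · intro η hη
    obtain ⟨δ, hδ, h1⟩ := exists_forall_abs_sub_le hF hγ hh hlim hη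
    refine ⟨δ, hδ, fun x hx hx0 hxδ => ?_⟩
    rw [Set.indicator_of_mem (hγ x).1]
    exact h1 x hx hx0 hxδ

/-! ### Conditional laws and the law of the signed distance. -/

section Conditional

variable {S : Type*} [MeasurableSpace S] {P : Measure S} [IsProbabilityMeasure P]

theorem hasPDF_of_map_restrict {g : S → ℝ} (hg : Measurable g) {s : Set S}
    (hac : (P.restrict s).map g ≪ volume) : HasPDF g (ProbabilityTheory.cond P s) volume := by
  have hc : SFinite (ProbabilityTheory.cond P s) := by unfold ProbabilityTheory.cond; infer_instance
  rw [Real.hasPDF_iff_of_aemeasurable hg.aemeasurable]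
  unfold ProbabilityTheory.cond
  rw [Measure.map_smul]
  exact Measure.smul_absolutelyContinuous.trans hac

/-- Conditioning rescales the restricted law by `(P s)⁻¹`, which the final factor `P.real s`
cancels. If `P s = 0`, the restricted law is zero, so `α = β = 0` by uniqueness of the limit. -/
theorem exists_limits_cond {g : S → ℝ} {s : Set S}
    (hac : (P.restrict s).map g ≪ volume) {α β : ℝ}
    (hα : LimDensity ((P.restrict s).map g) (𝓝[>] 0) α)
    (hβ : LimDensity ((P.restrict s).map g) (𝓝[<] 0) β) :
    ∃ a b : ℝ, HasRightLimit (density g (ProbabilityTheory.cond P s)) a ∧ HasLeftLimit (density g (ProbabilityTheory.cond P s)) b ∧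
      a * P.real s = α ∧ b * P.real s = β := by
  -- When `P s = 0` the inverse is `∞` and `c = 0`, in agreement with `cond P s = 0`.
  set c : ℝ≥0 := (P s)⁻¹.toNNReal with hc
  have hlaw : (ProbabilityTheory.cond P s).map g = c • (P.restrict s).map g := by
    by_cases hs : P s = 0
    · have h0 : P.restrict s = 0 := Measure.restrict_eq_zero.2 hs
      simp [ProbabilityTheory.cond, h0]
    · have : (c : ℝ≥0∞) = (P s)⁻¹ := ENNReal.coe_toNNReal (ENNReal.inv_ne_top.2 hs)
      unfold ProbabilityTheory.cond
      rw [Measure.map_smul, ← this]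
      rfl
  have hac' : (ProbabilityTheory.cond P s).map g ≪ volume := by
    rw [hlaw]; exact Measure.smul_absolutelyContinuous.trans hac
  have hfin : IsFiniteMeasure ((ProbabilityTheory.cond P s).map g) := by rw [hlaw]; infer_instance
  have hαc := hα.const_smul c
  have hβc := hβ.const_smul c
  rw [← hlaw] at hαc hβc
  have hcp : P s ≠ 0 → (c : ℝ) * P.real s = 1 := by
    intro hs
    rw [hc, measureReal_def]
    change ((P s)⁻¹).toReal * (P s).toReal = 1
    rw [ENNReal.toReal_inv, inv_mul_cancel₀]
    exact ENNReal.toReal_ne_zero.2 ⟨hs, measure_ne_top _ _⟩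
  have hzero : P s = 0 → α = 0 ∧ β = 0 := by
    intro hs
    have h0 : (P.restrict s).map g = 0 := by rw [Measure.restrict_eq_zero.2 hs, Measure.map_zero]
    rw [h0] at hα hβ
    refine ⟨hα.eq_zero, ?_⟩
    have h1 := hβ.map_neg (l' := 𝓝[>] 0) (by simpa using tendsto_neg_nhdsGT (a := (0 : ℝ)))
    rw [Measure.map_zero] at h1
    exact h1.eq_zero
  refine ⟨c * α, c * β, hαc.tendsto_rnDeriv nhdsWithin_le_nhds hac',
    hβc.tendsto_rnDeriv nhdsWithin_le_nhds hac', ?_, ?_⟩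
  · by_cases hs : P s = 0
    · rw [(hzero hs).1]; simp
    · rw [mul_right_comm, hcp hs, one_mul]
  · by_cases hs : P s = 0
    · rw [(hzero hs).2]; simp
    · rw [mul_right_comm, hcp hs, one_mul]

end Conditional

section SignedDistance

variable {d : ℕ} {Ω : Set (Euc d)}

theorem signedDistance_of_mem {x : Euc d} (hx : x ∈ Ω) :
    signedDistance Ω x = Metric.infDist x (frontier Ω) := by
  simp [signedDistance, hx]

theorem signedDistance_of_notMem {x : Euc d} (hx : x ∉ Ω) :
    signedDistance Ω x = -Metric.infDist x (frontier Ω) := by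
  simp [signedDistance, hx]

theorem signedDistance_nonneg_iff (hΩ : IsClosed Ω) (hne : (frontier Ω).Nonempty) (x : Euc d) :
    0 ≤ signedDistance Ω x ↔ x ∈ Ω := by
  by_cases hx : x ∈ Ω
  · simp only [signedDistance_of_mem hx, hx, iff_true]
    exact Metric.infDist_nonneg
  · simp only [signedDistance_of_notMem hx, hx, iff_false, not_le, neg_lt_zero]
    exact (isClosed_frontier.notMem_iff_infDist_pos hne).1 fun h => hx (hΩ.frontier_subset h)

theorem measurable_signedDistance (hΩ : IsClosed Ω) : Measurable (signedDistance Ω) := by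
  classical
  have hm := (Metric.continuous_infDist_pt (frontier Ω)).measurable
  have : signedDistance Ω = Ω.piecewise (fun x => Metric.infDist x (frontier Ω))
      (fun x => -Metric.infDist x (frontier Ω)) := by
    funext x
    by_cases hx : x ∈ Ω
    · rw [signedDistance_of_mem hx, Set.piecewise_eq_of_mem _ _ _ hx]
    · rw [signedDistance_of_notMem hx, Set.piecewise_eq_of_notMem _ _ _ hx]
  rw [this]
  exact hm.piecewise hΩ.measurableSet hm.neg

theorem signedDistance_preimage_inter_of_pos {γ : Euc d → Euc d} (A : Set (Euc d)) {B : Set ℝ}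
    (hB : B ⊆ Set.Ioi 0) :
    signedDistance Ω ⁻¹' B ∩ γ ⁻¹' A = collar (frontier Ω) γ Ω A B := by
  ext x
  by_cases hx : x ∈ Ω
  · simp [collar, signedDistance_of_mem hx, hx]
  · have : ¬ -Metric.infDist x (frontier Ω) ∈ B := fun h => by
      have h1 : 0 < -Metric.infDist x (frontier Ω) := hB h
      have h2 : 0 ≤ Metric.infDist x (frontier Ω) := Metric.infDist_nonneg
      linarith
    simp [collar, signedDistance_of_notMem hx, hx, this]

theorem signedDistance_preimage_inter_of_neg {γ : Euc d → Euc d} (A : Set (Euc d)) {B : Set ℝ}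
    (hB : B ⊆ Set.Ioi 0) :
    signedDistance Ω ⁻¹' ((fun x => -x) ⁻¹' B) ∩ γ ⁻¹' A = collar (frontier Ω) γ Ωᶜ A B := by
  ext x
  by_cases hx : x ∈ Ω
  · have : ¬ -Metric.infDist x (frontier Ω) ∈ B := fun h => by
      have h1 : 0 < -Metric.infDist x (frontier Ω) := hB h
      have h2 : 0 ≤ Metric.infDist x (frontier Ω) := Metric.infDist_nonneg
      linarith
    simp [collar, signedDistance_of_mem hx, hx, this]
  · simp [collar, signedDistance_of_notMem hx, hx]

/-- The signed distance pulls null sets back to null sets. -/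
theorem volume_signedDistance_preimage_eq_zero {γ : Euc d → Euc d}
    (hF : IsCompact (frontier Ω)) (hγ : IsNearestPoint (frontier Ω) γ)
    (hF0 : volume (frontier Ω) = 0) {N : Set ℝ} (hN : MeasurableSet N) (hN0 : volume N = 0) :
    volume (signedDistance Ω ⁻¹' N) = 0 := by
  have hneg : volume ((fun x : ℝ => -x) ⁻¹' N) = 0 := by
    have : (fun x : ℝ => -x) ⁻¹' N = -N := rfl
    rw [this, Measure.measure_neg, hN0]
  have h1 := volume_collar_univ_eq_zero hF hγ rfl (hN.inter measurableSet_Ioi)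
    (measure_mono_null Set.inter_subset_left hN0) (Set.inter_subset_right (t := Set.Ioi 0))
  have h2 := volume_collar_univ_eq_zero hF hγ (frontier_compl Ω)
    ((hN.preimage measurable_neg).inter measurableSet_Ioi)
    (measure_mono_null Set.inter_subset_left hneg) (Set.inter_subset_right (t := Set.Ioi 0))
  refine measure_mono_null (fun x hx => ?_) (measure_union_null (measure_union_null h1 h2) hF0)
  by_cases hxF : x ∈ frontier Ω
  · exact Or.inr hxF
  have hpos : 0 < Metric.infDist x (frontier Ω) :=
    (isClosed_frontier.notMem_iff_infDist_pos ⟨_, (hγ x).1⟩).1 hxF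
  rw [Set.mem_preimage] at hx
  by_cases hxΩ : x ∈ Ω
  · rw [signedDistance_of_mem hxΩ] at hx
    exact Or.inl (Or.inl ⟨hxΩ, ⟨hx, hpos⟩, trivial⟩)
  · rw [signedDistance_of_notMem hxΩ] at hx
    exact Or.inl (Or.inr ⟨hxΩ, ⟨hx, hpos⟩, trivial⟩)

end SignedDistance

section Law

variable {d : ℕ} {Ω : Set (Euc d)} {S : Type*} [MeasurableSpace S] {P : Measure S}
  {X : S → Euc d} {f : Euc d → ℝ} {γ : Euc d → Euc d} {g : S → ℝ} {A : Set (Euc d)}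

theorem quasiMeasurePreserving_of_map_eq_withDensity (hX : Measurable X)
    (hXf : P.map X = volume.withDensity (fun x => ENNReal.ofReal (f x))) :
    Measure.QuasiMeasurePreserving X P volume :=
  ⟨hX, hXf ▸ withDensity_absolutelyContinuous _ _⟩

theorem map_restrict_signedDistance_apply (hΩ : IsClosed Ω) (hF : IsCompact (frontier Ω))
    (hγ : IsNearestPoint (frontier Ω) γ) (hX : Measurable X)
    (hXf : P.map X = volume.withDensity (fun x => ENNReal.ofReal (f x)))
    (hg : ∀ s, g s = signedDistance Ω (X s)) (hA : MeasurableSet A)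
    {B : Set ℝ} (hB : MeasurableSet B) :
    (P.restrict (X ⁻¹' (γ ⁻¹' A))).map g B =
      (volume.withDensity fun x => ENNReal.ofReal (f x))
        (signedDistance Ω ⁻¹' B ∩ γ ⁻¹' A) := by
  have hgm : Measurable g := by
    rw [show g = signedDistance Ω ∘ X from funext hg]
    exact (measurable_signedDistance hΩ).comp hX
  have hn : NullMeasurableSet (signedDistance Ω ⁻¹' B ∩ γ ⁻¹' A) volume :=
    (measurable_signedDistance hΩ hB).nullMeasurableSet.inter
      ((hγ.aemeasurable hF).nullMeasurable hA)
  rw [Measure.map_apply hgm hB, Measure.restrict_apply (hgm hB), ← hXf,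
    Measure.map_apply₀ hX.aemeasurable
      (hn.mono_ac (hXf ▸ withDensity_absolutelyContinuous _ _))]
  congr 1
  ext s
  simp [hg]

theorem map_restrict_signedDistance_absolutelyContinuous (hΩ : IsClosed Ω)
    (hF : IsCompact (frontier Ω)) (hF0 : volume (frontier Ω) = 0)
    (hγ : IsNearestPoint (frontier Ω) γ) (hX : Measurable X)
    (hXf : P.map X = volume.withDensity (fun x => ENNReal.ofReal (f x)))
    (hg : ∀ s, g s = signedDistance Ω (X s)) (hA : MeasurableSet A) :
    (P.restrict (X ⁻¹' (γ ⁻¹' A))).map g ≪ volume := by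
  refine Measure.AbsolutelyContinuous.mk fun N hN hN0 => ?_
  rw [map_restrict_signedDistance_apply hΩ hF hγ hX hXf hg hA hN]
  refine withDensity_absolutelyContinuous _ _ (measure_mono_null Set.inter_subset_left ?_)
  exact volume_signedDistance_preimage_eq_zero hF hγ hF0 hN hN0

theorem LimDensity.of_map_neg {m : Measure ℝ} {a : ℝ}
    (h : LimDensity (m.map fun x => -x) (𝓝[>] 0) a) : LimDensity m (𝓝[<] 0) a := by
  have h1 := h.map_neg (l' := 𝓝[<] 0) (by simpa using tendsto_neg_nhdsLT (a := (0 : ℝ)))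
  rw [Measure.map_map measurable_neg measurable_neg] at h1
  simpa [Function.comp_def] using h1

variable {fplus fminus : Euc d → ℝ}

theorem limDensity_map_restrict_signedDistance (hd : 1 ≤ d) (hΩ : IsClosed Ω)
    (hΩb : Bornology.IsBounded Ω) (hΩs : HasPiecewiseSmoothBoundary Ω)
    (hγ : IsNearestPoint (frontier Ω) γ) (hX : Measurable X) (hf : Measurable f)
    (hf0 : ∀ x, 0 ≤ f x)
    (hXf : P.map X = volume.withDensity (fun x => ENNReal.ofReal (f x)))
    (hg : ∀ s, g s = signedDistance Ω (X s))
    (hplus : ∀ x ∈ frontier Ω, Tendsto f (𝓝[Ω \ {x}] x) (𝓝 (fplus x)))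
    (hminus : ∀ x ∈ frontier Ω, Tendsto f (𝓝[Ωᶜ \ {x}] x) (𝓝 (fminus x)))
    (hA : MeasurableSet A) (hAF : A ⊆ frontier Ω) :
    LimDensity ((P.restrict (X ⁻¹' (γ ⁻¹' A))).map g) (𝓝[>] 0) (∫ x in A, fplus x ∂μHE[d - 1]) ∧
    LimDensity ((P.restrict (X ⁻¹' (γ ⁻¹' A))).map g) (𝓝[<] 0)
      (∫ x in A, fminus x ∂μHE[d - 1]) := by
  obtain ⟨hcl, n, p, hp, hdisj⟩ := hΩs
  have hF : IsCompact (frontier Ω) := Metric.isCompact_of_isClosed_isBounded isClosed_frontier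
    (hΩb.subset hΩ.frontier_subset)
  have hin : frontier Ω ⊆ closure (interior Ω) := hcl.symm ▸ hΩ.frontier_subset
  have hout : frontier Ω ⊆ closure (interior Ωᶜ) := by
    rw [hΩ.isOpen_compl.interior_eq, ← frontier_compl]
    exact frontier_subset_closure
  have hS := area_ne_top p hp
  have hpos : ∀ᶠ B in (𝓝[>] (0 : ℝ)).smallSets, B ⊆ Set.Ioi 0 :=
    eventually_smallSets.2 ⟨_, self_mem_nhdsWithin, fun t ht => ht⟩
  constructor
  · refine (hasCollarDensity_of_smoothPieces hd hF hγ rfl hΩ.measurableSet hin hout p hp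
      hdisj).limDensity_of_tendsto hF hγ hΩ.measurableSet hS hf hf0
      (fun x hx => nhdsWithin_diff_singleton_neBot hd (hin hx)) hplus hA hAF ?_
    filter_upwards [hpos] with B hB0 hB
    rw [map_restrict_signedDistance_apply hΩ hF hγ hX hXf hg hA hB,
      signedDistance_preimage_inter_of_pos A hB0]
  · refine LimDensity.of_map_neg ?_
    refine (hasCollarDensity_of_smoothPieces hd hF hγ (frontier_compl Ω)
      hΩ.measurableSet.compl hout (by rwa [compl_compl]) p hp
      hdisj).limDensity_of_tendsto hF hγ hΩ.measurableSet.compl hS hf hf0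
      (fun x hx => nhdsWithin_diff_singleton_neBot hd (hout hx)) hminus hA hAF ?_
    filter_upwards [hpos] with B hB0 hB
    rw [Measure.map_apply measurable_neg hB,
      map_restrict_signedDistance_apply hΩ hF hγ hX hXf hg hA (hB.preimage measurable_neg),
      signedDistance_preimage_inter_of_neg A hB0]

end Law

/-- The law of a random variable whose sign is flipped off a set. -/
theorem map_eq_add_map_neg {S : Type*} [MeasurableSpace S] {P : Measure S} {s : Set S}
    (hs : NullMeasurableSet s P) {g h : S → ℝ} (hg : Measurable g) (hh : AEMeasurable h P)
    (h1 : ∀ x ∈ s, h x = g x) (h0 : ∀ x ∉ s, h x = -g x) :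
    P.map h = (P.restrict s).map g + ((P.restrict sᶜ).map g).map fun x => -x := by
  have hP : P = P.restrict s + P.restrict sᶜ := by
    rw [← Measure.restrict_union₀ disjoint_compl_right.aedisjoint hs.compl, Set.union_compl_self,
      Measure.restrict_univ]
  conv_lhs => rw [hP]
  rw [AEMeasurable.map_add₀ hh.restrict hh.restrict, Measure.map_map measurable_neg hg]
  congr 1
  · exact Measure.map_congr ((ae_restrict_mem₀ hs).mono h1)
  · exact Measure.map_congr ((ae_restrict_mem₀ hs.compl).mono h0)

theorem volume_eq_zero_of_area_ne_top {d : ℕ} (hd : 1 ≤ d) {F : Set (Euc d)}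
    (hS : μHE[d - 1] F ≠ ⊤) : volume F = 0 := by
  have := (Measure.euclideanHausdorffMeasure_zero_or_top (show d - 1 < d by omega) F).resolve_right
    hS
  rwa [EuclideanSpace.euclideanHausdorffMeasure_eq_volume] at this

end DensityJump

/-! ### The jump formula. -/

theorem theorem3 {d : ℕ} (hd : 1 ≤ d)
    (Ω : Set (EuclideanSpace ℝ (Fin d))) (hΩne : Ω.Nonempty) (hΩcl : IsClosed Ω)
    (hΩbd : Bornology.IsBounded Ω) (hΩsm : DensityJump.HasPiecewiseSmoothBoundary Ω)
    {S : Type*} [MeasurableSpace S] (P : Measure S) [IsProbabilityMeasure P]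
    (X : S → EuclideanSpace ℝ (Fin d)) (hX : Measurable X)
    (f : EuclideanSpace ℝ (Fin d) → ℝ) (hf : Measurable f) (hf0 : ∀ x, 0 ≤ f x)
    (hXf : P.map X = volume.withDensity (fun x => ENNReal.ofReal (f x)))
    (fplus fminus : EuclideanSpace ℝ (Fin d) → ℝ)
    (hplus : ∀ x ∈ frontier Ω,
      Tendsto f (𝓝[{x' | 0 ≤ DensityJump.signedDistance Ω x'} \ {x}] x) (𝓝 (fplus x)))
    (hminus : ∀ x ∈ frontier Ω,
      Tendsto f (𝓝[{x' | DensityJump.signedDistance Ω x' < 0} \ {x}] x) (𝓝 (fminus x)))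
    (τ : EuclideanSpace ℝ (Fin d) → ℝ) (hτ : ∀ x, τ x = fplus x - fminus x)
    (γ : EuclideanSpace ℝ (Fin d) → EuclideanSpace ℝ (Fin d))
    (hγ : DensityJump.IsNearestBoundaryPoint Ω γ)
    (g : S → ℝ) (hg : ∀ s, g s = DensityJump.signedDistance Ω (X s))
    (L : S → ℝ) (hL : ∀ s, L s = DensityJump.signIndicator τ γ (X s)) :
    IntegrableOn τ (frontier Ω) (Measure.euclideanHausdorffMeasure (d - 1)) ∧
    HasPDF g (cond P {s | L s = 1}) volume ∧
    HasPDF g (cond P {s | L s = 0}) volume ∧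
    HasPDF (fun s => (2 * L s - 1) * g s) P volume ∧
    ∃ a₁ b₁ a₀ b₀ a b : ℝ,
      DensityJump.HasRightLimit (DensityJump.density g (cond P {s | L s = 1})) a₁ ∧
      DensityJump.HasLeftLimit (DensityJump.density g (cond P {s | L s = 1})) b₁ ∧
      DensityJump.HasRightLimit (DensityJump.density g (cond P {s | L s = 0})) a₀ ∧
      DensityJump.HasLeftLimit (DensityJump.density g (cond P {s | L s = 0})) b₀ ∧
      DensityJump.HasRightLimit (DensityJump.density (fun s => (2 * L s - 1) * g s) P) a ∧
      DensityJump.HasLeftLimit (DensityJump.density (fun s => (2 * L s - 1) * g s) P) b ∧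
      (a₁ - b₁) * P.real {s | L s = 1} - (a₀ - b₀) * P.real {s | L s = 0} =
        ∫ x in frontier Ω, |τ x| ∂(Measure.euclideanHausdorffMeasure (d - 1)) ∧
      (a₁ - b₁) * P.real {s | L s = 1} - (a₀ - b₀) * P.real {s | L s = 0} =
        ∫ x in frontier Ω, (2 * DensityJump.signIndicator τ γ x - 1) * τ x
          ∂(Measure.euclideanHausdorffMeasure (d - 1)) ∧
      (a₁ - b₁) * P.real {s | L s = 1} - (a₀ - b₀) * P.real {s | L s = 0} = a - b := by
  have hγ' : DensityJump.IsNearestPoint (frontier Ω) γ := hγ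
  have hFne : (frontier Ω).Nonempty := ⟨_, (hγ 0).1⟩
  have hF : IsCompact (frontier Ω) := Metric.isCompact_of_isClosed_isBounded isClosed_frontier
    (hΩbd.subset hΩcl.frontier_subset)
  have hFm : MeasurableSet (frontier Ω) := isClosed_frontier.measurableSet
  obtain ⟨hS, hin⟩ : μHE[d - 1] (frontier Ω) ≠ ⊤ ∧ frontier Ω ⊆ closure (interior Ω) := by
    obtain ⟨hcl, n, p, hp, -⟩ := hΩsm
    exact ⟨DensityJump.area_ne_top p hp, hcl.symm ▸ hΩcl.frontier_subset⟩
  have hout : frontier Ω ⊆ closure (interior Ωᶜ) := by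
    rw [hΩcl.isOpen_compl.interior_eq, ← frontier_compl]
    exact frontier_subset_closure
  have hF0 := DensityJump.volume_eq_zero_of_area_ne_top hd hS
  have hset : {x' | 0 ≤ DensityJump.signedDistance Ω x'} = Ω :=
    Set.ext fun x => DensityJump.signedDistance_nonneg_iff hΩcl hFne x
  have hset' : {x' | DensityJump.signedDistance Ω x' < 0} = Ωᶜ :=
    Set.ext fun x => not_le.symm.trans (DensityJump.signedDistance_nonneg_iff hΩcl hFne x).not
  rw [hset] at hplus
  rw [hset'] at hminus
  have hcp := DensityJump.continuousOn_of_tendsto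
    (fun x hx => DensityJump.nhdsWithin_diff_singleton_neBot hd (hin hx)) hplus
  have hcm := DensityJump.continuousOn_of_tendsto
    (fun x hx => DensityJump.nhdsWithin_diff_singleton_neBot hd (hout hx)) hminus
  have hcτ : ContinuousOn τ (frontier Ω) := (hcp.sub hcm).congr fun x _ => hτ x
  have hip := DensityJump.integrableOn_of_continuousOn hF hcp hS
  have him := DensityJump.integrableOn_of_continuousOn hF hcm hS
  have hiτ := DensityJump.integrableOn_of_continuousOn hF hcτ hS
  have hτm := DensityJump.measurable_indicator_of_continuousOn isClosed_frontier hcτ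
  -- `A₁` and `A₀` partition `∂Ω` into Borel sets, since `τ` is continuous there. The events `Λ = 1`
  -- and `Λ = 0` are their preimages under `γ ∘ X`; these are only null measurable, because `γ` is
  -- arbitrary at ties.
  set A₁ : Set (EuclideanSpace ℝ (Fin d)) := {x | x ∈ frontier Ω ∧ 0 ≤ τ x} with hA₁
  set A₀ : Set (EuclideanSpace ℝ (Fin d)) := {x | x ∈ frontier Ω ∧ ¬ 0 ≤ τ x} with hA₀
  have hm₁ : MeasurableSet A₁ := by
    convert hFm.inter (hτm measurableSet_Ici : MeasurableSet (_ ⁻¹' Set.Ici (0 : ℝ))) using 1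
    ext x
    by_cases hx : x ∈ frontier Ω <;> simp [hA₁, hx]
  have hm₀ : MeasurableSet A₀ := by
    convert hFm.diff hm₁ using 1
    ext x
    by_cases hx : x ∈ frontier Ω <;> simp [hA₀, hA₁, hx]
  have hs₁ : A₁ ⊆ frontier Ω := fun x hx => hx.1
  have hs₀ : A₀ ⊆ frontier Ω := fun x hx => hx.1
  have hL₁ : {s | L s = 1} = X ⁻¹' (γ ⁻¹' A₁) := by
    ext s
    by_cases h : 0 ≤ τ (γ (X s)) <;> simp [hL, DensityJump.signIndicator, hA₁, h, (hγ (X s)).1]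
  have hL₀ : {s | L s = 0} = X ⁻¹' (γ ⁻¹' A₀) := by
    ext s
    by_cases h : 0 ≤ τ (γ (X s)) <;>
      simp [hL, DensityJump.signIndicator, hA₀, h, (hγ (X s)).1, -not_le]
  have hcompl : (X ⁻¹' (γ ⁻¹' A₁))ᶜ = X ⁻¹' (γ ⁻¹' A₀) := by
    ext s
    simp [hA₀, hA₁, (hγ (X s)).1]
  have hnm : NullMeasurableSet (X ⁻¹' (γ ⁻¹' A₁)) P :=
    ((hγ'.aemeasurable hF).nullMeasurable hm₁).preimage
      (DensityJump.quasiMeasurePreserving_of_map_eq_withDensity hX hXf)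
  have hgm : Measurable g := by
    rw [show g = DensityJump.signedDistance Ω ∘ X from funext hg]
    exact (DensityJump.measurable_signedDistance hΩcl).comp hX
  have hac₁ := DensityJump.map_restrict_signedDistance_absolutelyContinuous hΩcl hF hF0 hγ' hX hXf
    hg hm₁
  have hac₀ := DensityJump.map_restrict_signedDistance_absolutelyContinuous hΩcl hF hF0 hγ' hX hXf
    hg hm₀
  obtain ⟨hα₁, hβ₁⟩ := DensityJump.limDensity_map_restrict_signedDistance hd hΩcl hΩbd hΩsm hγ' hX
    hf hf0 hXf hg hplus hminus hm₁ hs₁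
  obtain ⟨hα₀, hβ₀⟩ := DensityJump.limDensity_map_restrict_signedDistance hd hΩcl hΩbd hΩsm hγ' hX
    hf hf0 hXf hg hplus hminus hm₀ hs₀
  have hLind : L = (X ⁻¹' (γ ⁻¹' A₁)).indicator fun _ => 1 := by
    funext s
    by_cases h : 0 ≤ τ (γ (X s)) <;>
      simp [hL, DensityJump.signIndicator, hA₁, h, (hγ (X s)).1, Set.indicator]
  have hLm : AEMeasurable L P := by
    rw [hLind]; exact aemeasurable_const.indicator₀ hnm
  have hhm : AEMeasurable (fun s => (2 * L s - 1) * g s) P :=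
    ((hLm.const_mul 2).sub_const 1).mul hgm.aemeasurable
  have hlaw := DensityJump.map_eq_add_map_neg hnm hgm hhm
    (fun s hs => by rw [hLind, Set.indicator_of_mem hs]; ring)
    (fun s hs => by rw [hLind, Set.indicator_of_notMem hs]; ring)
  rw [hcompl] at hlaw
  have hac : P.map (fun s => (2 * L s - 1) * g s) ≪ volume := by
    rw [hlaw]
    refine hac₁.add_left ?_
    have := hac₀.map (f := fun x : ℝ => -x) measurable_neg
    rwa [(Measure.measurePreserving_neg (volume : Measure ℝ)).map_eq] at this
  -- Negation over `A₀` exchanges the two sides of `0`. The right limit pairs `f⁺` on `A₁` with `f⁻`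
  -- on `A₀`, and the left limit pairs `f⁻` on `A₁` with `f⁺` on `A₀`.
  have hr := hα₁.add (hβ₀.map_neg (l' := 𝓝[>] 0)
    (by simpa using tendsto_neg_nhdsGT (a := (0 : ℝ))))
  have hl := hβ₁.add (hα₀.map_neg (l' := 𝓝[<] 0)
    (by simpa using tendsto_neg_nhdsLT (a := (0 : ℝ))))
  rw [← hlaw] at hr hl
  obtain ⟨a₁, b₁, h1, h2, h3, h4⟩ := DensityJump.exists_limits_cond hac₁ hα₁ hβ₁
  obtain ⟨a₀, b₀, h5, h6, h7, h8⟩ := DensityJump.exists_limits_cond hac₀ hα₀ hβ₀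
  rw [hL₁, hL₀]
  have hτint : ∀ {A}, A ⊆ frontier Ω → ∫ x in A, τ x ∂μHE[d - 1] =
      ∫ x in A, fplus x ∂μHE[d - 1] - ∫ x in A, fminus x ∂μHE[d - 1] := fun {A} hA => by
    rw [← integral_sub (hip.mono_set hA) (him.mono_set hA)]
    simp only [hτ]
  have habs : ∫ x in frontier Ω, |τ x| ∂μHE[d - 1] =
      ∫ x in A₁, τ x ∂μHE[d - 1] - ∫ x in A₀, τ x ∂μHE[d - 1] := by
    have hu : frontier Ω = A₁ ∪ A₀ := by
      ext x
      by_cases h : 0 ≤ τ x <;> simp [hA₁, hA₀, h, -not_le]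
    conv_lhs => rw [hu]
    have hia : IntegrableOn (fun x => |τ x|) (frontier Ω) μHE[d - 1] := hiτ.abs
    have hdj : Disjoint A₁ A₀ := Set.disjoint_left.2 fun x hx hx' => hx'.2 hx.2
    rw [setIntegral_union hdj hm₀ (hia.mono_set hs₁) (hia.mono_set hs₀), sub_eq_add_neg, ← integral_neg,
      setIntegral_congr_fun hm₁ fun x hx => abs_of_nonneg hx.2,
      setIntegral_congr_fun hm₀ fun x hx => abs_of_nonpos (not_le.1 hx.2).le]
  have hsgn : ∫ x in frontier Ω, (2 * DensityJump.signIndicator τ γ x - 1) * τ x ∂μHE[d - 1] =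
      ∫ x in frontier Ω, |τ x| ∂μHE[d - 1] := by
    refine setIntegral_congr_fun hFm fun x hx => ?_
    -- On `∂Ω` the map `γ` is the identity, so the indicator reads the sign of `τ x` itself.
    simp only [DensityJump.signIndicator, hγ'.apply_of_mem hx]
    split_ifs with h
    · rw [abs_of_nonneg h]; ring
    · rw [abs_of_neg (not_le.1 h)]; ring
  refine ⟨hiτ, DensityJump.hasPDF_of_map_restrict hgm hac₁,
    DensityJump.hasPDF_of_map_restrict hgm hac₀,
    (Real.hasPDF_iff_of_aemeasurable hhm).2 hac, a₁, b₁, a₀, b₀, _, _, h1, h2, h5, h6,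
    hr.tendsto_rnDeriv nhdsWithin_le_nhds hac, hl.tendsto_rnDeriv nhdsWithin_le_nhds hac, ?_⟩
  -- All the expressions reduce to the integrals of `f⁺` and `f⁻` over `A₁` and `A₀`, combined as
  -- `∫_{A₁} τ - ∫_{A₀} τ`.
  rw [hsgn, habs, hτint hs₁, hτint hs₀, sub_mul, sub_mul, h3, h4, h7, h8]
  refine ⟨rfl, rfl, by ring⟩
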